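/- **Setting.** Let $\{(y_i,Y_i,z_i)\}_{i\ge1}$ be i.i.d., where $y_i$ is scalar, $Y_i\in\mathbb R^{d_1}$ is endogenous and $z_i$ is exogenous. Let $x_{1i}=x_1(z_i)\in\mathbb R^{d_2}$ be the included exogenous variables and $d=d_1+d_2$. The model is $$y_i=X_i'\beta+\varepsilon_i,\qquad X_i=(Y_i',x_{1i}')'=f(z_i)+u_i,\qquad f(z_i)=(E[Y_i|z_i]',x_{1i}')',\quad u_i=(Y_i'-E[Y_i|z_i]',0')'.$$ Write $f_i=f(z_i)$, and let $y,\varepsilon,X,f,u$ denote also the vectors and matrices with $N$ rows formed by the first $N$ observations. Let $\psi_1,\psi_2,\dots$ be functions of $z$. For each $N$ let $k=k(N)\le K=K(N)$, and let $m=1,\dots,M=\binom Kk$ enumerate the subsets of size $k$ of $\{1,\dots,K\}$. Let $Z^k_{m,i}\in\mathbb R^{k+d_2}$ consist of the $\psi_j(z_i)$ with $j$ in the $m$-th subset and of $x_{1i}$, let $Z^k_m$ be the matrix with rows $Z^{k\prime}_{m,i}$, $i\le N$, and put $$P^k_m=Z^k_m(Z_m^{k\prime}Z^k_m)^{-1}Z_m^{k\prime},\qquad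 P^k=\frac1M\sum_{m=1}^MP^k_m,\qquad \widehat\beta=(X'P^kX)^{-1}X'P^ky .$$ **Assumptions.** 1. (i) $y_i$ and $X_i$ have finite fourth moments, and $E[\varepsilon_i^2]=\sigma_\varepsilon^2>0$. (ii) $E[\varepsilon_i|z_i]=0$ (and $E[u_i|z_i]=0$ by construction). (iii) For each coordinate $a$ and all integers $r,s\ge0$ with $r+s\le4$, $E[\varepsilon_i^ru_{ia}^s|z_i]$ is constant. (iv) $f_i$ is bounded. (v) $E[f_if_i']$ is nonsingular. (vi) With probability approaching one, $Z_m^{k\prime}Z_m^k$ is nonsingular for all $m=1,\dots,M$. (vii) $\max_{i\le N}P^k_{ii}\to0$ in probability. 2. There are matrices $\Pi^k_m$ with $\frac1M\sum_{m=1}^ME\|f(z_i)-\Pi_m^{k\prime}Z^k_{m,i}\|^2\to0$ as $N\to\infty$ along $k=k(N)$. 3. $k\to\infty$ and $k^2/N\to0$ as $N\to\infty$. 4. $E[u_i\varepsilon_i|z_i]=\sigma_{u\varepsilon}\ne0$ is constant. **Conclusion.** Let $H=f'f/N$, $P_f=f(f'f)^{-1}f'$ and $$S(k)=H^{-1}\left[\sigma_{u\varepsilon}\sigma_{u\varepsilon}'\frac{k^2}{N}+\sigma_\varepsilon^2\frac{f'(I-P^k)(I-P_f)(I-P^k)f}{N}\right]H^{-1}.$$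 Then there is a decomposition $$N(\widehat\beta-\beta)(\widehat\beta-\beta)'=\widehat Q(k)+\widehat r(k),\qquad E[\widehat Q(k)\,|\,z_1,\dots,z_N]=\sigma_\varepsilon^2H^{-1}+S(k)+T(k),$$ in which each entry of $\widehat Q(k)$ is a polynomial of degree at most four in the errors $\varepsilon_i$, $u_{ia}$ ($i\le N$, $a\le d$) with coefficients that are measurable functions of $z_1,\dots,z_N$, and in which $\widehat r(k)$ and $T(k)$ are of smaller order in probability than $S(k)$: for the Frobenius norm, $\|\widehat r(k)\|=o_p(\|S(k)\|)$ and $\|T(k)\|=o_p(\|S(k)\|)$ as $N\to\infty$. (The conditional expectation is understood in the usual extended sense: $\widehat Q(k)$ is integrable on each of countably many events in $\sigma(z_1,\dots,z_N)$ that cover the probability space up to a null set.) -/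

import Mathlib

open MeasureTheory ProbabilityTheory Filter Topology

noncomputable section

namespace CSA

/-! ### Sample matrices

The regressors and the reduced form have coordinates indexed by `Fin d₁ ⊕ Fin d₂`: the first block
belongs to the endogenous variables `Y`, the second one to the included exogenous variables
`x₁ = x₁(z)`, which are functions of the exogenous vector `z`. -/

/-- The vector `X = (Y, x₁(z))` of regressors. -/
def regressor {𝒵 : Type*} {d₁ d₂ : ℕ} (x₁ : 𝒵 → Fin d₂ → ℝ) (Y : Fin d₁ → ℝ) (z : 𝒵) :
    Fin d₁ ⊕ Fin d₂ → ℝ :=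
  Sum.elim Y (x₁ z)

/-- The reduced form `f(z) = (E[Y | z], x₁(z))`, where `g(z) = E[Y | z]`. -/
def reducedForm {𝒵 : Type*} {d₁ d₂ : ℕ} (g : 𝒵 → Fin d₁ → ℝ) (x₁ : 𝒵 → Fin d₂ → ℝ) (z : 𝒵) :
    Fin d₁ ⊕ Fin d₂ → ℝ :=
  Sum.elim (g z) (x₁ z)

/-- The structural error `ε = y - X'β`. -/
def structuralError {𝒵 : Type*} {d₁ d₂ : ℕ} (x₁ : 𝒵 → Fin d₂ → ℝ) (β : Fin d₁ ⊕ Fin d₂ → ℝ)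
    (y : ℝ) (Y : Fin d₁ → ℝ) (z : 𝒵) : ℝ :=
  y - regressor x₁ Y z ⬝ᵥ β

/-- The reduced form error `u = X - f(z) = (Y - E[Y | z], 0)`. -/
def reducedFormError {𝒵 : Type*} {d₁ d₂ : ℕ} (g : 𝒵 → Fin d₁ → ℝ) (x₁ : 𝒵 → Fin d₂ → ℝ)
    (Y : Fin d₁ → ℝ) (z : 𝒵) : Fin d₁ ⊕ Fin d₂ → ℝ :=
  regressor x₁ Y z - reducedForm g x₁ z

/-- The matrix with rows `v 0, …, v (N - 1)`. -/
def rows {ι : Type*} (N : ℕ) (v : ℕ → ι → ℝ) : Matrix (Fin N) ι ℝ :=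
  Matrix.of fun i => v i

/-! ### Complete subset averaging -/

/-- The instrument vector of the model with the subset `s` of the `K` excluded instruments
`ψ 0, …, ψ (K - 1)`: the selected `ψ j (z)`, followed by `x₁(z)`. -/
def instr {𝒵 : Type*} {d₂ : ℕ} (ψ : ℕ → 𝒵 → ℝ) (x₁ : 𝒵 → Fin d₂ → ℝ) {K : ℕ}
    (s : Finset (Fin K)) (z : 𝒵) : {j // j ∈ s} ⊕ Fin d₂ → ℝ :=
  Sum.elim (fun j => ψ (j : Fin K) z) (x₁ z)

/-- The `N × (k + d₂)` instrument matrix of the model with the subset `s`. -/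
def instrMatrix {𝒵 : Type*} {d₂ : ℕ} (N : ℕ) (ψ : ℕ → 𝒵 → ℝ) (x₁ : 𝒵 → Fin d₂ → ℝ) {K : ℕ}
    (s : Finset (Fin K)) (z : ℕ → 𝒵) : Matrix (Fin N) ({j // j ∈ s} ⊕ Fin d₂) ℝ :=
  rows N fun i => instr ψ x₁ s (z i)

/-- `A (A'A)⁻¹ A'`, the projection onto the column space of `A` when `A'A` is nonsingular. -/
def proj {m n : Type*} [Fintype m] [Fintype n] [DecidableEq n] (A : Matrix m n ℝ) :
    Matrix m m ℝ :=
  A * (A.transpose * A)⁻¹ * A.transpose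

/-- The average `P^k` of the projection matrices over all subsets of `k` of the `K` instruments. -/
def csaP {𝒵 : Type*} {d₂ : ℕ} (N : ℕ) (ψ : ℕ → 𝒵 → ℝ) (x₁ : 𝒵 → Fin d₂ → ℝ) (K k : ℕ)
    (z : ℕ → 𝒵) : Matrix (Fin N) (Fin N) ℝ :=
  ((K.choose k : ℕ) : ℝ)⁻¹ •
    ∑ s ∈ Finset.powersetCard k (Finset.univ : Finset (Fin K)), proj (instrMatrix N ψ x₁ s z)

/-- The estimator `(X'PX)⁻¹ X'Py`. -/
def ivEstimator {m n : Type*} [Fintype m] [Fintype n] [DecidableEq n] (P : Matrix m m ℝ)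
    (X : Matrix m n ℝ) (y : m → ℝ) : n → ℝ :=
  (X.transpose * P * X)⁻¹.mulVec ((X.transpose * P).mulVec y)

/-! ### The leading terms -/

/-- `H = f'f / N`. -/
def Hmat {n : Type*} [Fintype n] (N : ℕ) (f : Matrix (Fin N) n ℝ) : Matrix n n ℝ :=
  (N : ℝ)⁻¹ • (f.transpose * f)

/-- `S(k) = H⁻¹ [σ_{uε} σ_{uε}' k²/N + σ_ε² f'(I - P)(I - P_f)(I - P)f / N] H⁻¹`. -/
def Smat {n : Type*} [Fintype n] [DecidableEq n] (N k : ℕ) (σue : n → ℝ) (σε2 : ℝ)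
    (f : Matrix (Fin N) n ℝ) (P : Matrix (Fin N) (Fin N) ℝ) : Matrix n n ℝ :=
  (Hmat N f)⁻¹ *
    (((k : ℝ) ^ 2 / (N : ℝ)) • Matrix.vecMulVec σue σue +
      (σε2 / (N : ℝ)) • (f.transpose * (1 - P) * (1 - proj f) * (1 - P) * f)) *
    (Hmat N f)⁻¹

/-! ### Probabilistic notions -/

/-- The Frobenius norm `√tr(A'A)`. -/
def frob {n : Type*} [Fintype n] (A : Matrix n n ℝ) : ℝ :=
  Real.sqrt (A.transpose * A).trace

/-- `A_N = o_p(b_N)` for random matrices `A_N` and random variables `b_N ≥ 0`: for each `δ > 0`,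
the probability of `‖A_N‖ > δ b_N` tends to zero. -/
def IsLittleOProb {Ω n : Type*} [MeasurableSpace Ω] [Fintype n] (μ : Measure Ω)
    (A : ℕ → Ω → Matrix n n ℝ) (b : ℕ → Ω → ℝ) : Prop :=
  ∀ δ : ℝ, 0 < δ → Tendsto (fun N => μ {ω | δ * b N ω < frob (A N ω)}) atTop (𝓝 0)

/-- `C` is a version of the conditional expectation `E[X | m]`. As usual, `X` need not be
integrable on the whole space: it suffices that it is integrable on each of countably many events
in `m` that cover the space, and on these the conditional expectation is the usual one. -/
def HasCondExp {Ω : Type*} [MeasurableSpace Ω] (μ : Measure Ω) (m : MeasurableSpace Ω)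
    (X C : Ω → ℝ) : Prop :=
  ∃ A : ℕ → Set Ω, (∀ n, MeasurableSet[m] (A n)) ∧ (∀ᵐ ω ∂μ, ∃ n, ω ∈ A n) ∧
    ∀ n, IntegrableOn X (A n) μ ∧ μ[(A n).indicator X | m] =ᵐ[μ] (A n).indicator C

/-- Polynomials in the `N (1 + d)` error variables `ε_i` (the variable `(i, none)`) and `u_{ia}`
(the variable `(i, some a)`), whose coefficients are functions of `(z_1, …, z_N)`. -/
abbrev ErrPoly (𝒵 n : Type*) (N : ℕ) : Type _ :=
  MvPolynomial (Fin N × Option n) ((Fin N → 𝒵) → ℝ)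

/-- The value of such a polynomial at a sample of `z`, `ε` and `u`. -/
def ErrPoly.value {𝒵 n : Type*} {N : ℕ} (p : ErrPoly 𝒵 n N) (z : ℕ → 𝒵) (ε : ℕ → ℝ)
    (u : ℕ → n → ℝ) : ℝ :=
  MvPolynomial.eval₂ (Pi.evalRingHom (fun _ : Fin N → 𝒵 => ℝ) fun i : Fin N => z i)
    (fun v : Fin N × Option n => Option.elim v.2 (ε v.1) (u v.1)) p

end CSA

end

/-!
Everything is done conditionally on `z`. Write `F` for the reduced form matrix, `P` for the average
of the projections, `L = PF`, `α = L'ε`, `b = u'Pε`, `G = F'PF / N`, `B₁ = (L'u + u'L) / N` and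
`B₂ = u'Pu / N`. Then `X'PX / N = G + B₁ + B₂` and `N (β̂ - β) = (G + B₁ + B₂)⁻¹ (α + b)`. The
conditional moments show `‖α‖ = O_p(√N)`, `‖b‖ = O_p(k)`, `‖B₁‖ = O_p(1/√N)` and
`‖B₂‖ = O_p(k/N)`, so expanding the inverse to the order that matters gives
`N (β̂ - β)(β̂ - β)' = Q + r` with
`Q = G⁻¹ [(α + b)(α + b)' - B₁ G⁻¹ αα' - αα' G⁻¹ B₁] G⁻¹ / N` (`leadingTerm`) and
`‖r‖ = O_p(k / N)` (`norm_error_sub_leadingTerm_le`). Since `σ_{uε} ≠ 0`, `S(k)` is at least of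
order `k² / N`, and `r` is negligible because `k → ∞`.

The point that makes the conditional mean tractable is that the exact inverse of `G` is kept, and
not expanded around `H`. With `W` the residual of `PF` after regression on `F`, the identity
`G⁻¹ (L'L) G⁻¹ / N = H⁻¹ + G⁻¹ (W'W / N) G⁻¹` (`sandwich_eq`) holds, and
`W'W = F'(I - P)(I - P_F)(I - P)F` is the matrix in `S(k)`. The mean of `bb'` contributes
`σ_{uε} σ_{uε}' (tr P)²` up to `O(‖P‖²) = O(k)`, and the means of `αb'` and of `B₁ G⁻¹ αα'` are of
smaller order than `k² + ‖W‖²` (`exists_norm_mean_sub_le`). What is left is the difference of the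
sandwiches with `G⁻¹` and with `H⁻¹`; it is small because `G - H` tends to zero in probability.

The conditional moments reduce to moments of words of at most four error letters, for which the
conditional expectation given the whole sample of `z` factors over the observations
(`condExp_prod_eq_prod_condExp`). The orders in probability follow from a conditional Markov
inequality (`exists_eventuallyProb_le`); `H → E[ff']` is the law of large numbers, and `G - H → 0`
follows from the approximation of `f` by the instruments (`tendstoProbOne_gram_sub_Hmat`).
-/

namespace CSA

open Matrix

/-! ### Averages of orthogonal projections -/

section LinearAlgebra

attribute [local instance] Matrix.frobeniusNormedAddCommGroup Matrix.frobeniusNormedSpace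

variable {l m n ι : Type*} [Fintype l] [Fintype m] [Fintype n]

lemma norm_sq_eq_sum (A : Matrix m n ℝ) : ‖A‖ ^ 2 = ∑ i, ∑ j, A i j ^ 2 := by
  rw [frobenius_norm_def, ← Real.sqrt_eq_rpow, Real.sq_sqrt (by positivity)]
  simp

lemma norm_sq_eq_trace (A : Matrix m n ℝ) : ‖A‖ ^ 2 = (Aᵀ * A).trace := by
  rw [norm_sq_eq_sum, Finset.sum_comm]
  simp [trace, mul_apply, pow_two]

lemma frob_eq_norm (A : Matrix n n ℝ) : frob A = ‖A‖ := by
  rw [frob, ← norm_sq_eq_trace, Real.sqrt_sq (norm_nonneg _)]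

lemma abs_entry_le_norm (A : Matrix m n ℝ) (i : m) (j : n) : |A i j| ≤ ‖A‖ := by
  refine abs_le_of_sq_le_sq ?_ (norm_nonneg _)
  rw [norm_sq_eq_sum]
  calc A i j ^ 2 ≤ ∑ j, A i j ^ 2 :=
        Finset.single_le_sum (f := fun j => A i j ^ 2) (fun _ _ => sq_nonneg _) (Finset.mem_univ j)
    _ ≤ _ := Finset.single_le_sum (f := fun i => ∑ j, A i j ^ 2)
        (fun _ _ => Finset.sum_nonneg fun _ _ => sq_nonneg _) (Finset.mem_univ i)

lemma norm_le_sum_abs (A : Matrix m n ℝ) : ‖A‖ ≤ ∑ i, ∑ j, |A i j| := by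
  refine abs_le_of_sq_le_sq' ?_ (by positivity) |>.2
  rw [norm_sq_eq_sum]
  calc ∑ i, ∑ j, A i j ^ 2 ≤ ∑ i, (∑ j, |A i j|) ^ 2 := by
        refine Finset.sum_le_sum fun i _ => ?_
        simpa using Finset.sum_sq_le_sq_sum_of_nonneg (s := Finset.univ) (f := fun j => |A i j|)
          fun _ _ => abs_nonneg _
    _ ≤ _ := Finset.sum_sq_le_sq_sum_of_nonneg fun _ _ => by positivity

lemma norm_le_of_abs_le (A : Matrix m n ℝ) {c : ℝ} (h : ∀ i j, |A i j| ≤ c) :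
    ‖A‖ ≤ Fintype.card m * Fintype.card n * c := by
  refine (norm_le_sum_abs A).trans ?_
  calc ∑ i, ∑ j, |A i j| ≤ ∑ _i : m, ∑ _j : n, c :=
        Finset.sum_le_sum fun i _ => Finset.sum_le_sum fun j _ => h i j
    _ = _ := by simp [mul_assoc]

lemma norm_transpose_mul_self_le (A : Matrix m n ℝ) : ‖Aᵀ * A‖ ≤ ‖A‖ ^ 2 := by
  refine (frobenius_norm_mul _ _).trans ?_
  rw [frobenius_norm_transpose, pow_two]

/-- Symmetric idempotent matrices, that is, matrices of orthogonal projections. -/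
structure IsOrthProj (Q : Matrix m m ℝ) : Prop where
  transpose_eq : Qᵀ = Q
  mul_self : Q * Q = Q

namespace IsOrthProj

variable {Q : Matrix m m ℝ}

lemma transpose_mul_mul {p : Type*} (h : IsOrthProj Q) (A : Matrix m p ℝ) :
    (Q * A)ᵀ * (Q * A) = Aᵀ * Q * A := by
  rw [transpose_mul, h.transpose_eq, Matrix.mul_assoc, ← Matrix.mul_assoc Q Q, h.mul_self,
    Matrix.mul_assoc]

lemma one_sub [DecidableEq m] (h : IsOrthProj Q) : IsOrthProj (1 - Q) where
  transpose_eq := by rw [transpose_sub, transpose_one, h.transpose_eq]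
  mul_self := by
    rw [Matrix.mul_sub, Matrix.sub_mul, Matrix.sub_mul, h.mul_self]; simp

lemma norm_mul_le [DecidableEq m] (h : IsOrthProj Q) (A : Matrix m n ℝ) : ‖Q * A‖ ≤ ‖A‖ := by
  refine abs_le_of_sq_le_sq' ?_ (norm_nonneg _) |>.2
  have h1 : ‖A‖ ^ 2 = ‖Q * A‖ ^ 2 + ‖(1 - Q) * A‖ ^ 2 := by
    rw [norm_sq_eq_trace, norm_sq_eq_trace, norm_sq_eq_trace, h.transpose_mul_mul,
      h.one_sub.transpose_mul_mul, ← trace_add, Matrix.mul_sub, Matrix.sub_mul]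
    simp
  nlinarith [sq_nonneg ‖(1 - Q) * A‖]

lemma norm_sq (h : IsOrthProj Q) : ‖Q‖ ^ 2 = Q.trace := by
  rw [norm_sq_eq_trace, h.transpose_eq, h.mul_self]

lemma diag_nonneg (h : IsOrthProj Q) (i : m) : 0 ≤ Q i i := by
  have h1 : Q i i = ∑ j, Q i j * Q i j := by
    have h2 := congrFun (congrFun h.mul_self i) i
    rw [mul_apply] at h2
    rw [← h2]
    refine Finset.sum_congr rfl fun j _ => ?_
    rw [← congrFun (congrFun h.transpose_eq i) j, transpose_apply]
  rw [h1]
  exact Finset.sum_nonneg fun j _ => mul_self_nonneg _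

end IsOrthProj

section Proj

variable [DecidableEq n]

lemma transpose_proj (A : Matrix m n ℝ) : (proj A)ᵀ = proj A := by
  rw [proj, transpose_mul, transpose_mul, transpose_transpose, transpose_nonsing_inv,
    transpose_mul, transpose_transpose, Matrix.mul_assoc]

/-- When `A'A` is singular its Mathlib inverse is zero, and so is `proj A`: it is a projection in
that case, too. -/
lemma isOrthProj_proj (A : Matrix m n ℝ) : IsOrthProj (proj A) where
  transpose_eq := transpose_proj A
  mul_self := by
    by_cases h : IsUnit (Aᵀ * A).det
    · calc proj A * proj A = A * ((Aᵀ * A)⁻¹ * (Aᵀ * A)) * (Aᵀ * A)⁻¹ * Aᵀ := by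
            simp only [proj, Matrix.mul_assoc]
        _ = proj A := by rw [nonsing_inv_mul _ h, Matrix.mul_one, proj]
    · simp [proj, nonsing_inv_apply_not_isUnit _ h]

lemma proj_mul_self {A : Matrix m n ℝ} (h : IsUnit (Aᵀ * A).det) : proj A * A = A := by
  rw [proj, Matrix.mul_assoc, Matrix.mul_assoc, nonsing_inv_mul _ h, Matrix.mul_one]

lemma trace_proj {A : Matrix m n ℝ} (h : IsUnit (Aᵀ * A).det) :
    (proj A).trace = Fintype.card n := by
  rw [proj, Matrix.mul_assoc, trace_mul_comm, Matrix.mul_assoc, nonsing_inv_mul _ h, trace_one]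

lemma trace_proj_le (A : Matrix m n ℝ) : (proj A).trace ≤ Fintype.card n := by
  by_cases h : IsUnit (Aᵀ * A).det
  · exact (trace_proj h).le
  · simp [proj, nonsing_inv_apply_not_isUnit _ h]

end Proj

lemma norm_avg_mul_le [DecidableEq m] {s : Finset ι} (hs : s.Nonempty) {Q : ι → Matrix m m ℝ}
    (hQ : ∀ i ∈ s, IsOrthProj (Q i)) (A : Matrix m n ℝ) :
    ‖((s.card : ℝ)⁻¹ • ∑ i ∈ s, Q i) * A‖ ≤ ‖A‖ := by
  have hc : (0 : ℝ) < s.card := by exact_mod_cast hs.card_pos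
  rw [smul_mul, Matrix.sum_mul, norm_smul, norm_inv, Real.norm_natCast, inv_mul_le_iff₀ hc]
  refine (norm_sum_le _ _).trans ?_
  calc ∑ i ∈ s, ‖Q i * A‖ ≤ ∑ _i ∈ s, ‖A‖ := Finset.sum_le_sum fun i hi => (hQ i hi).norm_mul_le A
    _ = _ := by simp

lemma norm_avg_le {s : Finset ι} (hs : s.Nonempty) {Q : ι → Matrix m m ℝ} {c : ℝ}
    (hQ : ∀ i ∈ s, ‖Q i‖ ≤ c) : ‖(s.card : ℝ)⁻¹ • ∑ i ∈ s, Q i‖ ≤ c := by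
  have hc : (0 : ℝ) < s.card := by exact_mod_cast hs.card_pos
  rw [norm_smul, norm_inv, Real.norm_natCast, inv_mul_le_iff₀ hc]
  refine (norm_sum_le _ _).trans ?_
  calc ∑ i ∈ s, ‖Q i‖ ≤ ∑ _i ∈ s, c := Finset.sum_le_sum fun i hi => hQ i hi
    _ = _ := by simp

end LinearAlgebra

section CsaProjection

attribute [local instance] Matrix.frobeniusNormedAddCommGroup Matrix.frobeniusNormedSpace

variable {𝒵 : Type*} {d₂ : ℕ} {n : Type*} [Fintype n] (N : ℕ) (ψ : ℕ → 𝒵 → ℝ)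
  (x₁ : 𝒵 → Fin d₂ → ℝ) (K k : ℕ) (z : ℕ → 𝒵)

/-- All the instrument matrices with `k` of the `K` instruments have full column rank. -/
def FullRank : Prop :=
  ∀ s ∈ Finset.powersetCard k (Finset.univ : Finset (Fin K)),
    IsUnit ((instrMatrix N ψ x₁ s z)ᵀ * instrMatrix N ψ x₁ s z).det

lemma csaP_eq : csaP N ψ x₁ K k z =
    ((Finset.powersetCard k (Finset.univ : Finset (Fin K))).card : ℝ)⁻¹ •
      ∑ s ∈ Finset.powersetCard k (Finset.univ : Finset (Fin K)),
        proj (instrMatrix N ψ x₁ s z) := by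
  rw [csaP, Finset.card_powersetCard, Finset.card_univ, Fintype.card_fin]

variable {K k} in
lemma powersetCard_univ_nonempty (hk : k ≤ K) :
    (Finset.powersetCard k (Finset.univ : Finset (Fin K))).Nonempty :=
  Finset.powersetCard_nonempty.2 (by simpa using hk)

lemma transpose_csaP : (csaP N ψ x₁ K k z)ᵀ = csaP N ψ x₁ K k z := by
  rw [csaP, transpose_smul, transpose_sum]
  simp_rw [transpose_proj]

variable {K k}

lemma norm_csaP_mul_le (hk : k ≤ K) (A : Matrix (Fin N) n ℝ) :
    ‖csaP N ψ x₁ K k z * A‖ ≤ ‖A‖ := by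
  rw [csaP_eq]
  exact norm_avg_mul_le (powersetCard_univ_nonempty hk) (fun s _ => isOrthProj_proj _) A

lemma card_instr {s : Finset (Fin K)}
    (hs : s ∈ Finset.powersetCard k (Finset.univ : Finset (Fin K))) :
    Fintype.card ({j // j ∈ s} ⊕ Fin d₂) = k + d₂ := by
  rw [Fintype.card_sum, Fintype.card_coe, (Finset.mem_powersetCard.1 hs).2, Fintype.card_fin]

lemma norm_csaP_sq_le (hk : k ≤ K) : ‖csaP N ψ x₁ K k z‖ ^ 2 ≤ k + d₂ := by
  have h : ‖csaP N ψ x₁ K k z‖ ≤ √((k : ℝ) + d₂) := by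
    rw [csaP_eq]
    refine norm_avg_le (powersetCard_univ_nonempty hk) fun s hs => Real.le_sqrt_of_sq_le ?_
    rw [(isOrthProj_proj _).norm_sq]
    refine (trace_proj_le _).trans_eq ?_
    rw [card_instr hs]; push_cast; rfl
  calc _ ≤ √((k : ℝ) + d₂) ^ 2 := by gcongr
    _ = _ := Real.sq_sqrt (by positivity)

lemma csaP_diag_nonneg (i : Fin N) : 0 ≤ csaP N ψ x₁ K k z i i := by
  rw [csaP, Matrix.smul_apply, Matrix.sum_apply, smul_eq_mul]
  exact mul_nonneg (by positivity) (Finset.sum_nonneg fun s _ => (isOrthProj_proj _).diag_nonneg i)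

lemma trace_csaP_le (hk : k ≤ K) : (csaP N ψ x₁ K k z).trace ≤ k + d₂ := by
  have hc : (0 : ℝ) < (Finset.powersetCard k (Finset.univ : Finset (Fin K))).card := by
    exact_mod_cast (powersetCard_univ_nonempty hk).card_pos
  rw [csaP_eq, trace_smul, trace_sum, smul_eq_mul, inv_mul_le_iff₀ hc]
  calc _ ≤ ∑ s ∈ Finset.powersetCard k (Finset.univ : Finset (Fin K)), ((k : ℝ) + d₂) := by
        refine Finset.sum_le_sum fun s hs => (trace_proj_le _).trans_eq ?_
        rw [card_instr hs]; push_cast; rfl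
    _ = _ := by simp [mul_add]

lemma trace_csaP (hk : k ≤ K) (h : FullRank N ψ x₁ K k z) :
    (csaP N ψ x₁ K k z).trace = k + d₂ := by
  have hc : (0 : ℝ) < (Finset.powersetCard k (Finset.univ : Finset (Fin K))).card := by
    exact_mod_cast (powersetCard_univ_nonempty hk).card_pos
  rw [csaP_eq, trace_smul, trace_sum, smul_eq_mul, inv_mul_eq_iff_eq_mul₀ hc.ne']
  calc _ = ∑ s ∈ Finset.powersetCard k (Finset.univ : Finset (Fin K)), ((k : ℝ) + d₂) := by
        refine Finset.sum_congr rfl fun s hs => (trace_proj (h s hs)).trans ?_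
        rw [card_instr hs]; push_cast; rfl
    _ = _ := by simp [mul_add]

/-- `U'PU` is positive semidefinite, so that its norm is at most its trace. -/
lemma norm_quadratic_csaP_le (U : Matrix (Fin N) n ℝ) :
    ‖Uᵀ * csaP N ψ x₁ K k z * U‖ ≤ (Uᵀ * csaP N ψ x₁ K k z * U).trace := by
  rw [csaP, Matrix.mul_smul, Matrix.smul_mul, Matrix.mul_sum, Matrix.sum_mul, trace_smul, trace_sum,
    norm_smul, norm_inv, Real.norm_natCast, smul_eq_mul]
  gcongr
  refine (norm_sum_le _ _).trans (Finset.sum_le_sum fun s _ => ?_)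
  rw [← (isOrthProj_proj _).transpose_mul_mul, ← norm_sq_eq_trace]
  exact norm_transpose_mul_self_le _

/-- For `f` close on average to the column spaces of the instrument matrices, `f'(I - P)f` is
small. -/
lemma norm_transpose_mul_one_sub_csaP_mul_le (hk : k ≤ K) (h : FullRank N ψ x₁ K k z)
    (F : Matrix (Fin N) n ℝ) (Γ : (s : Finset (Fin K)) → Matrix ({j // j ∈ s} ⊕ Fin d₂) n ℝ) :
    ‖Fᵀ * (1 - csaP N ψ x₁ K k z) * F‖ ≤ ((K.choose k : ℕ) : ℝ)⁻¹ *
      ∑ s ∈ Finset.powersetCard k (Finset.univ : Finset (Fin K)),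
        ‖F - instrMatrix N ψ x₁ s z * Γ s‖ ^ 2 := by
  have hc : (0 : ℝ) < (K.choose k : ℕ) := by exact_mod_cast Nat.choose_pos hk
  have h1 : Fᵀ * (1 - csaP N ψ x₁ K k z) * F = ((K.choose k : ℕ) : ℝ)⁻¹ •
      ∑ s ∈ Finset.powersetCard k (Finset.univ : Finset (Fin K)),
        Fᵀ * (1 - proj (instrMatrix N ψ x₁ s z)) * F := by
    simp_rw [Matrix.mul_sub, Matrix.sub_mul]
    rw [Finset.sum_sub_distrib, smul_sub, csaP, Matrix.mul_smul, Matrix.smul_mul, Matrix.mul_sum,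
      Matrix.sum_mul, Finset.sum_const, Finset.card_powersetCard, Finset.card_univ,
      Fintype.card_fin, ← Nat.cast_smul_eq_nsmul ℝ, smul_smul, inv_mul_cancel₀ hc.ne', one_smul]
  rw [h1, norm_smul, norm_inv, Real.norm_natCast]
  gcongr
  refine (norm_sum_le _ _).trans (Finset.sum_le_sum fun s hs => ?_)
  have h2 := (isOrthProj_proj (instrMatrix N ψ x₁ s z)).one_sub
  rw [← h2.transpose_mul_mul]
  refine (norm_transpose_mul_self_le _).trans ?_
  have h3 : (1 - proj (instrMatrix N ψ x₁ s z)) * F =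
      (1 - proj (instrMatrix N ψ x₁ s z)) * (F - instrMatrix N ψ x₁ s z * Γ s) := by
    rw [Matrix.mul_sub, ← Matrix.mul_assoc, Matrix.sub_mul _ _ (instrMatrix N ψ x₁ s z),
      proj_mul_self (h s hs)]
    simp
  rw [h3]
  have := h2.norm_mul_le (F - instrMatrix N ψ x₁ s z * Γ s)
  gcongr

end CsaProjection

/-! ### Conditional expectations of products of independent families -/

section CondExpProduct

variable {Ω 𝒵 : Type*} [mΩ : MeasurableSpace Ω] [m𝒵 : MeasurableSpace 𝒵] {μ : Measure Ω}

lemma integrable_prod_of_iIndepFun {ι : Type*} [Fintype ι] {h : ι → Ω → ℝ}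
    (hind : iIndepFun h μ) (hint : ∀ i, Integrable (h i) μ) :
    Integrable (fun ω => ∏ i, h i ω) μ := by
  have := hind.isProbabilityMeasure
  have h1 : Integrable (fun x : ι → ℝ => ∏ i, x i) (Measure.pi fun i => μ.map (h i)) := by
    have : ∀ i, IsProbabilityMeasure (μ.map (h i)) := fun i =>
      Measure.isProbabilityMeasure_map (hint i).aemeasurable
    refine Integrable.fintype_prod (f := fun _ x => x) fun i => ?_
    exact (integrable_map_measure (by fun_prop) (hint i).aemeasurable).2 (hint i)
  rw [← hind.map_fun_eq_pi_map fun i => (hint i).aemeasurable] at h1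
  exact (integrable_map_measure h1.aestronglyMeasurable
    (aemeasurable_pi_lambda _ fun i => (hint i).aemeasurable)).1 h1

/-- Functions of independent observations are independent; here a function of the `i`-th
observation is a function measurable with respect to the `σ`-algebra it generates. -/
lemma iIndepFun_of_measurable_comap {ι : Type*} {W : Type*} [MeasurableSpace W]
    {w : ι → Ω → W} (hind : iIndepFun w μ) {h : ι → Ω → ℝ}
    (hh : ∀ i, Measurable[MeasurableSpace.comap (w i) inferInstance] (h i)) : iIndepFun h μ := by
  choose g hg hgw using fun i => (hh i).exists_eq_measurable_comp
  have : h = fun i => g i ∘ w i := funext hgw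
  rw [this]
  exact hind.comp g hg

/-- Given the whole sample of a component `z i` of independent observations `w i`, the conditional
expectation of a product of functions of the different observations is the product of the
conditional expectations given the individual `z i`. -/
lemma condExp_prod_eq_prod_condExp {W : Type*} [mW : MeasurableSpace W]
    [IsProbabilityMeasure μ] {N : ℕ} {w : Fin N → Ω → W} {z : Fin N → Ω → 𝒵}
    (hind : iIndepFun w μ) (hw : ∀ i, Measurable (w i)) {π : W → 𝒵} (hπ : Measurable π)
    (hz : ∀ i, z i = π ∘ w i) {h : Fin N → Ω → ℝ}
    (hh : ∀ i, Measurable[MeasurableSpace.comap (w i) inferInstance] (h i))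
    (hint : ∀ i, Integrable (h i) μ) :
    μ[fun ω => ∏ i, h i ω | MeasurableSpace.comap (fun ω i => z i ω) inferInstance] =ᵐ[μ]
      fun ω => ∏ i, (μ[h i | MeasurableSpace.comap (z i) inferInstance]) ω := by
  have hzm : ∀ i, Measurable (z i) := fun i => hz i ▸ hπ.comp (hw i)
  have hZ : Measurable fun ω i => z i ω := measurable_pi_lambda _ hzm
  set c : Fin N → Ω → ℝ := fun i => μ[h i | MeasurableSpace.comap (z i) inferInstance] with hc
  have hle : ∀ i, MeasurableSpace.comap (z i) m𝒵 ≤ MeasurableSpace.comap (w i) mW := by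
    intro i
    rw [hz i, ← MeasurableSpace.comap_comp]
    exact MeasurableSpace.comap_mono hπ.comap_le
  have hle' : ∀ i, MeasurableSpace.comap (z i) m𝒵 ≤
      MeasurableSpace.comap (fun ω i => z i ω) inferInstance := by
    intro i
    have : z i = (fun x : Fin N → 𝒵 => x i) ∘ fun ω i => z i ω := rfl
    rw [this, ← MeasurableSpace.comap_comp]
    exact MeasurableSpace.comap_mono (measurable_pi_apply i).comap_le
  have hcm : ∀ i, Measurable[MeasurableSpace.comap (z i) m𝒵] (c i) := fun i =>
    stronglyMeasurable_condExp.measurable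
  have hci : ∀ i, Integrable (c i) μ := fun i => integrable_condExp
  have hIh := integrable_prod_of_iIndepFun (iIndepFun_of_measurable_comap hind hh) hint
  have hIc := integrable_prod_of_iIndepFun
    (iIndepFun_of_measurable_comap hind fun i => (hcm i).mono (hle i) le_rfl) hci
  -- on rectangles both sides factor over the observations
  have hrect : ∀ B : Fin N → Set 𝒵, (∀ i, MeasurableSet (B i)) →
      ∫ ω in (fun ω i => z i ω) ⁻¹' Set.pi Set.univ B, ∏ i, c i ω ∂μ =
        ∫ ω in (fun ω i => z i ω) ⁻¹' Set.pi Set.univ B, ∏ i, h i ω ∂μ := by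
    intro B hB
    have hBm : ∀ i, MeasurableSet[MeasurableSpace.comap (z i) m𝒵] (z i ⁻¹' B i) := fun i =>
      ⟨B i, hB i, rfl⟩
    have hBm' : ∀ i, MeasurableSet (z i ⁻¹' B i) := fun i => hzm i (hB i)
    have hset : MeasurableSet ((fun ω i => z i ω) ⁻¹' Set.pi Set.univ B) :=
      hZ (MeasurableSet.univ_pi hB)
    have key : ∀ q : Fin N → Ω → ℝ,
        (∀ i, Measurable[MeasurableSpace.comap (w i) inferInstance] (q i)) →
        (∀ i, Integrable (q i) μ) →
        ∫ ω in (fun ω i => z i ω) ⁻¹' Set.pi Set.univ B, ∏ i, q i ω ∂μ =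
          ∏ i, ∫ ω in z i ⁻¹' B i, q i ω ∂μ := by
      intro q hq hqi
      have h1 : ∀ i, Measurable[MeasurableSpace.comap (w i) inferInstance]
          ((z i ⁻¹' B i).indicator (q i)) := fun i => (hq i).indicator (hle i _ (hBm i))
      have h2 := (iIndepFun_of_measurable_comap hind h1).integral_fun_prod_eq_prod_integral
        fun i => ((hqi i).indicator (hBm' i)).aestronglyMeasurable
      rw [← integral_indicator hset]
      simp_rw [← fun i => integral_indicator (f := q i) (μ := μ) (hBm' i)]
      rw [← h2]
      congr 1
      ext ω
      by_cases hω : ω ∈ (fun ω i => z i ω) ⁻¹' Set.pi Set.univ B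
      · rw [Set.indicator_of_mem hω]
        refine Finset.prod_congr rfl fun i _ => ?_
        rw [Set.indicator_of_mem]
        exact hω i (Set.mem_univ i)
      · rw [Set.indicator_of_notMem hω]
        have : ∃ i, z i ω ∉ B i := by
          by_contra! hcon
          exact hω fun i _ => hcon i
        obtain ⟨i, hi⟩ := this
        exact (Finset.prod_eq_zero (Finset.mem_univ i)
          (Set.indicator_of_notMem (by exact hi) _)).symm
    rw [key c (fun i => (hcm i).mono (hle i) le_rfl) hci, key h hh hint]
    refine Finset.prod_congr rfl fun i _ => ?_
    exact setIntegral_condExp (hzm i).comap_le (hint i) (hBm i)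
  refine (ae_eq_condExp_of_forall_setIntegral_eq hZ.comap_le hIh
    (fun s _ _ => hIc.integrableOn) ?_ ?_).symm
  · rintro s ⟨t, ht, rfl⟩ -
    have hgen : (MeasurableSpace.pi : MeasurableSpace (Fin N → 𝒵)) = MeasurableSpace.generateFrom
        (Set.pi Set.univ '' Set.pi Set.univ fun _ => {s : Set 𝒵 | MeasurableSet s}) :=
      generateFrom_pi.symm
    have hpi : IsPiSystem (Set.pi Set.univ '' Set.pi Set.univ
        fun _ : Fin N => {s : Set 𝒵 | MeasurableSet s}) := isPiSystem_pi
    induction t, ht using MeasurableSpace.induction_on_inter hgen hpi with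
    | empty => simp
    | basic t ht =>
      obtain ⟨B, hB, rfl⟩ := ht
      exact hrect B fun i => hB i (Set.mem_univ i)
    | compl t ht ih =>
      rw [Set.preimage_compl, setIntegral_compl (hZ ht) hIc, setIntegral_compl (hZ ht) hIh, ih]
      have := hrect (fun _ => Set.univ) fun _ => MeasurableSet.univ
      simp only [Set.pi_univ, Set.preimage_univ, Measure.restrict_univ] at this
      rw [this]
    | iUnion f hd hf ih =>
      rw [Set.preimage_iUnion, integral_iUnion (fun i => hZ (hf i))
        (fun i j hij => (hd hij).preimage _) hIc.integrableOn,
        integral_iUnion (fun i => hZ (hf i)) (fun i j hij => (hd hij).preimage _) hIh.integrableOn]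
      exact tsum_congr ih
  · refine Measurable.aestronglyMeasurable ?_
    exact Finset.measurable_fun_prod _ fun i _ => (hcm i).mono (hle' i) le_rfl

end CondExpProduct

/-! ### Conditional expectations in the extended sense -/

section ExtendedCondExp

variable {Ω : Type*} {m : MeasurableSpace Ω} [mΩ : MeasurableSpace Ω] {μ : Measure Ω}

/-- The cover in `HasCondExp` may be indexed by any countable type. -/
lemma HasCondExp.of_countable {ι : Type*} [Countable ι] [Nonempty ι] {X C : Ω → ℝ}
    (A : ι → Set Ω) (hA : ∀ n, MeasurableSet[m] (A n)) (hcov : ∀ᵐ ω ∂μ, ∃ n, ω ∈ A n)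
    (h : ∀ n, IntegrableOn X (A n) μ ∧ μ[(A n).indicator X | m] =ᵐ[μ] (A n).indicator C) :
    HasCondExp μ m X C := by
  obtain ⟨e, he⟩ := exists_surjective_nat ι
  refine ⟨fun n => A (e n), fun n => hA _, ?_, fun n => h _⟩
  filter_upwards [hcov] with ω ⟨n, hn⟩
  obtain ⟨j, rfl⟩ := he n
  exact ⟨j, hn⟩

lemma HasCondExp.of_integrable {X : Ω → ℝ} (hX : Integrable X μ) : HasCondExp μ m X (μ[X | m]) :=
  ⟨fun _ => Set.univ, fun _ => MeasurableSet.univ, by simp, fun _ => by simpa using hX⟩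

/-- A conditional expectation on an event of `m` restricts to the smaller events of `m`. -/
lemma condExp_indicator_of_subset (hm : m ≤ mΩ) {X C : Ω → ℝ} {A B : Set Ω}
    (hA : MeasurableSet[m] A) (hB : MeasurableSet[m] B) (hBA : B ⊆ A) (hX : IntegrableOn X A μ)
    (h : μ[A.indicator X | m] =ᵐ[μ] A.indicator C) :
    μ[B.indicator X | m] =ᵐ[μ] B.indicator C := by
  have h1 := condExp_indicator (hX.integrable_indicator (hm _ hA)) hB
  rw [Set.indicator_indicator, Set.inter_eq_left.2 hBA] at h1
  filter_upwards [h1, h] with ω hω1 hω2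
  rw [hω1]
  by_cases hω : ω ∈ B
  · rw [Set.indicator_of_mem hω, Set.indicator_of_mem hω, hω2, Set.indicator_of_mem (hBA hω)]
  · rw [Set.indicator_of_notMem hω, Set.indicator_of_notMem hω]

lemma HasCondExp.congr {X C C' : Ω → ℝ} (h : HasCondExp μ m X C) (hC : C =ᵐ[μ] C') :
    HasCondExp μ m X C' := by
  obtain ⟨A, hA, hcov, hAX⟩ := h
  refine ⟨A, hA, hcov, fun n => ⟨(hAX n).1, (hAX n).2.trans ?_⟩⟩
  filter_upwards [hC] with ω hω
  simp only [Set.indicator, hω]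

lemma HasCondExp.add (hm : m ≤ mΩ) {X X' C C' : Ω → ℝ} (h : HasCondExp μ m X C)
    (h' : HasCondExp μ m X' C') :
    HasCondExp μ m (fun ω => X ω + X' ω) (fun ω => C ω + C' ω) := by
  obtain ⟨A, hA, hcov, hAX⟩ := h
  obtain ⟨B, hB, hcov', hBX⟩ := h'
  refine HasCondExp.of_countable (ι := ℕ × ℕ) (fun p => A p.1 ∩ B p.2)
    (fun p => (hA _).inter (hB _)) ?_ fun p => ?_
  · filter_upwards [hcov, hcov'] with ω ⟨n, hn⟩ ⟨n', hn'⟩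
    exact ⟨(n, n'), hn, hn'⟩
  have hAB : MeasurableSet[m] (A p.1 ∩ B p.2) := (hA _).inter (hB _)
  have h1 := (hAX p.1).1.mono_set (Set.inter_subset_left (t := B p.2))
  have h2 := (hBX p.2).1.mono_set (Set.inter_subset_right (s := A p.1))
  refine ⟨h1.add h2, ?_⟩
  have e : (A p.1 ∩ B p.2).indicator (fun ω => X ω + X' ω) =
      (A p.1 ∩ B p.2).indicator X + (A p.1 ∩ B p.2).indicator X' := Set.indicator_add _ _ _
  rw [e]
  filter_upwards [condExp_add (h1.integrable_indicator (hm _ hAB))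
      (h2.integrable_indicator (hm _ hAB)) m,
    condExp_indicator_of_subset hm (hA _) hAB Set.inter_subset_left (hAX p.1).1 (hAX p.1).2,
    condExp_indicator_of_subset hm (hB _) hAB Set.inter_subset_right (hBX p.2).1 (hBX p.2).2]
    with ω e1 e2 e3
  rw [e1, Pi.add_apply, e2, e3]
  by_cases hω : ω ∈ A p.1 ∩ B p.2
  · simp only [Set.indicator_of_mem hω]
  · simp only [Set.indicator_of_notMem hω, add_zero]

/-- The pull-out property. No integrability is needed: the events of the cover are intersected with
those on which the factor is bounded by an integer. -/
lemma HasCondExp.mul_left (hm : m ≤ mΩ) [IsFiniteMeasure μ] {X C c : Ω → ℝ}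
    (h : HasCondExp μ m X C) (hc : Measurable[m] c) :
    HasCondExp μ m (fun ω => c ω * X ω) (fun ω => c ω * C ω) := by
  obtain ⟨A, hA, hcov, hAX⟩ := h
  have hB : ∀ j : ℕ, MeasurableSet[m] {ω | |c ω| ≤ j} := fun j =>
    (measurable_norm.comp hc) measurableSet_Iic
  refine HasCondExp.of_countable (ι := ℕ × ℕ) (fun p => A p.1 ∩ {ω | |c ω| ≤ p.2})
    (fun p => (hA _).inter (hB _)) ?_ fun p => ?_
  · filter_upwards [hcov] with ω ⟨n, hn⟩
    obtain ⟨j, hj⟩ := exists_nat_ge |c ω|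
    exact ⟨(n, j), hn, hj⟩
  have hAB : MeasurableSet[m] (A p.1 ∩ {ω | |c ω| ≤ p.2}) := (hA _).inter (hB _)
  have h1 := ((hAX p.1).1.mono_set
    (Set.inter_subset_left (t := {ω | |c ω| ≤ p.2}))).integrable_indicator (hm _ hAB)
  have hcm : StronglyMeasurable[m] ({ω | |c ω| ≤ p.2}.indicator c) :=
    (hc.indicator (hB _)).stronglyMeasurable
  have hbd : ∀ ω, ‖{ω | |c ω| ≤ p.2}.indicator c ω‖ ≤ p.2 := by
    intro ω
    by_cases hω : ω ∈ {ω | |c ω| ≤ p.2}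
    · rw [Set.indicator_of_mem hω]; exact hω
    · rw [Set.indicator_of_notMem hω]; simp
  have e : (A p.1 ∩ {ω | |c ω| ≤ p.2}).indicator (fun ω => c ω * X ω) =
      {ω | |c ω| ≤ p.2}.indicator c * (A p.1 ∩ {ω | |c ω| ≤ p.2}).indicator X := by
    ext ω
    by_cases hω : ω ∈ A p.1 ∩ {ω | |c ω| ≤ p.2}
    · rw [Pi.mul_apply, Set.indicator_of_mem hω, Set.indicator_of_mem hω,
        Set.indicator_of_mem hω.2]
    · rw [Pi.mul_apply, Set.indicator_of_notMem hω, Set.indicator_of_notMem hω, mul_zero]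
  constructor
  · rw [← integrable_indicator_iff (hm _ hAB), e]
    exact h1.bdd_mul (hcm.mono hm).aestronglyMeasurable (ae_of_all _ hbd)
  · rw [e]
    filter_upwards [condExp_stronglyMeasurable_mul_of_bound hm hcm h1 p.2 (ae_of_all _ hbd),
      condExp_indicator_of_subset hm (hA _) hAB Set.inter_subset_left (hAX p.1).1 (hAX p.1).2]
      with ω e1 e2
    rw [e1, Pi.mul_apply, e2]
    by_cases hω : ω ∈ A p.1 ∩ {ω | |c ω| ≤ p.2}
    · rw [Set.indicator_of_mem hω, Set.indicator_of_mem hω, Set.indicator_of_mem hω.2]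
    · rw [Set.indicator_of_notMem hω, Set.indicator_of_notMem hω, mul_zero]

lemma HasCondExp.sum (hm : m ≤ mΩ) [IsFiniteMeasure μ] {ι : Type*} (s : Finset ι)
    {X C : ι → Ω → ℝ} (h : ∀ i ∈ s, HasCondExp μ m (X i) (C i)) :
    HasCondExp μ m (fun ω => ∑ i ∈ s, X i ω) (fun ω => ∑ i ∈ s, C i ω) := by
  classical
  induction s using Finset.induction_on with
  | empty =>
    have h0 : HasCondExp μ m (fun _ => (0 : ℝ)) (μ[fun _ => (0 : ℝ) | m]) :=
      HasCondExp.of_integrable (integrable_zero _ _ _)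
    simp only [Finset.sum_empty]
    exact h0.congr (by rw [condExp_const hm])
  | insert i s hi ih =>
    simp only [Finset.sum_insert hi]
    exact (h i (Finset.mem_insert_self i s)).add hm
      (ih fun j hj => h j (Finset.mem_insert_of_mem hj))

/-- Entrywise version of `HasCondExp` for random matrices. -/
def MatHasCondExp {p q : Type*} (μ : Measure Ω) (m : MeasurableSpace Ω) (X C : Ω → Matrix p q ℝ) :
    Prop :=
  ∀ a b, @HasCondExp _ mΩ μ m (fun ω => X ω a b) (fun ω => C ω a b)

namespace MatHasCondExp

variable {p q r : Type*} {X X' C C' : Ω → Matrix p q ℝ}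

lemma add (hm : m ≤ mΩ) (h : MatHasCondExp μ m X C) (h' : MatHasCondExp μ m X' C') :
    MatHasCondExp μ m (fun ω => X ω + X' ω) (fun ω => C ω + C' ω) :=
  fun a b => (h a b).add hm (h' a b)

lemma smul [IsFiniteMeasure μ] (hm : m ≤ mΩ) (h : MatHasCondExp μ m X C) (c : ℝ) :
    MatHasCondExp μ m (fun ω => c • X ω) (fun ω => c • C ω) :=
  fun a b => (h a b).mul_left hm measurable_const

lemma sub [IsFiniteMeasure μ] (hm : m ≤ mΩ) (h : MatHasCondExp μ m X C)
    (h' : MatHasCondExp μ m X' C') :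
    MatHasCondExp μ m (fun ω => X ω - X' ω) (fun ω => C ω - C' ω) := by
  have := h.add hm (h'.smul hm (-1))
  simpa only [neg_one_smul, ← sub_eq_add_neg] using this

lemma transpose (h : MatHasCondExp μ m X C) :
    MatHasCondExp μ m (fun ω => (X ω).transpose) (fun ω => (C ω).transpose) :=
  fun a b => h b a

lemma mul_left [IsFiniteMeasure μ] [Fintype p] (hm : m ≤ mΩ) (h : MatHasCondExp μ m X C)
    {A : Ω → Matrix r p ℝ}
    (hA : ∀ a b, Measurable[m] fun ω => A ω a b) :
    MatHasCondExp μ m (fun ω => A ω * X ω) (fun ω => A ω * C ω) := by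
  intro a b
  simp only [Matrix.mul_apply]
  exact HasCondExp.sum hm _ fun c _ => (h c b).mul_left hm (hA a c)

lemma mul_right [IsFiniteMeasure μ] [Fintype q] (hm : m ≤ mΩ) (h : MatHasCondExp μ m X C)
    {A : Ω → Matrix q r ℝ}
    (hA : ∀ a b, Measurable[m] fun ω => A ω a b) :
    MatHasCondExp μ m (fun ω => X ω * A ω) (fun ω => C ω * A ω) := by
  intro a b
  simp only [Matrix.mul_apply]
  refine HasCondExp.sum hm _ fun c _ => ?_
  simp only [mul_comm (X _ a c), mul_comm (C _ a c)]
  exact (h a c).mul_left hm (hA c b)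

end MatHasCondExp

end ExtendedCondExp

/-! ### Polynomials in the errors -/

section ErrorPolynomials

variable {Ω 𝒵 n : Type*} [MeasurableSpace 𝒵] {N : ℕ} {z : ℕ → Ω → 𝒵} {ε : ℕ → Ω → ℝ}
  {u : ℕ → Ω → n → ℝ}

/-- The random variable `X` is a polynomial of degree at most `D` in the first `N` errors, with
coefficients that are measurable functions of the sample of `z`. -/
def IsErrPoly (N : ℕ) (z : ℕ → Ω → 𝒵) (ε : ℕ → Ω → ℝ) (u : ℕ → Ω → n → ℝ) (D : ℕ) (X : Ω → ℝ) :
    Prop :=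
  ∃ p : ErrPoly 𝒵 n N, p.totalDegree ≤ D ∧ (∀ e, Measurable (p.coeff e)) ∧
    ∀ ω, X ω = p.value (fun i => z i ω) (fun i => ε i ω) (fun i => u i ω)

namespace IsErrPoly

variable {D D' : ℕ} {X X' : Ω → ℝ}

lemma mono (h : IsErrPoly N z ε u D X) (hD : D ≤ D') : IsErrPoly N z ε u D' X := by
  obtain ⟨p, hp, hm, hv⟩ := h
  exact ⟨p, hp.trans hD, hm, hv⟩

lemma add (h : IsErrPoly N z ε u D X) (h' : IsErrPoly N z ε u D X') :
    IsErrPoly N z ε u D (fun ω => X ω + X' ω) := by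
  obtain ⟨p, hp, hm, hv⟩ := h
  obtain ⟨p', hp', hm', hv'⟩ := h'
  refine ⟨p + p', (MvPolynomial.totalDegree_add _ _).trans (max_le hp hp'), fun e => ?_,
    fun ω => ?_⟩
  · rw [MvPolynomial.coeff_add]; exact (hm e).add (hm' e)
  · simp only [hv, hv', ErrPoly.value, MvPolynomial.eval₂_add]

lemma mul (h : IsErrPoly N z ε u D X) (h' : IsErrPoly N z ε u D' X') :
    IsErrPoly N z ε u (D + D') (fun ω => X ω * X' ω) := by
  classical
  obtain ⟨p, hp, hm, hv⟩ := h
  obtain ⟨p', hp', hm', hv'⟩ := h'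
  refine ⟨p * p', (MvPolynomial.totalDegree_mul _ _).trans (add_le_add hp hp'), fun e => ?_,
    fun ω => ?_⟩
  · rw [MvPolynomial.coeff_mul]
    exact Finset.sum_induction _ Measurable (fun _ _ => Measurable.add) measurable_zero
      fun x _ => (hm x.1).mul (hm' x.2)
  · simp only [hv, hv', ErrPoly.value, MvPolynomial.eval₂_mul]

lemma coeff {c : (Fin N → 𝒵) → ℝ} (hc : Measurable c) :
    IsErrPoly N z ε u 0 (fun ω => c fun i => z i ω) := by
  classical
  refine ⟨MvPolynomial.C c, by simp, fun e => ?_, fun ω => ?_⟩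
  · rw [MvPolynomial.coeff_C]
    split_ifs
    · exact hc
    · exact measurable_const
  · rw [ErrPoly.value, MvPolynomial.eval₂_C]; rfl

lemma const (c : ℝ) : IsErrPoly N z ε u 0 (fun _ => c) :=
  coeff (c := fun _ => c) measurable_const

lemma var (v : Fin N × Option n) :
    IsErrPoly N z ε u 1 (fun ω => Option.elim v.2 (ε v.1 ω) (u v.1 ω)) := by
  classical
  refine ⟨MvPolynomial.X v, ?_, fun e => ?_, fun ω => ?_⟩
  · refine (MvPolynomial.totalDegree_monomial_le _ _).trans ?_
    simp
  · rw [MvPolynomial.coeff_X]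
    split_ifs
    · exact measurable_const
    · exact measurable_const
  · simp only [ErrPoly.value, MvPolynomial.eval₂_X]

lemma error (i : Fin N) : IsErrPoly N z ε u 1 (fun ω => ε i ω) := var (i, none)

lemma reducedFormError (i : Fin N) (a : n) : IsErrPoly N z ε u 1 (fun ω => u i ω a) :=
  var (i, some a)

lemma sum {ι : Type*} (s : Finset ι) {X : ι → Ω → ℝ} (h : ∀ i ∈ s, IsErrPoly N z ε u D (X i)) :
    IsErrPoly N z ε u D (fun ω => ∑ i ∈ s, X i ω) := by
  classical
  induction s using Finset.induction_on with
  | empty => simpa using (const (N := N) (z := z) (ε := ε) (u := u) 0).mono (Nat.zero_le D)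
  | insert i s hi ih =>
    simp only [Finset.sum_insert hi]
    exact (h i (Finset.mem_insert_self i s)).add
      (ih fun j hj => h j (Finset.mem_insert_of_mem hj))

end IsErrPoly

/-- Entrywise version of `IsErrPoly` for random matrices. -/
def MatIsErrPoly {p q : Type*} (N : ℕ) (z : ℕ → Ω → 𝒵) (ε : ℕ → Ω → ℝ) (u : ℕ → Ω → n → ℝ)
    (D : ℕ) (X : Ω → Matrix p q ℝ) : Prop :=
  ∀ a b, IsErrPoly N z ε u D (fun ω => X ω a b)

namespace MatIsErrPoly

variable {D D' : ℕ} {p q r : Type*} {X X' : Ω → Matrix p q ℝ} {Y : Ω → Matrix q r ℝ}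

lemma mono (h : MatIsErrPoly N z ε u D X) (hD : D ≤ D') : MatIsErrPoly N z ε u D' X :=
  fun a b => (h a b).mono hD

lemma add (h : MatIsErrPoly N z ε u D X) (h' : MatIsErrPoly N z ε u D X') :
    MatIsErrPoly N z ε u D (fun ω => X ω + X' ω) :=
  fun a b => (h a b).add (h' a b)

lemma smul (h : MatIsErrPoly N z ε u D X) (c : ℝ) :
    MatIsErrPoly N z ε u D (fun ω => c • X ω) := fun a b => by
  simpa using (IsErrPoly.const c).mul (h a b)

lemma sub (h : MatIsErrPoly N z ε u D X) (h' : MatIsErrPoly N z ε u D X') :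
    MatIsErrPoly N z ε u D (fun ω => X ω - X' ω) := by
  have := h.add (h'.smul (-1))
  simpa only [neg_one_smul, ← sub_eq_add_neg] using this

lemma mul [Fintype q] (h : MatIsErrPoly N z ε u D X) (h' : MatIsErrPoly N z ε u D' Y) :
    MatIsErrPoly N z ε u (D + D') (fun ω => X ω * Y ω) := by
  intro a b
  simp only [Matrix.mul_apply]
  exact IsErrPoly.sum _ fun c _ => (h a c).mul (h' c b)

lemma transpose (h : MatIsErrPoly N z ε u D X) :
    MatIsErrPoly N z ε u D (fun ω => (X ω).transpose) :=
  fun a b => h b a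

end MatIsErrPoly

end ErrorPolynomials

/-! ### Measurability of matrix operations -/

section MatrixMeasurability

variable {α p q r : Type*} [MeasurableSpace α]

/-- Measurability of the entries of a matrix-valued function. -/
def MatMeasurable (A : α → Matrix p q ℝ) : Prop := ∀ i j, Measurable fun x => A x i j

namespace MatMeasurable

lemma mul [Fintype q] {A : α → Matrix p q ℝ} {B : α → Matrix q r ℝ} (hA : MatMeasurable A)
    (hB : MatMeasurable B) : MatMeasurable fun x => A x * B x := by
  intro i j
  simp only [Matrix.mul_apply]
  exact Finset.measurable_fun_sum _ fun c _ => (hA i c).mul (hB c j)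

lemma transpose {A : α → Matrix p q ℝ} (hA : MatMeasurable A) :
    MatMeasurable fun x => (A x).transpose := fun i j => hA j i

lemma smul {A : α → Matrix p q ℝ} (hA : MatMeasurable A) (c : ℝ) :
    MatMeasurable fun x => c • A x := fun i j => (hA i j).const_mul c

lemma det [Fintype p] [DecidableEq p] {A : α → Matrix p p ℝ} (hA : MatMeasurable A) :
    Measurable fun x => (A x).det := by
  simp only [Matrix.det_apply]
  exact Finset.measurable_fun_sum _ fun σ _ =>
    (Finset.measurable_fun_prod _ fun i _ => hA _ _).const_smul _

lemma inv [Fintype p] [DecidableEq p] {A : α → Matrix p p ℝ} (hA : MatMeasurable A) :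
    MatMeasurable fun x => (A x)⁻¹ := by
  intro i j
  simp only [Matrix.inv_def, Ring.inverse_eq_inv', Matrix.smul_apply, smul_eq_mul,
    Matrix.adjugate_apply]
  refine hA.det.inv.mul (det fun a b => ?_)
  by_cases h : a = j
  · subst h; simp
  · simp only [Matrix.updateRow_ne h]; exact hA a b

lemma proj [Fintype p] [Fintype q] [DecidableEq q] {A : α → Matrix p q ℝ} (hA : MatMeasurable A) :
    MatMeasurable fun x => proj (A x) :=
  (hA.mul (hA.transpose.mul hA).inv).mul hA.transpose

end MatMeasurable

end MatrixMeasurability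

/-! ### Conditional moments of words in the errors -/

section ErrorMoments

variable {Ω 𝒵 n : Type*} [mΩ : MeasurableSpace Ω] [m𝒵 : MeasurableSpace 𝒵]

/-- The `σ`-algebra generated by the first `N` values of `z`. -/
abbrev sampleSigma (z : ℕ → Ω → 𝒵) (N : ℕ) : MeasurableSpace Ω :=
  MeasurableSpace.comap (fun ω (i : Fin N) => z i ω) inferInstance

/-- The probabilistic properties of the errors: the triples `(ε_i, u_i, z_i)` are independent, with
finite fourth moments of the errors, the errors have conditional mean zero, the conditional moments
`E[ε² | z] = σε2`, `E[u ε | z] = σue` and `E[u ε² | z] = τ` are constant, and `E[u_a u_b | z]` and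
`E[u_a u_b ε² | z]` are bounded by `C`. -/
structure ErrorModel (μ : Measure Ω) (z : ℕ → Ω → 𝒵) (ε : ℕ → Ω → ℝ) (u : ℕ → Ω → n → ℝ)
    (σε2 : ℝ) (σue τ : n → ℝ) (C : ℝ) : Prop where
  C_nonneg : 0 ≤ C
  meas_z : ∀ i, Measurable (z i)
  meas_ε : ∀ i, Measurable (ε i)
  meas_u : ∀ i, Measurable (u i)
  indep : iIndepFun (fun i ω => (ε i ω, u i ω, z i ω)) μ
  ε_four : ∀ i, MemLp (ε i) 4 μ
  u_four : ∀ i a, MemLp (fun ω => u i ω a) 4 μ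
  ε_mean : ∀ i, μ[ε i | MeasurableSpace.comap (z i) inferInstance] =ᵐ[μ] 0
  u_mean : ∀ i a, μ[fun ω => u i ω a | MeasurableSpace.comap (z i) inferInstance] =ᵐ[μ] 0
  ε_ε : ∀ i, μ[fun ω => ε i ω * ε i ω | MeasurableSpace.comap (z i) inferInstance]
    =ᵐ[μ] fun _ => σε2
  u_ε : ∀ i a, μ[fun ω => u i ω a * ε i ω | MeasurableSpace.comap (z i) inferInstance]
    =ᵐ[μ] fun _ => σue a
  u_ε_ε : ∀ i a, μ[fun ω => u i ω a * (ε i ω * ε i ω) |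
    MeasurableSpace.comap (z i) inferInstance] =ᵐ[μ] fun _ => τ a
  u_u : ∀ i a b, ∀ᵐ ω ∂μ,
    |(μ[fun ω => u i ω a * u i ω b | MeasurableSpace.comap (z i) inferInstance]) ω| ≤ C
  u_ε_u_ε : ∀ i a b, ∀ᵐ ω ∂μ, |(μ[fun ω => u i ω a * ε i ω * (u i ω b * ε i ω) |
    MeasurableSpace.comap (z i) inferInstance]) ω| ≤ C

variable {μ : Measure Ω} {z : ℕ → Ω → 𝒵} {ε : ℕ → Ω → ℝ}
  {u : ℕ → Ω → n → ℝ} {σε2 : ℝ} {σue τ : n → ℝ} {C : ℝ}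

lemma integrable_prod_four [IsFiniteMeasure μ] {X : Fin 4 → Ω → ℝ} (hX : ∀ t, MemLp (X t) 4 μ) :
    Integrable (fun ω => ∏ t, X t ω) μ := by
  have h : MemLp (∏ t, X t) (∑ _t : Fin 4, (4 : ENNReal)⁻¹)⁻¹ μ :=
    MemLp.prod (s := Finset.univ) (p := fun _ => 4) fun t _ => hX t
  have e : (∑ _t : Fin 4, (4 : ENNReal)⁻¹)⁻¹ = 1 := by
    simp only [Finset.sum_const, Finset.card_univ, Fintype.card_fin, nsmul_eq_mul]
    rw [Nat.cast_ofNat, ENNReal.mul_inv_cancel (by norm_num) (by norm_num), inv_one]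
  rw [e] at h
  convert! h.integrable le_rfl using 1

/-- A family `X i` of random variables such that `X i` is a function of the `i`-th observation and
has a finite fourth moment. -/
structure IsLetter (μ : Measure Ω) (z : ℕ → Ω → 𝒵) (ε : ℕ → Ω → ℝ) (u : ℕ → Ω → n → ℝ)
    (X : ℕ → Ω → ℝ) : Prop where
  meas : ∀ i, Measurable[MeasurableSpace.comap (fun ω => (ε i ω, u i ω, z i ω)) inferInstance] (X i)
  four : ∀ i, MemLp (X i) 4 μ

namespace ErrorModel

lemma isLetter_ε (M : ErrorModel μ z ε u σε2 σue τ C) : IsLetter μ z ε u ε where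
  meas i := measurable_fst.comp (comap_measurable fun ω => (ε i ω, u i ω, z i ω))
  four := M.ε_four

lemma isLetter_u (M : ErrorModel μ z ε u σε2 σue τ C) (a : n) :
    IsLetter μ z ε u (fun i ω => u i ω a) where
  meas i := (measurable_pi_apply a).comp <| measurable_fst.comp <| measurable_snd.comp
    (comap_measurable fun ω => (ε i ω, u i ω, z i ω))
  four i := M.u_four i a

lemma isLetter_one [IsProbabilityMeasure μ] : IsLetter μ z ε u (fun _ _ => 1) where
  meas _ := measurable_const
  four _ := memLp_const 1

variable [IsProbabilityMeasure μ]

/-- The conditional expectation of a product of four errors (or ones), belonging to the observations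
`p 0, …, p 3`, factors over the observations. -/
lemma condExp_word (M : ErrorModel μ z ε u σε2 σue τ C) {N : ℕ} {X : Fin 4 → ℕ → Ω → ℝ}
    (hX : ∀ t, IsLetter μ z ε u (X t)) (p : Fin 4 → Fin N) :
    μ[fun ω => ∏ t, X t (p t) ω | sampleSigma z N] =ᵐ[μ] fun ω => ∏ i : Fin N,
      (μ[fun ω => ∏ t, if p t = i then X t i ω else 1 |
        MeasurableSpace.comap (z i) inferInstance]) ω := by
  have h := condExp_prod_eq_prod_condExp (μ := μ) (N := N)
    (w := fun i ω => (ε i ω, u i ω, z i ω)) (z := fun i => z i)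
    (h := fun i ω => ∏ t, if p t = i then X t i ω else 1)
    (M.indep.precomp Fin.val_injective)
    (fun i => (M.meas_ε i).prodMk ((M.meas_u i).prodMk (M.meas_z i)))
    (π := fun w => w.2.2) (measurable_snd.comp measurable_snd) (fun i => rfl)
    (fun i => Finset.measurable_fun_prod _ fun t _ => by
      split_ifs
      · exact (hX t).meas i
      · exact measurable_const)
    (fun i => by
      refine integrable_prod_four (X := fun t ω => if p t = i then X t i ω else 1) fun t => ?_
      split_ifs
      · exact (hX t).four i
      · exact memLp_const 1)
  have e : (fun ω => ∏ i : Fin N, ∏ t, if p t = i then X t i ω else 1) =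
      fun ω => ∏ t, X t (p t) ω := by
    ext ω
    rw [Finset.prod_comm]
    simp
  rw [e] at h
  exact h

/-- The conditional expectation vanishes if the observation of one of the errors is not that of
another one. -/
lemma condExp_word_isolated (M : ErrorModel μ z ε u σε2 σue τ C) {N : ℕ} {X : Fin 4 → ℕ → Ω → ℝ}
    (hX : ∀ t, IsLetter μ z ε u (X t)) (p : Fin 4 → Fin N) (t₀ : Fin 4)
    (hp : ∀ t, t ≠ t₀ → p t ≠ p t₀)
    (h0 : ∀ i, μ[X t₀ i | MeasurableSpace.comap (z i) inferInstance] =ᵐ[μ] 0) :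
    μ[fun ω => ∏ t, X t (p t) ω | sampleSigma z N] =ᵐ[μ] fun _ => 0 := by
  filter_upwards [M.condExp_word hX p, h0 (p t₀)] with ω h1 h2
  rw [h1]
  refine Finset.prod_eq_zero (Finset.mem_univ (p t₀)) ?_
  have e : (fun ω => ∏ t, if p t = p t₀ then X t (p t₀) ω else 1) = X t₀ (p t₀) := by
    ext ω
    rw [Finset.prod_eq_single t₀ (fun t _ ht => if_neg (hp t ht)) (by simp)]
    simp
  rw [e, h2, Pi.zero_apply]

lemma condExp_one_apply (M : ErrorModel μ z ε u σε2 σue τ C) (i : ℕ) (ω : Ω) :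
    (μ[fun _ => (1 : ℝ) | MeasurableSpace.comap (z i) inferInstance]) ω = 1 := by
  rw [condExp_const (M.meas_z i).comap_le]

/-- If all four errors belong to the `i`-th observation, only `z_i` matters. -/
lemma condExp_word_same (M : ErrorModel μ z ε u σε2 σue τ C) {N : ℕ} {X : Fin 4 → ℕ → Ω → ℝ}
    (hX : ∀ t, IsLetter μ z ε u (X t)) (i : Fin N) :
    μ[fun ω => ∏ t, X t i ω | sampleSigma z N] =ᵐ[μ]
      μ[fun ω => ∏ t, X t i ω | MeasurableSpace.comap (z i) inferInstance] := by
  filter_upwards [M.condExp_word hX fun _ => i] with ω h1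
  rw [h1, Finset.prod_eq_single i]
  · simp
  · intro j _ hj
    simp only [if_neg hj.symm, Finset.prod_const_one]
    exact M.condExp_one_apply j ω
  · simp

/-- If the errors form two pairs that belong to different observations, the conditional expectation
is a product. -/
lemma condExp_word_pairs (M : ErrorModel μ z ε u σε2 σue τ C) {N : ℕ} {X Y X' Y' : ℕ → Ω → ℝ}
    (hX : IsLetter μ z ε u X) (hY : IsLetter μ z ε u Y) (hX' : IsLetter μ z ε u X')
    (hY' : IsLetter μ z ε u Y') {i j : Fin N} (hij : i ≠ j) :
    μ[fun ω => X i ω * Y i ω * (X' j ω * Y' j ω) | sampleSigma z N] =ᵐ[μ]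
      fun ω => (μ[fun ω => X i ω * Y i ω | MeasurableSpace.comap (z i) inferInstance]) ω *
        (μ[fun ω => X' j ω * Y' j ω | MeasurableSpace.comap (z j) inferInstance]) ω := by
  have h := M.condExp_word (X := ![X, Y, X', Y'])
    (by intro t; fin_cases t <;> assumption) ![i, i, j, j]
  simp only [Fin.prod_univ_four] at h
  simp only [Matrix.cons_val] at h
  have e : (fun ω => X i ω * Y i ω * (X' j ω * Y' j ω)) =
      fun ω => X i ω * Y i ω * X' j ω * Y' j ω := by ext ω; ring
  rw [e]
  filter_upwards [h] with ω h1
  rw [h1, Finset.prod_eq_mul i j hij]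
  · simp [hij, hij.symm]
  · intro l _ hl
    have hi : i ≠ l := hl.1.symm
    have hj : j ≠ l := hl.2.symm
    simp only [hi, hj, if_false, mul_one]
    exact M.condExp_one_apply l ω
  · simp
  · simp

lemma condExp_ε_mul_ε (M : ErrorModel μ z ε u σε2 σue τ C) {N : ℕ} (i j : Fin N) :
    μ[fun ω => ε i ω * ε j ω | sampleSigma z N] =ᵐ[μ] fun _ => if i = j then σε2 else 0 := by
  have hX : ∀ t, IsLetter μ z ε u
      ((![ε, ε, fun _ _ => 1, fun _ _ => 1] : Fin 4 → ℕ → Ω → ℝ) t) := by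
    intro t
    fin_cases t
    exacts [M.isLetter_ε, M.isLetter_ε, isLetter_one, isLetter_one]
  split_ifs with hij
  · subst hij
    have h := M.condExp_word_same hX i
    simp only [Fin.prod_univ_four] at h
    simp only [Matrix.cons_val, mul_one] at h
    exact h.trans (M.ε_ε i)
  · have h := M.condExp_word_isolated hX ![i, j, j, j] 0
      (by intro t ht; fin_cases t <;> simp_all [eq_comm]) M.ε_mean
    simp only [Fin.prod_univ_four] at h
    simpa only [Matrix.cons_val, mul_one] using h

lemma condExp_u_mul_u (M : ErrorModel μ z ε u σε2 σue τ C) {N : ℕ} (i j : Fin N) (a b : n) :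
    ∀ᵐ ω ∂μ, |(μ[fun ω => u i ω a * u j ω b | sampleSigma z N]) ω| ≤ if i = j then C else 0 := by
  have hX : ∀ t, IsLetter μ z ε u ((![fun i ω => u i ω a, fun i ω => u i ω b, fun _ _ => 1,
      fun _ _ => 1] : Fin 4 → ℕ → Ω → ℝ) t) := by
    intro t
    fin_cases t
    exacts [M.isLetter_u a, M.isLetter_u b, isLetter_one, isLetter_one]
  split_ifs with hij
  · subst hij
    have h := M.condExp_word_same hX i
    simp only [Fin.prod_univ_four] at h
    simp only [Matrix.cons_val, mul_one] at h
    filter_upwards [h, M.u_u i a b] with ω h1 h2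
    rwa [h1]
  · have h := M.condExp_word_isolated hX ![i, j, j, j] 0
      (by intro t ht; fin_cases t <;> simp_all [eq_comm]) (fun i => M.u_mean i a)
    simp only [Fin.prod_univ_four] at h
    simp only [Matrix.cons_val, mul_one] at h
    filter_upwards [h] with ω h1
    rw [h1]; simp

lemma condExp_u_mul_ε_mul_ε (M : ErrorModel μ z ε u σε2 σue τ C) {N : ℕ} (i j l : Fin N) (a : n) :
    μ[fun ω => u i ω a * (ε j ω * ε l ω) | sampleSigma z N] =ᵐ[μ]
      fun _ => if i = j ∧ i = l then τ a else 0 := by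
  have e : (fun ω => u i ω a * (ε j ω * ε l ω)) = fun ω => u i ω a * ε j ω * ε l ω := by
    ext ω; ring
  have hX : ∀ t, IsLetter μ z ε u ((![fun i ω => u i ω a, ε, ε,
      fun _ _ => 1] : Fin 4 → ℕ → Ω → ℝ) t) := by
    intro t
    fin_cases t
    exacts [M.isLetter_u a, M.isLetter_ε, M.isLetter_ε, isLetter_one]
  rw [e]
  by_cases hj : i = j
  · subst hj
    by_cases hl : i = l
    · subst hl
      have h := M.condExp_word_same hX i
      simp only [Fin.prod_univ_four] at h
      simp only [Matrix.cons_val, mul_one] at h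
      have h2 := M.u_ε_ε i a
      simp only [← mul_assoc] at h2
      simpa using h.trans h2
    · have h := M.condExp_word_isolated hX ![i, i, l, i] 2
        (by intro t ht; fin_cases t <;> simp_all [eq_comm]) M.ε_mean
      simp only [Fin.prod_univ_four] at h
      simp only [Matrix.cons_val, mul_one] at h
      simpa [hl] using h
  · by_cases hl : i = l
    · subst hl
      have h := M.condExp_word_isolated hX ![i, j, i, i] 1
        (by intro t ht; fin_cases t <;> simp_all [eq_comm]) M.ε_mean
      simp only [Fin.prod_univ_four] at h
      simp only [Matrix.cons_val, mul_one] at h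
      simpa [hj] using h
    · have h := M.condExp_word_isolated hX ![i, j, l, j] 0
        (by intro t ht; fin_cases t <;> simp_all [eq_comm]) (fun i => M.u_mean i a)
      simp only [Fin.prod_univ_four] at h
      simp only [Matrix.cons_val, mul_one] at h
      simpa [hl] using h

end ErrorModel
end ErrorMoments

section SampleMoments

variable {Ω 𝒵 n : Type*} [mΩ : MeasurableSpace Ω] [m𝒵 : MeasurableSpace 𝒵] {μ : Measure Ω}
  {z : ℕ → Ω → 𝒵} {ε : ℕ → Ω → ℝ} {u : ℕ → Ω → n → ℝ} {σε2 : ℝ} {σue τ : n → ℝ} {C : ℝ}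

namespace ErrorModel

variable [IsProbabilityMeasure μ]

/-- Up to a bounded error that occurs only on the two pairings `i = l, j = m` and `i = m, j = l`,
the conditional moment of `u_i ε_j u_l ε_m` is that of the pairing `i = j, l = m`, which carries the
endogeneity. -/
lemma condExp_u_mul_ε_mul_u_mul_ε (M : ErrorModel μ z ε u σε2 σue τ C) {N : ℕ} (i j l m : Fin N)
    (a b : n) :
    ∀ᵐ ω ∂μ, |(μ[fun ω => u i ω a * ε j ω * (u l ω b * ε m ω) | sampleSigma z N]) ω -
        if i = j ∧ l = m then σue a * σue b else 0| ≤
      (C + |σue a * σue b| + C * |σε2|) *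
        ((if i = l ∧ j = m then 1 else 0) + if i = m ∧ j = l then 1 else 0) := by
  have hC := M.C_nonneg
  have e : (fun ω => u i ω a * ε j ω * (u l ω b * ε m ω)) =
    fun ω => u i ω a * ε j ω * u l ω b * ε m ω := by ext ω; ring
  have hX : ∀ t, IsLetter μ z ε u ((![fun i ω => u i ω a, ε, fun i ω => u i ω b, ε] :
      Fin 4 → ℕ → Ω → ℝ) t) := by
    intro t
    fin_cases t
    exacts [M.isLetter_u a, M.isLetter_ε, M.isLetter_u b, M.isLetter_ε]
  have hK : 0 ≤ C + |σue a * σue b| + C * |σε2| := by positivity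
  have hnn : 0 ≤ (C + |σue a * σue b| + C * |σε2|) *
      (((if i = l ∧ j = m then 1 else 0) + if i = m ∧ j = l then 1 else 0 : ℝ)) := by
    refine mul_nonneg hK (add_nonneg ?_ ?_) <;> split_ifs <;> norm_num
  -- an isolated observation makes the conditional moment vanish
  have hiso : ∀ t₀ : Fin 4, (∀ t, t ≠ t₀ → (![i, j, l, m] : Fin 4 → Fin N) t ≠ ![i, j, l, m] t₀) →
      ¬ (i = j ∧ l = m) →
      ∀ᵐ ω ∂μ, |(μ[fun ω => u i ω a * ε j ω * (u l ω b * ε m ω) | sampleSigma z N]) ω -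
          if i = j ∧ l = m then σue a * σue b else 0| ≤
        (C + |σue a * σue b| + C * |σε2|) *
          ((if i = l ∧ j = m then 1 else 0) + if i = m ∧ j = l then 1 else 0) := by
    intro t₀ ht₀ hne
    have h := M.condExp_word_isolated hX ![i, j, l, m] t₀ ht₀ (by
      fin_cases t₀
      exacts [fun i => M.u_mean i a, M.ε_mean, fun i => M.u_mean i b, M.ε_mean])
    simp only [Fin.prod_univ_four] at h
    simp only [Matrix.cons_val] at h
    rw [e]
    filter_upwards [h] with ω h1
    rw [h1, if_neg hne, sub_zero, abs_zero]
    exact hnn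
  by_cases hij : i = j
  · subst hij
    by_cases hlm : l = m
    · subst hlm
      by_cases hil : i = l
      · subst hil
        have h := M.condExp_word_same hX i
        simp only [Fin.prod_univ_four] at h
        simp only [Matrix.cons_val] at h
        rw [← e] at h
        filter_upwards [h, M.u_ε_u_ε i a b] with ω h1 h2
        rw [h1]
        simp only [and_self, if_true]
        refine (abs_sub _ _).trans ?_
        nlinarith [abs_nonneg (σue a * σue b), mul_nonneg hC (abs_nonneg σε2)]
      · filter_upwards [M.condExp_word_pairs (M.isLetter_u a) M.isLetter_ε (M.isLetter_u b)
          M.isLetter_ε hil, M.u_ε i a, M.u_ε l b] with ω h1 h2 h3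
        rw [h1, h2, h3]
        simp [hil]
    · by_cases hil : l = i
      · subst hil
        exact hiso 3 (by intro t ht; fin_cases t <;> simp_all [eq_comm]) (by simp [hlm])
      · exact hiso 2 (by intro t ht; fin_cases t <;> simp_all [eq_comm]) (by simp [hlm])
  · by_cases hil : i = l
    · subst hil
      by_cases hjm : j = m
      · subst hjm
        have e' : (fun ω => u i ω a * ε j ω * (u i ω b * ε j ω)) =
          fun ω => u i ω a * u i ω b * (ε j ω * ε j ω) := by ext ω; ring
        rw [e']
        filter_upwards [M.condExp_word_pairs (M.isLetter_u a) (M.isLetter_u b) M.isLetter_ε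
          M.isLetter_ε hij, M.u_u i a b, M.ε_ε j] with ω h1 h2 h3
        rw [h1, h3]
        have hji : ¬ j = i := fun h => hij h.symm
        simp only [hij, hji, and_self, if_true, if_false, add_zero, mul_one, sub_zero, abs_mul]
        have : |(μ[fun ω => u i ω a * u i ω b | MeasurableSpace.comap (z i) inferInstance]) ω| *
          |σε2| ≤ C * |σε2| := by gcongr
        have := mul_nonneg (abs_nonneg (σue a)) (abs_nonneg (σue b))
        linarith
      · exact hiso 1 (by intro t ht; fin_cases t <;> simp_all [eq_comm]) (by simp [hij])
    · by_cases him : i = m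
      · subst him
        by_cases hjl : j = l
        · subst hjl
          have e' : (fun ω => u i ω a * ε j ω * (u j ω b * ε i ω)) =
            fun ω => u i ω a * ε i ω * (u j ω b * ε j ω) := by ext ω; ring
          rw [e']
          filter_upwards [M.condExp_word_pairs (M.isLetter_u a) M.isLetter_ε (M.isLetter_u b)
            M.isLetter_ε hij, M.u_ε i a, M.u_ε j b] with ω h1 h2 h3
          rw [h1, h2, h3]
          simp only [hij, false_and, and_self, if_true, if_false, zero_add, mul_one, sub_zero]
          linarith [mul_nonneg hC (abs_nonneg σε2)]
        · exact hiso 1 (by intro t ht; fin_cases t <;> simp_all [eq_comm]) (by simp [hij])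
      · exact hiso 0 (by intro t ht; fin_cases t <;> simp_all [eq_comm]) (by simp [hij])

lemma integrable_word {X Y X' Y' : ℕ → Ω → ℝ}
    (hX : IsLetter μ z ε u X) (hY : IsLetter μ z ε u Y) (hX' : IsLetter μ z ε u X')
    (hY' : IsLetter μ z ε u Y') (i j l m : ℕ) :
    Integrable (fun ω => X i ω * Y j ω * (X' l ω * Y' m ω)) μ := by
  have h := integrable_prod_four (μ := μ) (X := ![X i, Y j, X' l, Y' m]) (by
    intro t
    fin_cases t
    exacts [hX.four i, hY.four j, hX'.four l, hY'.four m])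
  simp only [Fin.prod_univ_four] at h
  simp only [Matrix.cons_val] at h
  simpa only [mul_assoc] using h

lemma hasCondExp_ε_ε (M : ErrorModel μ z ε u σε2 σue τ C) {N : ℕ} (i j : Fin N) :
    HasCondExp μ (sampleSigma z N) (fun ω => ε i ω * ε j ω)
      (fun _ => if i = j then σε2 else 0) := by
  refine HasCondExp.congr (HasCondExp.of_integrable ?_) (M.condExp_ε_mul_ε i j)
  simpa using integrable_word M.isLetter_ε M.isLetter_ε isLetter_one isLetter_one i j i i

lemma hasCondExp_u_ε_ε (M : ErrorModel μ z ε u σε2 σue τ C) {N : ℕ} (i j l : Fin N) (a : n) :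
    HasCondExp μ (sampleSigma z N) (fun ω => u i ω a * (ε j ω * ε l ω))
      (fun _ => if i = j ∧ i = l then τ a else 0) := by
  refine HasCondExp.congr (HasCondExp.of_integrable ?_) (M.condExp_u_mul_ε_mul_ε i j l a)
  simpa using integrable_word (M.isLetter_u a) isLetter_one M.isLetter_ε M.isLetter_ε i i j l

lemma hasCondExp_u_u (M : ErrorModel μ z ε u σε2 σue τ C) {N : ℕ} (i j : Fin N) (a b : n) :
    HasCondExp μ (sampleSigma z N) (fun ω => u i ω a * u j ω b)
      (μ[fun ω => u i ω a * u j ω b | sampleSigma z N]) := by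
  refine HasCondExp.of_integrable ?_
  simpa using integrable_word (M.isLetter_u a) (M.isLetter_u b) isLetter_one isLetter_one i j i i

lemma hasCondExp_u_ε_u_ε (M : ErrorModel μ z ε u σε2 σue τ C) {N : ℕ} (i j l m : Fin N) (a b : n) :
    HasCondExp μ (sampleSigma z N) (fun ω => u i ω a * ε j ω * (u l ω b * ε m ω))
      (μ[fun ω => u i ω a * ε j ω * (u l ω b * ε m ω) | sampleSigma z N]) :=
  HasCondExp.of_integrable <|
    integrable_word (M.isLetter_u a) M.isLetter_ε (M.isLetter_u b) M.isLetter_ε i j l m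

end ErrorModel

/-! ### Conditional moments of linear and quadratic forms in the errors -/

/-- The column vector of the first `N` structural errors. -/
def errCol (N : ℕ) (ε : ℕ → Ω → ℝ) (ω : Ω) : Matrix (Fin N) Unit ℝ := Matrix.of fun i _ => ε i ω

/-- The matrix whose rows are the first `N` reduced form errors. -/
def errMat (N : ℕ) (u : ℕ → Ω → n → ℝ) (ω : Ω) : Matrix (Fin N) n ℝ := Matrix.of fun i => u i ω

namespace ErrorModel

variable {N : ℕ} {L : Ω → Matrix (Fin N) n ℝ}
  {P : Ω → Matrix (Fin N) (Fin N) ℝ}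

lemma sampleSigma_le (M : ErrorModel μ z ε u σε2 σue τ C) (N : ℕ) : sampleSigma z N ≤ mΩ :=
  (measurable_pi_lambda _ fun _ => M.meas_z _).comap_le

variable [IsProbabilityMeasure μ]

/-- `E[αα' | z] = σ_ε² L'L` for `α = L'ε`. -/
lemma hasCondExp_linear_linear (M : ErrorModel μ z ε u σε2 σue τ C)
    (hL : ∀ i a, Measurable[sampleSigma z N] fun ω => L ω i a) (a b : n) :
    HasCondExp μ (sampleSigma z N)
      (fun ω => ((L ω)ᵀ * errCol N ε ω * ((L ω)ᵀ * errCol N ε ω)ᵀ) a b)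
      (fun ω => (σε2 • ((L ω)ᵀ * L ω)) a b) := by
  have hm := M.sampleSigma_le N
  have key := HasCondExp.sum hm Finset.univ fun i _ => HasCondExp.sum hm Finset.univ fun j _ =>
    (M.hasCondExp_ε_ε i j).mul_left hm ((hL i a).mul (hL j b))
  convert! key using 1
  · ext ω
    simp only [mul_apply, transpose_apply, errCol, of_apply, Finset.univ_unique, Finset.sum_const,
      Finset.card_singleton, one_smul, Finset.sum_mul_sum, Pi.mul_apply]
    exact Finset.sum_congr rfl fun i _ => Finset.sum_congr rfl fun j _ => by ring
  · ext ω
    simp only [Matrix.smul_apply, mul_apply, transpose_apply, smul_eq_mul, Finset.mul_sum,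
      Pi.mul_apply,
      mul_ite, mul_zero, Finset.sum_ite_eq, Finset.mem_univ, if_true]
    exact Finset.sum_congr rfl fun i _ => by ring

/-- `E[αb' | z]` for `α = L'ε` and `b = u'Pε`: only the diagonal of `P` contributes. -/
lemma hasCondExp_linear_quadratic (M : ErrorModel μ z ε u σε2 σue τ C)
    (hL : ∀ i a, Measurable[sampleSigma z N] fun ω => L ω i a)
    (hP : ∀ i j, Measurable[sampleSigma z N] fun ω => P ω i j) (a b : n) :
    HasCondExp μ (sampleSigma z N)
      (fun ω => ((L ω)ᵀ * errCol N ε ω * ((errMat N u ω)ᵀ * P ω * errCol N ε ω)ᵀ) a b)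
      (fun ω => (∑ i, L ω i a * P ω i i) * τ b) := by
  have hm := M.sampleSigma_le N
  have key := HasCondExp.sum hm Finset.univ fun l _ => HasCondExp.sum hm Finset.univ fun j _ =>
    HasCondExp.sum hm Finset.univ fun i _ =>
      (M.hasCondExp_u_ε_ε i j l b).mul_left hm ((hL l a).mul (hP i j))
  convert! key using 1
  · ext ω
    simp only [mul_apply, transpose_apply, errCol, errMat, of_apply, Finset.univ_unique,
      Finset.sum_const, Finset.card_singleton, one_smul, Finset.sum_mul_sum, Pi.mul_apply]
    refine Finset.sum_congr rfl fun i _ => Finset.sum_congr rfl fun j _ => ?_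
    rw [Finset.sum_mul, Finset.mul_sum]
    exact Finset.sum_congr rfl fun l _ => by ring
  · ext ω
    simp only [Pi.mul_apply, mul_ite, mul_zero]
    rw [Finset.sum_mul]
    refine Finset.sum_congr rfl fun l _ => ?_
    rw [Finset.sum_eq_single l, Finset.sum_eq_single l]
    · simp
    · intro i _ hi; simp [hi]
    · simp
    · intro j _ hj
      refine Finset.sum_eq_zero fun i _ => if_neg ?_
      rintro ⟨rfl, rfl⟩; exact hj rfl
    · simp

/-- `E[bb' | z]` for `b = u'Pε` is `σ_{uε} σ_{uε}' (tr P)²`, up to a multiple of the squared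
Frobenius norm of `P`. The main term gives the `k²` in `S(k)`. -/
lemma hasCondExp_quadratic_quadratic (M : ErrorModel μ z ε u σε2 σue τ C)
    (hP : ∀ i j, Measurable[sampleSigma z N] fun ω => P ω i j)
    (hsymm : ∀ ω, (P ω)ᵀ = P ω) (a b : n) :
    ∃ R : Ω → ℝ, HasCondExp μ (sampleSigma z N)
        (fun ω => ((errMat N u ω)ᵀ * P ω * errCol N ε ω *
          ((errMat N u ω)ᵀ * P ω * errCol N ε ω)ᵀ) a b) R ∧
      ∀ᵐ ω ∂μ, |R ω - σue a * σue b * (P ω).trace ^ 2| ≤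
        2 * (C + |σue a * σue b| + C * |σε2|) * ∑ i, ∑ j, P ω i j ^ 2 := by
  have hm := M.sampleSigma_le N
  have key := HasCondExp.sum hm Finset.univ fun j _ => HasCondExp.sum hm Finset.univ fun m _ =>
    HasCondExp.sum hm Finset.univ fun i _ => HasCondExp.sum hm Finset.univ fun l _ =>
      (M.hasCondExp_u_ε_u_ε i j l m a b).mul_left hm ((hP i j).mul (hP l m))
  have eX : (fun ω => ((errMat N u ω)ᵀ * P ω * errCol N ε ω *
      ((errMat N u ω)ᵀ * P ω * errCol N ε ω)ᵀ) a b) = fun ω => ∑ j, ∑ m, ∑ i, ∑ l,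
        ((fun ω => P ω i j) * fun ω => P ω l m) ω *
          (u i ω a * ε j ω * (u l ω b * ε m ω)) := by
    ext ω
    simp only [mul_apply, transpose_apply, errCol, errMat, of_apply, Finset.univ_unique,
      Finset.sum_const, Finset.card_singleton, one_smul, Finset.sum_mul_sum, Pi.mul_apply]
    refine Finset.sum_congr rfl fun j _ => Finset.sum_congr rfl fun m _ => ?_
    rw [Finset.sum_mul, Finset.sum_mul]
    refine Finset.sum_congr rfl fun i _ => ?_
    rw [Finset.sum_mul, Finset.mul_sum]
    exact Finset.sum_congr rfl fun l _ => by ring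
  rw [eX]
  refine ⟨_, key, ?_⟩
  set K : ℝ := C + |σue a * σue b| + C * |σε2| with hK
  have h : ∀ᵐ ω ∂μ, ∀ i j l m : Fin N,
      |(μ[fun ω => u i ω a * ε j ω * (u l ω b * ε m ω) | sampleSigma z N]) ω -
        if i = j ∧ l = m then σue a * σue b else 0| ≤
        K * ((if i = l ∧ j = m then 1 else 0) + if i = m ∧ j = l then 1 else 0) :=
    ae_all_iff.2 fun i => ae_all_iff.2 fun j => ae_all_iff.2 fun l => ae_all_iff.2 fun m =>
      M.condExp_u_mul_ε_mul_u_mul_ε i j l m a b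
  filter_upwards [h] with ω hω
  have htr : σue a * σue b * (P ω).trace ^ 2 = ∑ j, ∑ m, ∑ i, ∑ l,
      P ω i j * P ω l m * if i = j ∧ l = m then σue a * σue b else 0 := by
    rw [trace, pow_two, Finset.sum_mul_sum, Finset.mul_sum]
    refine Finset.sum_congr rfl fun j _ => ?_
    rw [Finset.mul_sum]
    refine Finset.sum_congr rfl fun m _ => ?_
    rw [Finset.sum_eq_single j, Finset.sum_eq_single m]
    · simp only [diag_apply, and_self, if_true]; ring
    · intro l _ hl; simp [hl]
    · simp
    · intro i _ hi; simp [hi]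
    · simp
  rw [htr]
  simp only [← Finset.sum_sub_distrib, Pi.mul_apply, ← mul_sub]
  calc _ ≤ ∑ j, ∑ m, ∑ i, ∑ l, |P ω i j * P ω l m| *
        (K * ((if i = l ∧ j = m then 1 else 0) + if i = m ∧ j = l then 1 else 0)) := by
        refine (Finset.abs_sum_le_sum_abs _ _).trans (Finset.sum_le_sum fun j _ => ?_)
        refine (Finset.abs_sum_le_sum_abs _ _).trans (Finset.sum_le_sum fun m _ => ?_)
        refine (Finset.abs_sum_le_sum_abs _ _).trans (Finset.sum_le_sum fun i _ => ?_)
        refine (Finset.abs_sum_le_sum_abs _ _).trans (Finset.sum_le_sum fun l _ => ?_)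
        rw [abs_mul]
        exact mul_le_mul_of_nonneg_left (hω i j l m) (abs_nonneg _)
    _ = ∑ j, ∑ i, K * (|P ω i j * P ω i j| + |P ω i j * P ω j i|) := by
        refine Finset.sum_congr rfl fun j _ => ?_
        rw [Finset.sum_comm]
        refine Finset.sum_congr rfl fun i _ => ?_
        simp only [mul_add, Finset.sum_add_distrib]
        congr 1
        · rw [Finset.sum_eq_single j, Finset.sum_eq_single i]
          · simp; ring
          · intro l _ hl; simp [hl.symm]
          · simp
          · intro m _ hm; simp [hm.symm]
          · simp
        · rw [Finset.sum_eq_single i, Finset.sum_eq_single j]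
          · simp; ring
          · intro l _ hl; simp [hl.symm]
          · simp
          · intro m _ hm; simp [hm.symm]
          · simp
    _ = 2 * K * ∑ i, ∑ j, P ω i j ^ 2 := by
        rw [Finset.sum_comm, Finset.mul_sum]
        refine Finset.sum_congr rfl fun i _ => ?_
        rw [Finset.mul_sum]
        refine Finset.sum_congr rfl fun j _ => ?_
        have : P ω j i = P ω i j := congrFun (congrFun (hsymm ω) i) j
        rw [this, ← pow_two, abs_of_nonneg (sq_nonneg _)]
        ring

/-- `E[(L'u + u'L) G αα' | z]` for `α = L'ε`: only the terms with all errors from the same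
observation remain. -/
lemma hasCondExp_cubic (M : ErrorModel μ z ε u σε2 σue τ C) [Fintype n]
    (hL : ∀ i a, Measurable[sampleSigma z N] fun ω => L ω i a) {G : Ω → Matrix n n ℝ}
    (hG : ∀ i j, Measurable[sampleSigma z N] fun ω => G ω i j) (a b : n) :
    HasCondExp μ (sampleSigma z N)
      (fun ω => (((L ω)ᵀ * errMat N u ω + (errMat N u ω)ᵀ * L ω) * G ω *
        ((L ω)ᵀ * errCol N ε ω * ((L ω)ᵀ * errCol N ε ω)ᵀ)) a b)
      (fun ω => ∑ c, ∑ d, G ω c d *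
        ∑ i, (L ω i a * τ c + L ω i c * τ a) * (L ω i d * L ω i b)) := by
  have hm := M.sampleSigma_le N
  have key := HasCondExp.sum hm Finset.univ fun d _ => HasCondExp.sum hm Finset.univ fun c _ =>
    HasCondExp.mul_left hm (HasCondExp.sum hm Finset.univ fun i _ =>
      HasCondExp.sum hm Finset.univ fun j _ => HasCondExp.sum hm Finset.univ fun l _ =>
        HasCondExp.mul_left hm
          (((M.hasCondExp_u_ε_ε i j l c).mul_left hm (hL i a)).add hm
            ((M.hasCondExp_u_ε_ε i j l a).mul_left hm (hL i c)))
          ((hL j d).mul (hL l b))) (hG c d)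
  convert! key using 1
  · ext ω
    simp only [mul_apply, Matrix.add_apply, transpose_apply, errCol, errMat, of_apply,
      Finset.univ_unique, Finset.sum_const, Finset.card_singleton, one_smul, Pi.mul_apply,
      ← Finset.sum_add_distrib]
    refine Finset.sum_congr rfl fun d _ => ?_
    rw [Finset.sum_mul]
    refine Finset.sum_congr rfl fun c _ => ?_
    rw [Finset.sum_mul_sum, mul_comm _ (G ω c d), mul_assoc, Finset.sum_mul]
    congr 1
    refine Finset.sum_congr rfl fun i _ => ?_
    rw [Finset.mul_sum]
    refine Finset.sum_congr rfl fun j _ => ?_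
    rw [Finset.mul_sum]
    exact Finset.sum_congr rfl fun l _ => by ring
  · ext ω
    rw [Finset.sum_comm]
    refine Finset.sum_congr rfl fun d _ => Finset.sum_congr rfl fun c _ => ?_
    congr 1
    refine Finset.sum_congr rfl fun i _ => ?_
    rw [Finset.sum_eq_single i, Finset.sum_eq_single i]
    · simp only [and_self, if_true, Pi.mul_apply]; ring
    · intro l _ hl; simp [hl.symm]
    · simp
    · intro j _ hj
      refine Finset.sum_eq_zero fun l _ => ?_
      simp [hj.symm]
    · simp

/-- The second moments of the entries of `L'u`. -/
lemma hasCondExp_u_linear_sq (M : ErrorModel μ z ε u σε2 σue τ C)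
    (hL : ∀ i a, Measurable[sampleSigma z N] fun ω => L ω i a) (a b : n) :
    ∃ R : Ω → ℝ, HasCondExp μ (sampleSigma z N)
        (fun ω => ((L ω)ᵀ * errMat N u ω) a b ^ 2) R ∧
      ∀ᵐ ω ∂μ, R ω ≤ C * ∑ i, L ω i a ^ 2 := by
  have hm := M.sampleSigma_le N
  have key := HasCondExp.sum hm Finset.univ fun i _ => HasCondExp.sum hm Finset.univ fun j _ =>
      (M.hasCondExp_u_u i j b b).mul_left hm ((hL i a).mul (hL j a))
  have eX : (fun ω => ((L ω)ᵀ * errMat N u ω) a b ^ 2) = fun ω => ∑ i, ∑ j,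
      ((fun ω => L ω i a) * fun ω => L ω j a) ω * (u i ω b * u j ω b) := by
    ext ω
    simp only [mul_apply, transpose_apply, errMat, of_apply, pow_two, Finset.sum_mul_sum,
      Pi.mul_apply]
    exact Finset.sum_congr rfl fun i _ => Finset.sum_congr rfl fun j _ => by ring
  rw [eX]
  refine ⟨_, key, ?_⟩
  · have h : ∀ᵐ ω ∂μ, ∀ i j : Fin N,
        |(μ[fun ω => u i ω b * u j ω b | sampleSigma z N]) ω| ≤ if i = j then C else 0 :=
      ae_all_iff.2 fun i => ae_all_iff.2 fun j => M.condExp_u_mul_u i j b b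
    filter_upwards [h] with ω hω
    rw [Finset.mul_sum]
    refine Finset.sum_le_sum fun i _ => ?_
    calc _ ≤ ∑ j, |L ω i a * L ω j a| * (if i = j then C else 0) := by
          refine Finset.sum_le_sum fun j _ => (le_abs_self _).trans ?_
          rw [abs_mul]
          exact mul_le_mul_of_nonneg_left (hω i j) (abs_nonneg _)
      _ = _ := by
          simp only [mul_ite, mul_zero, Finset.sum_ite_eq, Finset.mem_univ, if_true]
          rw [← pow_two, abs_of_nonneg (sq_nonneg _)]; ring

/-- The means of the diagonal entries of `u'Pu`. -/
lemma hasCondExp_u_quadratic (M : ErrorModel μ z ε u σε2 σue τ C)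
    (hP : ∀ i j, Measurable[sampleSigma z N] fun ω => P ω i j)
    (hdiag : ∀ ω i, 0 ≤ P ω i i) (a : n) :
    ∃ R : Ω → ℝ, HasCondExp μ (sampleSigma z N)
        (fun ω => ((errMat N u ω)ᵀ * P ω * errMat N u ω) a a) R ∧
      ∀ᵐ ω ∂μ, R ω ≤ C * (P ω).trace := by
  have hm := M.sampleSigma_le N
  have key := HasCondExp.sum hm Finset.univ fun j _ => HasCondExp.sum hm Finset.univ fun i _ =>
      (M.hasCondExp_u_u i j a a).mul_left hm (hP i j)
  have eX : (fun ω => ((errMat N u ω)ᵀ * P ω * errMat N u ω) a a) = fun ω => ∑ j, ∑ i,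
      P ω i j * (u i ω a * u j ω a) := by
    ext ω
    simp only [mul_apply, transpose_apply, errMat, of_apply, Finset.sum_mul]
    exact Finset.sum_congr rfl fun i _ => Finset.sum_congr rfl fun j _ => by ring
  rw [eX]
  refine ⟨_, key, ?_⟩
  · have h : ∀ᵐ ω ∂μ, ∀ i j : Fin N,
        |(μ[fun ω => u i ω a * u j ω a | sampleSigma z N]) ω| ≤ if i = j then C else 0 :=
      ae_all_iff.2 fun i => ae_all_iff.2 fun j => M.condExp_u_mul_u i j a a
    filter_upwards [h] with ω hω
    rw [trace, Finset.mul_sum]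
    refine Finset.sum_le_sum fun j _ => ?_
    calc _ ≤ ∑ i, |P ω i j| * (if i = j then C else 0) := by
          refine Finset.sum_le_sum fun i _ => (le_abs_self _).trans ?_
          rw [abs_mul]
          exact mul_le_mul_of_nonneg_left (hω i j) (abs_nonneg _)
      _ = _ := by
          simp only [mul_ite, mul_zero, Finset.sum_ite_eq', Finset.mem_univ, if_true, diag_apply]
          rw [abs_of_nonneg (hdiag ω j)]; ring

end ErrorModel
end SampleMoments

/-! ### The algebra of the expansion -/

section Expansion

attribute [local instance] Matrix.frobeniusNormedAddCommGroup Matrix.frobeniusNormedSpace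

variable {l m n : Type*} [Fintype l] [Fintype m] [Fintype n]

lemma norm_mul_le_of_le {A : Matrix l m ℝ} {B : Matrix m n ℝ} {a b : ℝ} (hA : ‖A‖ ≤ a)
    (hB : ‖B‖ ≤ b) : ‖A * B‖ ≤ a * b :=
  (frobenius_norm_mul A B).trans
    (mul_le_mul hA hB (norm_nonneg _) ((norm_nonneg _).trans hA))

lemma inv_sub_inv_eq [DecidableEq n] {X G : Matrix n n ℝ} (hX : IsUnit X.det) (hG : IsUnit G.det) :
    X⁻¹ - G⁻¹ = X⁻¹ * (G - X) * G⁻¹ := by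
  rw [Matrix.mul_sub, Matrix.sub_mul, nonsing_inv_mul _ hX, Matrix.mul_assoc,
    mul_nonsing_inv _ hG, Matrix.mul_one, Matrix.one_mul]

/-- The remainder in the second order expansion of `(G + B₁ + B₂)⁻¹ (α + b)` and of its outer
product. Here `s` stands for `√N`; the terms `α`, `b`, `B₁`, `B₂` have the orders `√N`, `k`,
`1 / √N` and `k / N`. -/
lemma norm_outer_expansion_le [DecidableEq n] {G B₁ B₂ : Matrix n n ℝ} {α b : Matrix n Unit ℝ}
    {C k s : ℝ} (hC : 1 ≤ C) (hk : 1 ≤ k) (hks : k ≤ s) (hG : IsUnit G.det)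
    (hX : IsUnit (G + B₁ + B₂).det) (hGn : ‖G⁻¹‖ ≤ C) (hXn : ‖(G + B₁ + B₂)⁻¹‖ ≤ C)
    (hα : ‖α‖ ≤ C * s) (hb : ‖b‖ ≤ C * k) (hB₁ : ‖B₁‖ ≤ C / s) (hB₂ : ‖B₂‖ ≤ C * k / s ^ 2) :
    ‖(G + B₁ + B₂)⁻¹ * (α + b) * ((G + B₁ + B₂)⁻¹ * (α + b))ᵀ -
      G⁻¹ * ((α + b) * (α + b)ᵀ - B₁ * G⁻¹ * (α * αᵀ) - (B₁ * G⁻¹ * (α * αᵀ))ᵀ) * (G⁻¹)ᵀ‖ ≤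
      190 * C ^ 12 * k := by
  have hs : 1 ≤ s := hk.trans hks
  have hs0 : 0 < s := by linarith
  have hC0 : 0 < C := by linarith
  set B := B₁ + B₂ with hB
  set I := G⁻¹ with hI
  set J := (G + B₁ + B₂)⁻¹ with hJ
  -- the resolvent identity, used twice below to expand `J` to second order
  have hJI : J = I - J * B * I := by
    have h1 := inv_sub_inv_eq hX hG
    have h2 : G - (G + B₁ + B₂) = -B := by rw [hB]; abel
    rw [h2, Matrix.mul_neg, Matrix.neg_mul] at h1
    rw [sub_eq_iff_eq_add] at h1
    rw [sub_eq_add_neg, add_comm]; exact h1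
  -- `D` is the part of the second order term that enters the leading term, `R` the rest
  set D := I * (B₁ * (I * α)) with hD
  set R := -(I * (B₂ * (I * α))) - I * (B * (I * b)) + J * (B * (I * (B * (I * (α + b)))))
    with hR
  set V₀ := I * (α + b) with hV₀
  have hV : J * (α + b) = V₀ - D + R := by
    have h1 : J = I - I * B * I + J * B * I * B * I := by
      conv_lhs => rw [hJI, hJI]
      simp only [Matrix.sub_mul, Matrix.mul_assoc]
      abel
    conv_lhs => rw [h1]
    rw [hR, hV₀, hD, hB]
    simp only [Matrix.sub_mul, Matrix.add_mul, Matrix.mul_add, Matrix.mul_assoc]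
    abel
  have hBn : ‖B‖ ≤ 2 * C / s := by
    refine (norm_add_le _ _).trans ?_
    have : C * k / s ^ 2 ≤ C / s := by
      rw [div_le_div_iff₀ (by positivity) hs0]
      nlinarith [mul_le_mul_of_nonneg_left hks (mul_nonneg hC0.le hs0.le)]
    calc _ ≤ C / s + C / s := add_le_add hB₁ (hB₂.trans this)
      _ = _ := by ring
  have hαb : ‖α + b‖ ≤ 2 * C * s := by
    refine (norm_add_le _ _).trans ?_
    nlinarith [mul_le_mul_of_nonneg_left hks hC0.le]
  have hq : k / s ≤ 1 := (div_le_one hs0).2 hks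
  have hq0 : 0 ≤ k / s := by positivity
  have hDn : ‖D‖ ≤ C ^ 4 := by
    refine (norm_mul_le_of_le hGn (norm_mul_le_of_le hB₁ (norm_mul_le_of_le hGn hα))).trans_eq ?_
    field_simp
  have hRn : ‖R‖ ≤ 11 * C ^ 6 * (k / s) := by
    have e1 : ‖I * (B₂ * (I * α))‖ ≤ C ^ 4 * (k / s) := by
      refine (norm_mul_le_of_le hGn (norm_mul_le_of_le hB₂ (norm_mul_le_of_le hGn hα))).trans_eq ?_
      field_simp
    have e2 : ‖I * (B * (I * b))‖ ≤ 2 * C ^ 4 * (k / s) := by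
      refine (norm_mul_le_of_le hGn (norm_mul_le_of_le hBn (norm_mul_le_of_le hGn hb))).trans_eq ?_
      field_simp
    have e3 : ‖J * (B * (I * (B * (I * (α + b)))))‖ ≤ 8 * C ^ 6 * (1 / s) := by
      refine (norm_mul_le_of_le hXn (norm_mul_le_of_le hBn (norm_mul_le_of_le hGn
        (norm_mul_le_of_le hBn (norm_mul_le_of_le hGn hαb))))).trans_eq ?_
      field_simp
      ring
    have e4 : 1 / s ≤ k / s := by gcongr
    have e5 : C ^ 4 ≤ C ^ 6 := pow_le_pow_right₀ hC (by norm_num)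
    calc ‖R‖ ≤ ‖-(I * (B₂ * (I * α))) - I * (B * (I * b))‖ +
          ‖J * (B * (I * (B * (I * (α + b)))))‖ := norm_add_le _ _
      _ ≤ ‖I * (B₂ * (I * α))‖ + ‖I * (B * (I * b))‖ +
          ‖J * (B * (I * (B * (I * (α + b)))))‖ := by
          gcongr
          exact (norm_sub_le _ _).trans_eq (by rw [norm_neg])
      _ ≤ C ^ 4 * (k / s) + 2 * C ^ 4 * (k / s) + 8 * C ^ 6 * (1 / s) :=
          add_le_add (add_le_add e1 e2) e3
      _ ≤ C ^ 6 * (k / s) + 2 * C ^ 6 * (k / s) + 8 * C ^ 6 * (k / s) := by gcongr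
      _ = _ := by ring
  have hbn : ‖I * b‖ ≤ C ^ 2 * k :=
    (norm_mul_le_of_le hGn hb).trans_eq (by ring)
  have hVD : ‖V₀ - D‖ ≤ 3 * C ^ 4 * s := by
    have e1 : ‖V₀‖ ≤ 2 * C ^ 2 * s := (norm_mul_le_of_le hGn hαb).trans_eq (by ring)
    have e2 : C ^ 2 ≤ C ^ 4 := pow_le_pow_right₀ hC (by norm_num)
    calc ‖V₀ - D‖ ≤ ‖V₀‖ + ‖D‖ := norm_sub_le _ _
      _ ≤ 2 * C ^ 4 * s + C ^ 4 * s := by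
          refine add_le_add (e1.trans (by gcongr)) (hDn.trans ?_)
          exact le_mul_of_one_le_right (by positivity) hs
      _ = _ := by ring
  -- everything that is not in the leading term is of order `k`
  have hkey : J * (α + b) * (J * (α + b))ᵀ -
      I * ((α + b) * (α + b)ᵀ - B₁ * I * (α * αᵀ) - (B₁ * I * (α * αᵀ))ᵀ) * Iᵀ =
      -(D * (I * b)ᵀ) - (I * b) * Dᵀ + D * Dᵀ + R * (V₀ - D)ᵀ + (V₀ - D) * Rᵀ + R * Rᵀ := by
    rw [hV]
    have e1 : I * ((α + b) * (α + b)ᵀ - B₁ * I * (α * αᵀ) - (B₁ * I * (α * αᵀ))ᵀ) * Iᵀ =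
        V₀ * V₀ᵀ - D * (I * α)ᵀ - (I * α) * Dᵀ := by
      simp only [hV₀, hD, Matrix.mul_sub, Matrix.sub_mul, transpose_mul, transpose_transpose,
        Matrix.mul_assoc]
    rw [e1]
    have e2 : V₀ = I * α + I * b := by rw [hV₀, Matrix.mul_add]
    rw [e2]
    simp only [transpose_add, transpose_sub, Matrix.mul_add, Matrix.add_mul, Matrix.mul_sub,
      Matrix.sub_mul]
    abel
  rw [hkey]
  have t1 : ‖D * (I * b)ᵀ‖ ≤ C ^ 12 * k := by
    refine (norm_mul_le_of_le hDn ((frobenius_norm_transpose _).trans_le hbn)).trans ?_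
    calc C ^ 4 * (C ^ 2 * k) = C ^ 6 * k := by ring
      _ ≤ C ^ 12 * k := by gcongr; norm_num
  have t2 : ‖(I * b) * Dᵀ‖ ≤ C ^ 12 * k := by
    rw [← frobenius_norm_transpose, transpose_mul, transpose_transpose]; exact t1
  have t3 : ‖D * Dᵀ‖ ≤ C ^ 12 * k := by
    refine (norm_mul_le_of_le hDn ((frobenius_norm_transpose _).trans_le hDn)).trans ?_
    calc C ^ 4 * C ^ 4 = C ^ 8 * 1 := by ring
      _ ≤ C ^ 12 * k := by gcongr; norm_num
  have t4 : ‖R * (V₀ - D)ᵀ‖ ≤ 33 * C ^ 12 * k := by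
    refine (norm_mul_le_of_le hRn ((frobenius_norm_transpose _).trans_le hVD)).trans ?_
    calc 11 * C ^ 6 * (k / s) * (3 * C ^ 4 * s) = 33 * C ^ 10 * k := by field_simp; ring
      _ ≤ 33 * C ^ 12 * k := by gcongr; norm_num
  have t5 : ‖(V₀ - D) * Rᵀ‖ ≤ 33 * C ^ 12 * k := by
    rw [← frobenius_norm_transpose, transpose_mul, transpose_transpose]; exact t4
  have t6 : ‖R * Rᵀ‖ ≤ 121 * C ^ 12 * k := by
    refine (norm_mul_le_of_le hRn ((frobenius_norm_transpose _).trans_le hRn)).trans ?_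
    calc 11 * C ^ 6 * (k / s) * (11 * C ^ 6 * (k / s)) = 121 * C ^ 12 * ((k / s) * (k / s)) := by
          ring
      _ ≤ 121 * C ^ 12 * k := by
          gcongr
          nlinarith
  calc _ ≤ ‖D * (I * b)ᵀ‖ + ‖(I * b) * Dᵀ‖ + ‖D * Dᵀ‖ + ‖R * (V₀ - D)ᵀ‖ + ‖(V₀ - D) * Rᵀ‖ +
        ‖R * Rᵀ‖ := by
        refine (norm_add_le _ _).trans (add_le_add ?_ le_rfl)
        refine (norm_add_le _ _).trans (add_le_add ?_ le_rfl)
        refine (norm_add_le _ _).trans (add_le_add ?_ le_rfl)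
        refine (norm_add_le _ _).trans (add_le_add ?_ le_rfl)
        exact (norm_sub_le _ _).trans_eq (by rw [norm_neg])
    _ ≤ C ^ 12 * k + C ^ 12 * k + C ^ 12 * k + 33 * C ^ 12 * k + 33 * C ^ 12 * k +
        121 * C ^ 12 * k := by gcongr
    _ = _ := by ring

end Expansion

section LeadingTerm

attribute [local instance] Matrix.frobeniusNormedAddCommGroup Matrix.frobeniusNormedSpace

variable {m n : Type*} [Fintype m] [Fintype n] [DecidableEq m] [DecidableEq n]

/-- The part of `P f` orthogonal to the columns of `f`. -/
noncomputable def resid (F : Matrix m n ℝ) (P : Matrix m m ℝ) : Matrix m n ℝ :=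
  (1 - proj F) * (P * F)

variable {F : Matrix m n ℝ} {P : Matrix m m ℝ}

/-- The matrix in the second term of `S(k)` is the Gram matrix of the residual of `P f`. -/
lemma transpose_resid_mul_resid (hP : Pᵀ = P) (hF : IsUnit (Fᵀ * F).det) :
    (resid F P)ᵀ * resid F P = Fᵀ * (1 - P) * (1 - proj F) * (1 - P) * F := by
  have h1 : resid F P = -((1 - proj F) * ((1 - P) * F)) := by
    rw [resid, Matrix.sub_mul 1 P F, Matrix.mul_sub, Matrix.one_mul, Matrix.sub_mul _ _ F,
      Matrix.one_mul, proj_mul_self hF]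
    simp
  rw [h1, transpose_neg, Matrix.neg_mul, Matrix.mul_neg, neg_neg,
    (isOrthProj_proj F).one_sub.transpose_mul_mul, transpose_mul, transpose_sub, transpose_one, hP]
  simp only [Matrix.mul_assoc]

lemma mul_eq_add_resid : P * F = proj F * (P * F) + resid F P := by
  rw [resid, Matrix.sub_mul, Matrix.one_mul]; abel

/-- With the exact inverse of `f'Pf`, the first order term `σ_ε² H⁻¹` appears exactly. -/
lemma sandwich_eq {ν : ℝ} (hP : Pᵀ = P) (hν : ν ≠ 0)
    (hF : IsUnit (ν • (Fᵀ * F)).det) (hG : IsUnit (ν • (Fᵀ * (P * F))).det) :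
    ν • ((ν • (Fᵀ * (P * F)))⁻¹ * ((P * F)ᵀ * (P * F)) * (ν • (Fᵀ * (P * F)))⁻¹) =
      (ν • (Fᵀ * F))⁻¹ + ν • ((ν • (Fᵀ * (P * F)))⁻¹ * ((resid F P)ᵀ * resid F P) *
        (ν • (Fᵀ * (P * F)))⁻¹) := by
  set G := ν • (Fᵀ * (P * F)) with hGdef
  have hFF : IsUnit (Fᵀ * F).det := by
    rw [det_smul, IsUnit.mul_iff] at hF; exact hF.2
  have h1 : (P * F)ᵀ * (P * F) = (P * F)ᵀ * proj F * (P * F) + (resid F P)ᵀ * resid F P := by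
    rw [resid, (isOrthProj_proj F).one_sub.transpose_mul_mul, Matrix.mul_sub, Matrix.sub_mul,
      Matrix.mul_one]
    abel
  have h2 : ν • ((P * F)ᵀ * proj F * (P * F)) = G * (ν • (Fᵀ * F))⁻¹ * G := by
    have e1 : (ν • (Fᵀ * F))⁻¹ = ν⁻¹ • (Fᵀ * F)⁻¹ := by
      have := invertibleOfNonzero hν
      rw [inv_smul _ _ hFF, invOf_eq_inv]
    have e2 : (P * F)ᵀ * F = Fᵀ * (P * F) := by
      rw [transpose_mul, hP, Matrix.mul_assoc]
    have e3 : (P * F)ᵀ * proj F * (P * F) =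
        ((P * F)ᵀ * F) * (Fᵀ * F)⁻¹ * (Fᵀ * (P * F)) := by
      simp only [proj, Matrix.mul_assoc]
    rw [e3, e2, e1, hGdef]
    simp only [Matrix.smul_mul, Matrix.mul_smul, smul_smul]
    rw [inv_mul_cancel₀ hν, mul_one]
  rw [h1, Matrix.mul_add, Matrix.add_mul, smul_add]
  congr 1
  rw [← Matrix.smul_mul, ← Matrix.mul_smul, h2, ← Matrix.mul_assoc, ← Matrix.mul_assoc,
    nonsing_inv_mul _ hG, Matrix.one_mul, Matrix.mul_assoc, mul_nonsing_inv _ hG, Matrix.mul_one]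

end LeadingTerm

/-! ### Bounds for the conditional mean -/

section MeanBounds

attribute [local instance] Matrix.frobeniusNormedAddCommGroup Matrix.frobeniusNormedSpace

variable {m n : Type*} [Fintype m] [Fintype n]

lemma abs_trace_le (A : Matrix n n ℝ) : |A.trace| ≤ Fintype.card n * ‖A‖ := by
  calc |A.trace| ≤ ∑ a, |A a a| := Finset.abs_sum_le_sum_abs _ _
    _ ≤ ∑ _a : n, ‖A‖ := Finset.sum_le_sum fun a _ => abs_entry_le_norm A a a
    _ = _ := by simp

lemma norm_vecMulVec_self (v : n → ℝ) : ‖vecMulVec v v‖ = ∑ a, v a ^ 2 := by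
  have h : ‖vecMulVec v v‖ ^ 2 = (∑ a, v a ^ 2) ^ 2 := by
    rw [norm_sq_eq_sum, pow_two (∑ a, v a ^ 2), Finset.sum_mul_sum]
    exact Finset.sum_congr rfl fun a _ => Finset.sum_congr rfl fun b _ => by
      rw [vecMulVec_apply]; ring
  exact (pow_left_inj₀ (norm_nonneg _) (Finset.sum_nonneg fun _ _ => sq_nonneg _)
    two_ne_zero).1 h

/-- `S(k)` is not of smaller order than the trace of its middle factor. -/
lemma trace_le_card_mul_norm_Smat [DecidableEq n] {N k : ℕ} {σue : n → ℝ} {σε2 C : ℝ}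
    {F : Matrix (Fin N) n ℝ} {P : Matrix (Fin N) (Fin N) ℝ} (hP : Pᵀ = P)
    (hH : IsUnit (Hmat N F).det) (hHC : ‖Hmat N F‖ ≤ C) :
    (k : ℝ) ^ 2 / N * ∑ a, σue a ^ 2 + σε2 / N * ‖resid F P‖ ^ 2 ≤
      Fintype.card n * C ^ 2 * ‖Smat N k σue σε2 F P‖ := by
  have hF : IsUnit (Fᵀ * F).det := by
    rw [Hmat, det_smul, IsUnit.mul_iff] at hH; exact hH.2
  set M := ((k : ℝ) ^ 2 / N) • vecMulVec σue σue + (σε2 / N) • ((resid F P)ᵀ * resid F P) with hM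
  have hS : Smat N k σue σε2 F P = (Hmat N F)⁻¹ * M * (Hmat N F)⁻¹ := by
    rw [Smat, hM, transpose_resid_mul_resid hP hF]
  have h1 : M = Hmat N F * (Smat N k σue σε2 F P) * Hmat N F := by
    rw [hS]
    simp only [Matrix.mul_assoc]
    rw [nonsing_inv_mul _ hH, Matrix.mul_one, ← Matrix.mul_assoc, mul_nonsing_inv _ hH,
      Matrix.one_mul]
  have h2 : M.trace = (k : ℝ) ^ 2 / N * ∑ a, σue a ^ 2 + σε2 / N * ‖resid F P‖ ^ 2 := by
    rw [hM, trace_add, trace_smul, trace_smul, ← norm_sq_eq_trace, smul_eq_mul, smul_eq_mul]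
    simp [trace, vecMulVec_apply, pow_two]
  rw [← h2]
  have h3 : ‖M‖ ≤ C * ‖Smat N k σue σε2 F P‖ * C := by
    conv_lhs => rw [h1]
    exact norm_mul_le_of_le (norm_mul_le_of_le hHC le_rfl) hHC
  calc M.trace ≤ |M.trace| := le_abs_self _
    _ ≤ Fintype.card n * ‖M‖ := abs_trace_le M
    _ ≤ Fintype.card n * (C * ‖Smat N k σue σε2 F P‖ * C) := by gcongr
    _ = _ := by ring

/-- The middle factor of `S(k)` is of order at most `(k² + ‖W‖²) / N`. -/
lemma norm_middle_le {N k : ℝ} (hN : 0 ≤ N) {σue : n → ℝ} {σε2 : ℝ} (hσ : 0 ≤ σε2)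
    (W : Matrix m n ℝ) :
    ‖(k ^ 2 / N) • vecMulVec σue σue + (σε2 / N) • (Wᵀ * W)‖ ≤
      (∑ a, σue a ^ 2 + σε2) * ((k ^ 2 + ‖W‖ ^ 2) / N) := by
  have h0 : 0 ≤ ∑ a, σue a ^ 2 := Finset.sum_nonneg fun _ _ => sq_nonneg _
  have h1 : 0 ≤ k ^ 2 / N := by positivity
  have h2 : 0 ≤ ‖W‖ ^ 2 / N := by positivity
  calc _ ≤ ‖(k ^ 2 / N) • vecMulVec σue σue‖ + ‖(σε2 / N) • (Wᵀ * W)‖ := norm_add_le _ _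
    _ ≤ k ^ 2 / N * ∑ a, σue a ^ 2 + σε2 / N * ‖W‖ ^ 2 := by
        rw [norm_smul, norm_smul, norm_vecMulVec_self, Real.norm_of_nonneg h1,
          Real.norm_of_nonneg (by positivity : 0 ≤ σε2 / N)]
        gcongr
        exact norm_transpose_mul_self_le W
    _ ≤ _ := by
        have e : (∑ a, σue a ^ 2 + σε2) * ((k ^ 2 + ‖W‖ ^ 2) / N) =
          k ^ 2 / N * ∑ a, σue a ^ 2 + σε2 / N * ‖W‖ ^ 2 +
            (k ^ 2 / N * σε2 + ‖W‖ ^ 2 / N * ∑ a, σue a ^ 2) := by ring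
        rw [e]
        have := mul_nonneg h1 hσ
        have := mul_nonneg h2 h0
        linarith

/-- The difference between the conditional mean of the leading term and its approximation. -/
lemma norm_sandwich_sub_le [DecidableEq n] {G H M E : Matrix n n ℝ} {C δ ρ e ν : ℝ}
    (hG : IsUnit G.det) (hH : IsUnit H.det) (hGC : ‖G⁻¹‖ ≤ C) (hHC : ‖H⁻¹‖ ≤ C)
    (hδ : ‖G - H‖ ≤ δ) (hM : ‖M‖ ≤ ρ) (hE : ‖E‖ ≤ e) (hν : 0 ≤ ν) :
    ‖G⁻¹ * M * G⁻¹ - H⁻¹ * M * H⁻¹ + ν • (G⁻¹ * E * G⁻¹)‖ ≤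
      2 * C ^ 3 * δ * ρ + ν * (C ^ 2 * e) := by
  have hd : ‖G⁻¹ - H⁻¹‖ ≤ C * δ * C := by
    rw [inv_sub_inv_eq hG hH]
    refine norm_mul_le_of_le (norm_mul_le_of_le hGC ?_) hHC
    rw [norm_sub_rev]; exact hδ
  have h1 : G⁻¹ * M * G⁻¹ - H⁻¹ * M * H⁻¹ =
      (G⁻¹ - H⁻¹) * M * G⁻¹ + H⁻¹ * M * (G⁻¹ - H⁻¹) := by
    simp only [Matrix.sub_mul, Matrix.mul_sub]; abel
  rw [h1]
  calc _ ≤ ‖(G⁻¹ - H⁻¹) * M * G⁻¹‖ + ‖H⁻¹ * M * (G⁻¹ - H⁻¹)‖ + ‖ν • (G⁻¹ * E * G⁻¹)‖ :=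
        (norm_add_le _ _).trans (add_le_add (norm_add_le _ _) le_rfl)
    _ ≤ C * δ * C * ρ * C + C * ρ * (C * δ * C) + ν * (C * e * C) := by
        rw [norm_smul, Real.norm_of_nonneg hν]
        refine add_le_add (add_le_add ?_ ?_) (mul_le_mul_of_nonneg_left ?_ hν)
        · exact norm_mul_le_of_le (norm_mul_le_of_le hd hM) hGC
        · exact norm_mul_le_of_le (norm_mul_le_of_le hHC hM) hd
        · exact norm_mul_le_of_le (norm_mul_le_of_le hGC hE) hGC
    _ = _ := by ring

/-- The diagonal terms in `E[αb' | z]`. The bounded part `L₀` of `Pf` is paired with `tr P`, and the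
residual `W` with `‖P‖` through the Cauchy-Schwarz inequality. -/
lemma abs_sum_mul_diag_le {L₀ W : Matrix m n ℝ} {P : Matrix m m ℝ} {c t : ℝ} (hc : 0 ≤ c)
    (hL₀ : ∀ i a, |L₀ i a| ≤ c) (hP : ∀ i, 0 ≤ P i i) (ht : P.trace ≤ t) (hPn : ‖P‖ ^ 2 ≤ t)
    (a : n) : |∑ i, (L₀ + W) i a * P i i| ≤ c * t + ‖W‖ * √t := by
  have ht0 : 0 ≤ t := (sq_nonneg _).trans hPn
  have h1 : |∑ i, L₀ i a * P i i| ≤ c * t := by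
    calc _ ≤ ∑ i, |L₀ i a * P i i| := Finset.abs_sum_le_sum_abs _ _
      _ ≤ ∑ i, c * P i i := by
          refine Finset.sum_le_sum fun i _ => ?_
          rw [abs_mul, abs_of_nonneg (hP i)]
          exact mul_le_mul_of_nonneg_right (hL₀ i a) (hP i)
      _ = c * P.trace := by rw [← Finset.mul_sum]; rfl
      _ ≤ _ := by gcongr
  have h2 : |∑ i, W i a * P i i| ≤ ‖W‖ * √t := by
    refine abs_le_of_sq_le_sq ?_ (by positivity)
    rw [mul_pow, Real.sq_sqrt ht0]
    refine (Finset.sum_mul_sq_le_sq_mul_sq _ _ _).trans ?_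
    refine mul_le_mul ?_ ((?_ : _ ≤ ‖P‖ ^ 2).trans hPn)
      (Finset.sum_nonneg fun _ _ => sq_nonneg _) (sq_nonneg _)
    · rw [norm_sq_eq_sum]
      exact Finset.sum_le_sum fun i _ => Finset.single_le_sum (f := fun a => W i a ^ 2)
        (fun _ _ => sq_nonneg _) (Finset.mem_univ a)
    · rw [norm_sq_eq_sum]
      exact Finset.sum_le_sum fun i _ => Finset.single_le_sum (f := fun j => P i j ^ 2)
        (fun _ _ => sq_nonneg _) (Finset.mem_univ i)
  simp only [Matrix.add_apply, add_mul, Finset.sum_add_distrib]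
  exact (abs_add_le _ _).trans (add_le_add h1 h2)

/-- The cubic sums in `E[B₁ G⁻¹ αα' | z]`, for `Pf = L₀ + W` with `L₀` bounded; the cubes of
the norms of the rows of `W` sum to at most `‖W‖³`. -/
lemma abs_sum_cubic_le {L₀ W : Matrix m n ℝ} {τ : n → ℝ} {c t : ℝ} (hc : 0 ≤ c)
    (hL₀ : ∀ i a, |L₀ i a| ≤ c) (hτ : ∀ a, |τ a| ≤ t) (ht : 0 ≤ t) (a b p q : n) :
    |∑ i, ((L₀ + W) i a * τ p + (L₀ + W) i p * τ a) * ((L₀ + W) i q * (L₀ + W) i b)| ≤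
      8 * t * (c ^ 3 * Fintype.card m + ‖W‖ ^ 3) := by
  set w : m → ℝ := fun i => √(∑ a, W i a ^ 2) with hw
  have hw0 : ∀ i, 0 ≤ w i := fun i => Real.sqrt_nonneg _
  have hwsq : ∀ i, w i ^ 2 = ∑ a, W i a ^ 2 := fun i =>
    Real.sq_sqrt (Finset.sum_nonneg fun _ _ => sq_nonneg _)
  have hW : ∀ i a, |W i a| ≤ w i := fun i a => by
    refine abs_le_of_sq_le_sq ?_ (hw0 i)
    rw [hwsq]
    exact Finset.single_le_sum (f := fun a => W i a ^ 2) (fun _ _ => sq_nonneg _)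
      (Finset.mem_univ a)
  have hwsum : ∑ i, w i ^ 2 = ‖W‖ ^ 2 := by
    rw [norm_sq_eq_sum]; exact Finset.sum_congr rfl fun i _ => hwsq i
  have hwle : ∀ i, w i ≤ ‖W‖ := fun i => by
    refine abs_le_of_sq_le_sq' ?_ (norm_nonneg _) |>.2
    rw [← hwsum]
    exact Finset.single_le_sum (f := fun i => w i ^ 2) (fun _ _ => sq_nonneg _)
      (Finset.mem_univ i)
  have hL : ∀ i a, |(L₀ + W) i a| ≤ c + w i := fun i a =>
    (abs_add_le _ _).trans (add_le_add (hL₀ i a) (hW i a))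
  calc _ ≤ ∑ i, |((L₀ + W) i a * τ p + (L₀ + W) i p * τ a) * ((L₀ + W) i q * (L₀ + W) i b)| :=
        Finset.abs_sum_le_sum_abs _ _
    _ ≤ ∑ i, 8 * t * (c ^ 3 + ‖W‖ * w i ^ 2) := by
        refine Finset.sum_le_sum fun i _ => ?_
        have hcw : 0 ≤ c + w i := add_nonneg hc (hw0 i)
        rw [abs_mul, abs_mul]
        calc _ ≤ ((c + w i) * t + (c + w i) * t) * ((c + w i) * (c + w i)) := by
              refine mul_le_mul ?_ (mul_le_mul (hL i q) (hL i b) (abs_nonneg _) hcw)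
                (by positivity) (by positivity)
              refine (abs_add_le _ _).trans (add_le_add ?_ ?_)
              · rw [abs_mul]; exact mul_le_mul (hL i a) (hτ p) (abs_nonneg _) hcw
              · rw [abs_mul]; exact mul_le_mul (hL i p) (hτ a) (abs_nonneg _) hcw
          _ = 2 * t * (c + w i) ^ 3 := by ring
          _ ≤ 2 * t * (4 * (c ^ 3 + w i ^ 3)) := by
              refine mul_le_mul_of_nonneg_left ?_ (by positivity)
              nlinarith [mul_nonneg hcw (sq_nonneg (c - w i))]
          _ ≤ 2 * t * (4 * (c ^ 3 + ‖W‖ * w i ^ 2)) := by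
              have : w i ^ 3 ≤ ‖W‖ * w i ^ 2 := by
                rw [pow_succ, mul_comm]
                exact mul_le_mul_of_nonneg_right (hwle i) (sq_nonneg _)
              gcongr
          _ = _ := by ring
    _ = _ := by
        rw [← Finset.mul_sum, Finset.sum_add_distrib, ← Finset.mul_sum, hwsum]
        simp only [Finset.sum_const, Finset.card_univ, nsmul_eq_mul]
        ring

/-- The error terms `k`, `‖W‖√k` and `‖W‖³/N` are of smaller order than `k² + ‖W‖²`. -/
lemma error_order_le {C k w s : ℝ} (hC : 0 ≤ C) (hk : 1 ≤ k) (hks : k ≤ s)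
    (hws : w ≤ C * s) :
    k + w * √k + w ^ 3 / s ^ 2 ≤ (2 + C) * ((k ^ 2 + w ^ 2) / √k) := by
  have hk0 : 0 ≤ k := by linarith
  have hs : 0 < s := by linarith
  have hr : 1 ≤ √k := Real.one_le_sqrt.2 hk
  have hr0 : 0 < √k := by linarith
  have hrr : √k * √k = k := Real.mul_self_sqrt hk0
  have hrk : √k ≤ k := by nlinarith
  have h1 : k ≤ (k ^ 2 + w ^ 2) / √k := by
    rw [le_div_iff₀ hr0]
    nlinarith [sq_nonneg w]
  have h2 : w * √k ≤ (k ^ 2 + w ^ 2) / √k := by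
    rw [le_div_iff₀ hr0, mul_assoc, hrr]
    nlinarith [sq_nonneg (w - k), sq_nonneg w, sq_nonneg k]
  have h3 : w ^ 3 / s ^ 2 ≤ C * ((k ^ 2 + w ^ 2) / √k) := by
    calc w ^ 3 / s ^ 2 = w ^ 2 * w / s ^ 2 := by ring
      _ ≤ w ^ 2 * (C * s) / s ^ 2 := by gcongr
      _ = C * (w ^ 2 / s) := by field_simp
      _ ≤ C * ((k ^ 2 + w ^ 2) / √k) := by
          gcongr
          · nlinarith [sq_nonneg k]
          · exact hrk.trans hks
  linarith

end MeanBounds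

/-! ### Events of high probability -/

section HighProbability

variable {Ω : Type*} {m : MeasurableSpace Ω} [mΩ : MeasurableSpace Ω] {μ : Measure Ω}

/-- The events `E N` hold with probability at least `1 - η` for all large `N`. -/
def EventuallyProb (μ : Measure Ω) (η : ENNReal) (E : ℕ → Ω → Prop) : Prop :=
  ∀ᶠ N in atTop, μ {ω | ¬ E N ω} ≤ η

/-- The events `E N` hold with probability approaching one. -/
def TendstoProbOne (μ : Measure Ω) (E : ℕ → Ω → Prop) : Prop :=
  ∀ η : ENNReal, 0 < η → EventuallyProb μ η E

lemma EventuallyProb.and {η η' : ENNReal} {E E' : ℕ → Ω → Prop} (h : EventuallyProb μ η E)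
    (h' : EventuallyProb μ η' E') : EventuallyProb μ (η + η') fun N ω => E N ω ∧ E' N ω := by
  filter_upwards [h, h'] with N h1 h2
  refine (measure_mono ?_).trans ((measure_union_le _ _).trans (add_le_add h1 h2))
  intro ω hω
  simp only [Set.mem_ofPred_eq, Set.mem_union] at hω ⊢
  tauto

lemma EventuallyProb.mono {η : ENNReal} {E E' : ℕ → Ω → Prop} (h : EventuallyProb μ η E)
    (hE : ∀ᶠ N in atTop, ∀ᵐ ω ∂μ, E N ω → E' N ω) : EventuallyProb μ η E' := by
  filter_upwards [h, hE] with N h1 h2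
  refine (measure_mono_ae ?_).trans h1
  filter_upwards [h2] with ω hω hn he
  exact hn (hω he)

lemma TendstoProbOne.and {E E' : ℕ → Ω → Prop} (h : TendstoProbOne μ E)
    (h' : TendstoProbOne μ E') : TendstoProbOne μ fun N ω => E N ω ∧ E' N ω := fun η hη => by
  have := (h (η / 2) (ENNReal.half_pos hη.ne')).and (h' (η / 2) (ENNReal.half_pos hη.ne'))
  rwa [ENNReal.add_halves] at this

lemma TendstoProbOne.mono {E E' : ℕ → Ω → Prop} (h : TendstoProbOne μ E)
    (hE : ∀ᶠ N in atTop, ∀ᵐ ω ∂μ, E N ω → E' N ω) : TendstoProbOne μ E' :=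
  fun η hη => (h η hη).mono hE

lemma tendstoProbOne_iff {E : ℕ → Ω → Prop} :
    TendstoProbOne μ E ↔ Tendsto (fun N => μ {ω | ¬ E N ω}) atTop (𝓝 0) :=
  ENNReal.tendsto_nhds_zero.symm

lemma TendstoProbOne.forall_fintype {ι : Type*} [Fintype ι] {E : ι → ℕ → Ω → Prop}
    (h : ∀ i, TendstoProbOne μ (E i)) : TendstoProbOne μ fun N ω => ∀ i, E i N ω := by
  rw [tendstoProbOne_iff]
  have h1 : Tendsto (fun N => ∑ i, μ {ω | ¬ E i N ω}) atTop (𝓝 (∑ _i : ι, 0)) :=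
    tendsto_finsetSum _ fun i _ => tendstoProbOne_iff.1 (h i)
  rw [Finset.sum_const_zero] at h1
  refine tendsto_of_tendsto_of_tendsto_of_le_of_le tendsto_const_nhds h1 (fun _ => zero_le)
    fun N => ?_
  refine (measure_mono ?_).trans (measure_iUnion_fintype_le μ _)
  intro ω hω
  simpa using hω

/-- Markov's inequality for a nonnegative random variable with bounded conditional mean. -/
lemma HasCondExp.measure_lt_le [IsProbabilityMeasure μ] (hm : m ≤ mΩ)
    {X C : Ω → ℝ} {K t : ℝ} (h : HasCondExp μ m X C) (hX : ∀ ω, 0 ≤ X ω)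
    (hC : ∀ᵐ ω ∂μ, C ω ≤ K) (ht : 0 < t) : μ {ω | t < X ω} ≤ ENNReal.ofReal (K / t) := by
  obtain ⟨A, hA, hcov, hAX⟩ := h
  have hDm : ∀ n, MeasurableSet[m] (disjointed A n) := fun n => MeasurableSet.disjointed hA n
  have hDm' : ∀ n, MeasurableSet (disjointed A n) := fun n => hm _ (hDm n)
  have hDA : ∀ n, disjointed A n ⊆ A n := fun n => disjointed_subset A n
  have hcovD : μ.restrict (⋃ n, disjointed A n) = μ := by
    refine Measure.restrict_eq_self_of_ae_mem ?_
    rw [iUnion_disjointed]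
    filter_upwards [hcov] with ω hω
    simpa using hω
  have hint : ∀ n, IntegrableOn X (disjointed A n) μ := fun n => (hAX n).1.mono_set (hDA n)
  have hpiece : ∀ n, ∫⁻ ω in disjointed A n, ENNReal.ofReal (X ω) ∂μ ≤
      ENNReal.ofReal K * μ (disjointed A n) := by
    intro n
    have h1 := condExp_indicator_of_subset hm (hA n) (hDm n) (hDA n) (hAX n).1 (hAX n).2
    have h2 : Integrable ((disjointed A n).indicator C) μ := integrable_condExp.congr h1
    rw [← ofReal_integral_eq_lintegral_ofReal (hint n) (ae_of_all _ hX)]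
    have h3 : ∫ ω in disjointed A n, X ω ∂μ = ∫ ω, (disjointed A n).indicator C ω ∂μ := by
      rw [← integral_congr_ae h1, integral_condExp hm, integral_indicator (hDm' n)]
    have h4 : ∫ ω, (disjointed A n).indicator C ω ∂μ ≤ K * μ.real (disjointed A n) := by
      rw [integral_indicator (hDm' n), mul_comm, ← smul_eq_mul, ← setIntegral_const]
      refine setIntegral_mono_ae ((integrable_indicator_iff (hDm' n)).1 h2)
        (integrable_const K).integrableOn hC
    rw [h3]
    refine (ENNReal.ofReal_le_ofReal h4).trans ?_
    rw [ENNReal.ofReal_mul' measureReal_nonneg, measureReal_def,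
      ENNReal.ofReal_toReal (measure_ne_top _ _)]
  have hXm : AEMeasurable X μ := by
    rw [← hcovD, aemeasurable_iUnion_iff]
    exact fun n => (hint n).aemeasurable
  have htot : ∫⁻ ω, ENNReal.ofReal (X ω) ∂μ ≤ ENNReal.ofReal K := by
    conv_lhs => rw [← hcovD]
    rw [lintegral_iUnion hDm' (disjoint_disjointed A)]
    calc _ ≤ ∑' n, ENNReal.ofReal K * μ (disjointed A n) := ENNReal.tsum_le_tsum hpiece
      _ = ENNReal.ofReal K * μ (⋃ n, disjointed A n) := by
          rw [ENNReal.tsum_mul_left, measure_iUnion (disjoint_disjointed A) hDm']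
      _ ≤ ENNReal.ofReal K * 1 := by gcongr; exact prob_le_one
      _ = _ := mul_one _
  calc μ {ω | t < X ω} ≤ μ {ω | ENNReal.ofReal t ≤ ENNReal.ofReal (X ω)} :=
        measure_mono fun ω hω => ENNReal.ofReal_le_ofReal (le_of_lt hω)
    _ ≤ (∫⁻ ω, ENNReal.ofReal (X ω) ∂μ) / ENNReal.ofReal t :=
        meas_ge_le_lintegral_div hXm.ennreal_ofReal (by simpa using ht) ENNReal.ofReal_ne_top
    _ ≤ ENNReal.ofReal K / ENNReal.ofReal t := by gcongr
    _ = _ := (ENNReal.ofReal_div_of_pos ht).symm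

/-- Nonnegative random variables whose conditional means are at most `K * b N` are `O_p(b N)`. -/
lemma exists_eventuallyProb_le [IsProbabilityMeasure μ] {m : ℕ → MeasurableSpace Ω}
    (hm : ∀ N, m N ≤ mΩ) {X : ℕ → Ω → ℝ} {b : ℕ → ℝ} {K : ℝ} (hX : ∀ N ω, 0 ≤ X N ω)
    (hb : ∀ᶠ N in atTop, 0 < b N)
    (h : ∀ᶠ N in atTop, ∃ C : Ω → ℝ, @HasCondExp Ω mΩ μ (m N) (X N) C ∧
      ∀ᵐ ω ∂μ, C ω ≤ K * b N)
    {η : ENNReal} (hη : 0 < η) : ∃ c : ℝ, EventuallyProb μ η fun N ω => X N ω ≤ c * b N := by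
  have h0 : ∀ᶠ c : ℝ in atTop, ENNReal.ofReal (K / c) ≤ η := by
    have h1 : Tendsto (fun c : ℝ => ENNReal.ofReal (K / c)) atTop (𝓝 (ENNReal.ofReal 0)) :=
      ENNReal.tendsto_ofReal (tendsto_const_nhds.div_atTop tendsto_id)
    rw [ENNReal.ofReal_zero] at h1
    exact ENNReal.tendsto_nhds_zero.1 h1 η hη
  obtain ⟨c, hc, hc0⟩ := (h0.and (eventually_gt_atTop 0)).exists
  refine ⟨c, ?_⟩
  filter_upwards [h, hb] with N ⟨C, hXC, hC⟩ hbN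
  simp only [not_le]
  refine (hXC.measure_lt_le (hm N) (hX N) hC (mul_pos hc0 hbN)).trans ?_
  rwa [mul_div_mul_right _ _ hbN.ne']

end HighProbability

section Inverse

attribute [local instance] Matrix.frobeniusNormedAddCommGroup Matrix.frobeniusNormedSpace

variable {n : Type*} [Fintype n] [DecidableEq n]

/-- Matrices near an invertible matrix are invertible, with bounded inverses. -/
lemma exists_isUnit_det_and_norm_inv_le {A₀ : Matrix n n ℝ} (h : IsUnit A₀.det) :
    ∃ δ : ℝ, 0 < δ ∧ ∃ C : ℝ, ∀ A : Matrix n n ℝ, ‖A - A₀‖ ≤ δ → IsUnit A.det ∧ ‖A⁻¹‖ ≤ C := by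
  set c := ‖A₀⁻¹‖ with hc
  have hc0 : 0 ≤ c := norm_nonneg _
  refine ⟨1 / (2 * (c + 1)), by positivity, 2 * c, fun A hA => ?_⟩
  have hsmall : c * ‖A - A₀‖ ≤ 1 / 2 := by
    calc c * ‖A - A₀‖ ≤ c * (1 / (2 * (c + 1))) := by gcongr
      _ ≤ (c + 1) * (1 / (2 * (c + 1))) := by gcongr; linarith
      _ = 1 / 2 := by field_simp
  have hdet : IsUnit A.det := by
    rw [isUnit_iff_ne_zero]
    intro h0
    obtain ⟨v, hv, hAv⟩ := exists_mulVec_eq_zero_iff.2 h0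
    have h1 : A * replicateCol Unit v = 0 := by
      rw [← replicateCol_mulVec, hAv]; ext; simp
    have h2 : replicateCol Unit v = A₀⁻¹ * ((A₀ - A) * replicateCol Unit v) := by
      rw [Matrix.sub_mul, h1, sub_zero, ← Matrix.mul_assoc, nonsing_inv_mul _ h, Matrix.one_mul]
    have h3 : ‖replicateCol Unit v‖ ≤ c * (‖A - A₀‖ * ‖replicateCol Unit v‖) := by
      conv_lhs => rw [h2]
      refine norm_mul_le_of_le le_rfl (norm_mul_le_of_le ?_ le_rfl)
      rw [norm_sub_rev]
    have h4 : ‖replicateCol Unit v‖ = 0 := by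
      have := norm_nonneg (replicateCol Unit v)
      nlinarith
    have h5 : replicateCol Unit v = 0 := norm_eq_zero.1 h4
    apply hv
    ext i
    exact congrFun (congrFun h5 i) ()
  refine ⟨hdet, ?_⟩
  have h1 : A⁻¹ = A₀⁻¹ + A⁻¹ * (A₀ - A) * A₀⁻¹ := by
    rw [← inv_sub_inv_eq hdet h]; abel
  have h2 : ‖A⁻¹‖ ≤ c + ‖A⁻¹‖ * ‖A - A₀‖ * c := by
    conv_lhs => rw [h1]
    refine (norm_add_le _ _).trans (add_le_add le_rfl ?_)
    refine norm_mul_le_of_le (norm_mul_le_of_le le_rfl ?_) le_rfl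
    rw [norm_sub_rev]
  nlinarith [norm_nonneg A⁻¹]

end Inverse

/-! ### The leading term -/

section LeadingTermBounds

attribute [local instance] Matrix.frobeniusNormedAddCommGroup Matrix.frobeniusNormedSpace

/-- The decomposition `G + B₁ + B₂` of the Gram matrix of the regressors `X = F + U`. -/
lemma gram_regressor_eq {n : Type*} {N : ℕ} {F U : Matrix (Fin N) n ℝ}
    {P : Matrix (Fin N) (Fin N) ℝ} (hP : Pᵀ = P) (ν : ℝ) :
    ν • (Fᵀ * (P * F)) + ν • ((P * F)ᵀ * U + Uᵀ * (P * F)) +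
      ν • (Uᵀ * P * U) = ν • ((F + U)ᵀ * P * (F + U)) := by
  rw [← smul_add, ← smul_add]
  congr 1
  simp only [transpose_add, transpose_mul, hP, Matrix.add_mul, Matrix.mul_add, Matrix.mul_assoc]
  abel

variable {n : Type*} [Fintype n] [DecidableEq n]

/-- The leading term of `N (β̂ - β)(β̂ - β)'`: with `G = f'Pf / N`, `α = f'Pε`, `b = u'Pε` and
`B₁ = (f'Pu + u'Pf) / N`, it is `G⁻¹ [(α + b)(α + b)' - B₁ G⁻¹ αα' - αα' G⁻¹ B₁] G⁻¹ / N`.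
The exact inverse of `G` is kept, rather than expanded around `H`. Where `G` is singular, its
Mathlib inverse is zero and so is the leading term; the probability of this event tends to zero. -/
noncomputable def leadingTerm {N : ℕ} (F : Matrix (Fin N) n ℝ) (P : Matrix (Fin N) (Fin N) ℝ)
    (U : Matrix (Fin N) n ℝ) (e : Matrix (Fin N) Unit ℝ) : Matrix n n ℝ :=
  (N : ℝ)⁻¹ • (((N : ℝ)⁻¹ • (Fᵀ * (P * F)))⁻¹ *
    (((P * F)ᵀ * e + Uᵀ * P * e) * ((P * F)ᵀ * e + Uᵀ * P * e)ᵀ -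
      (N : ℝ)⁻¹ • (((P * F)ᵀ * U + Uᵀ * (P * F)) * ((N : ℝ)⁻¹ • (Fᵀ * (P * F)))⁻¹ *
        ((P * F)ᵀ * e * ((P * F)ᵀ * e)ᵀ)) -
      ((N : ℝ)⁻¹ • (((P * F)ᵀ * U + Uᵀ * (P * F)) * ((N : ℝ)⁻¹ • (Fᵀ * (P * F)))⁻¹ *
        ((P * F)ᵀ * e * ((P * F)ᵀ * e)ᵀ)))ᵀ) *
    ((N : ℝ)⁻¹ • (Fᵀ * (P * F)))⁻¹)

lemma transpose_gram_inv {N : ℕ} {F : Matrix (Fin N) n ℝ} {P : Matrix (Fin N) (Fin N) ℝ}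
    (hP : Pᵀ = P) (ν : ℝ) : ((ν • (Fᵀ * (P * F)))⁻¹)ᵀ = (ν • (Fᵀ * (P * F)))⁻¹ := by
  rw [transpose_nonsing_inv, transpose_smul, transpose_mul, transpose_mul, transpose_transpose, hP,
    Matrix.mul_assoc]

/-- On the event that all terms have their typical orders, the scaled squared error `v v'` of the
estimator differs from its leading term by at most a multiple of `k / N`. -/
lemma norm_error_sub_leadingTerm_le {N : ℕ} (hN : 0 < N) {F U : Matrix (Fin N) n ℝ}
    {P : Matrix (Fin N) (Fin N) ℝ} {e : Matrix (Fin N) Unit ℝ} (hP : Pᵀ = P) {C k : ℝ} (hC : 1 ≤ C)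
    (hk : 1 ≤ k) (hkN : k ≤ √N) {v : n → ℝ}
    (hv : replicateCol Unit v = ((F + U)ᵀ * P * (F + U))⁻¹ * ((F + U)ᵀ * P * e))
    (hG : IsUnit ((N : ℝ)⁻¹ • (Fᵀ * (P * F))).det) (hGn : ‖((N : ℝ)⁻¹ • (Fᵀ * (P * F)))⁻¹‖ ≤ C)
    (hX : IsUnit ((N : ℝ)⁻¹ • ((F + U)ᵀ * P * (F + U))).det)
    (hXn : ‖((N : ℝ)⁻¹ • ((F + U)ᵀ * P * (F + U)))⁻¹‖ ≤ C)
    (hα : ‖(P * F)ᵀ * e‖ ≤ C * √N) (hb : ‖Uᵀ * P * e‖ ≤ C * k)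
    (hB₁ : ‖(N : ℝ)⁻¹ • ((P * F)ᵀ * U + Uᵀ * (P * F))‖ ≤ C / √N)
    (hB₂ : ‖(N : ℝ)⁻¹ • (Uᵀ * P * U)‖ ≤ C * k / √N ^ 2) :
    ‖(N : ℝ) • vecMulVec v v - leadingTerm F P U e‖ ≤ (N : ℝ)⁻¹ * (190 * C ^ 12 * k) := by
  have hν : (N : ℝ) ≠ 0 := by exact_mod_cast hN.ne'
  rw [← gram_regressor_eq hP] at hX hXn
  have h := norm_outer_expansion_le hC hk hkN hG hX hGn hXn hα hb hB₁ hB₂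
  rw [gram_regressor_eq hP] at h hX
  have hdet : IsUnit ((F + U)ᵀ * P * (F + U)).det := by
    rw [det_smul, IsUnit.mul_iff] at hX; exact hX.2
  have hcol : ((N : ℝ)⁻¹ • ((F + U)ᵀ * P * (F + U)))⁻¹ * ((P * F)ᵀ * e + Uᵀ * P * e) =
      (N : ℝ) • replicateCol Unit v := by
    have := invertibleOfNonzero (inv_ne_zero hν)
    rw [hv, inv_smul _ _ hdet, invOf_eq_inv, inv_inv, Matrix.smul_mul]
    congr 2
    rw [transpose_add, Matrix.add_mul, Matrix.add_mul, transpose_mul, hP]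
  have hvv : (N : ℝ) • vecMulVec v v = (N : ℝ)⁻¹ •
      (((N : ℝ)⁻¹ • ((F + U)ᵀ * P * (F + U)))⁻¹ * ((P * F)ᵀ * e + Uᵀ * P * e) *
        (((N : ℝ)⁻¹ • ((F + U)ᵀ * P * (F + U)))⁻¹ * ((P * F)ᵀ * e + Uᵀ * P * e))ᵀ) := by
    rw [hcol, transpose_smul, transpose_replicateCol, Matrix.smul_mul, Matrix.mul_smul,
      smul_smul, inv_mul_cancel₀ hν, one_smul, vecMulVec_eq Unit]
  rw [hvv, leadingTerm, ← smul_sub, norm_smul, norm_inv, Real.norm_natCast]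
  rw [transpose_gram_inv hP] at h
  simp only [Matrix.smul_mul] at h ⊢
  gcongr

set_option maxHeartbeats 2000000 in
/-- The conditional mean of the leading term differs from `σ_ε² H⁻¹ + S(k)` by a term of smaller
order than `(k² + ‖W‖²) / N`, where `W` is the residual of `Pf`. The matrices `Eab`, `Ebb` and `Ec`
stand for the conditional means of `αb'`, `bb'` and `N B₁ G⁻¹ αα'`. -/
lemma exists_norm_mean_sub_le (σue τ : n → ℝ) {σε2 B C κ : ℝ} (d : ℕ) (hσ : 0 ≤ σε2) (hB : 0 ≤ B)
    (hC : 0 ≤ C) (hκ : 0 ≤ κ) :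
    ∃ c : ℝ, 0 ≤ c ∧ ∀ (N k : ℕ) (δ : ℝ) (F : Matrix (Fin N) n ℝ) (P : Matrix (Fin N) (Fin N) ℝ)
      (Eab Ebb Ec : Matrix n n ℝ), 0 < N → 1 ≤ k → (k : ℝ) ≤ √N → Pᵀ = P → (∀ i, 0 ≤ P i i) →
      P.trace = k + d → ‖P‖ ^ 2 ≤ k + d → ‖P * F‖ ≤ ‖F‖ → (∀ i a, |F i a| ≤ B) →
      IsUnit (Hmat N F).det → IsUnit ((N : ℝ)⁻¹ • (Fᵀ * (P * F))).det → ‖(Hmat N F)⁻¹‖ ≤ C →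
      ‖((N : ℝ)⁻¹ • (Fᵀ * (P * F)))⁻¹‖ ≤ C → ‖(N : ℝ)⁻¹ • (Fᵀ * (P * F)) - Hmat N F‖ ≤ δ →
      (∀ a b, Eab a b = (∑ i, (P * F) i a * P i i) * τ b) →
      (∀ a b, |Ebb a b - σue a * σue b * P.trace ^ 2| ≤ κ * ‖P‖ ^ 2) →
      (∀ a b, Ec a b = ∑ c, ∑ d, ((N : ℝ)⁻¹ • (Fᵀ * (P * F)))⁻¹ c d *
        ∑ i, ((P * F) i a * τ c + (P * F) i c * τ a) * ((P * F) i d * (P * F) i b)) →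
      ‖(N : ℝ)⁻¹ • (((N : ℝ)⁻¹ • (Fᵀ * (P * F)))⁻¹ *
          (σε2 • ((P * F)ᵀ * (P * F)) + Eab + Eabᵀ + Ebb - (N : ℝ)⁻¹ • Ec - ((N : ℝ)⁻¹ • Ec)ᵀ) *
          ((N : ℝ)⁻¹ • (Fᵀ * (P * F)))⁻¹) - σε2 • (Hmat N F)⁻¹ - Smat N k σue σε2 F P‖ ≤
        c * (δ + 1 / √k) * (((k : ℝ) ^ 2 + ‖resid F P‖ ^ 2) / N) := by
  set q : ℝ := (Fintype.card n : ℝ) with hq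
  have hq0 : 0 ≤ q := by positivity
  set t : ℝ := ∑ a, |τ a| with ht
  have ht0 : 0 ≤ t := Finset.sum_nonneg fun _ _ => abs_nonneg _
  have hτ : ∀ a, |τ a| ≤ t := fun a =>
    Finset.single_le_sum (f := fun a => |τ a|) (fun _ _ => abs_nonneg _) (Finset.mem_univ a)
  set ς : ℝ := ∑ a, σue a ^ 2 with hς
  have hς0 : 0 ≤ ς := Finset.sum_nonneg fun _ _ => sq_nonneg _
  have hσσ : ∀ a b, |σue a * σue b| ≤ ς := fun a b => by
    have h := abs_entry_le_norm (vecMulVec σue σue) a b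
    rwa [norm_vecMulVec_self, vecMulVec_apply] at h
  set c₀ : ℝ := q * B * (C * (q * B ^ 2)) with hc₀
  have hc₀0 : 0 ≤ c₀ := by positivity
  set C' : ℝ := √(q * B ^ 2) with hC'
  have hC'0 : 0 ≤ C' := Real.sqrt_nonneg _
  set c₁ : ℝ := t * (1 + d) * (c₀ + 1) with hc₁
  set c₂ : ℝ := κ * (1 + d) + ς * (2 * d + d ^ 2) with hc₂
  set c₃ : ℝ := q * q * C * (8 * t * (c₀ ^ 3 + 1)) with hc₃
  have hc₁0 : 0 ≤ c₁ := by positivity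
  have hc₂0 : 0 ≤ c₂ := by positivity
  have hc₃0 : 0 ≤ c₃ := by positivity
  set cE : ℝ := q * q * (2 * c₁ + c₂ + 2 * c₃) with hcE
  have hcE0 : 0 ≤ cE := by positivity
  refine ⟨2 * C ^ 3 * (ς + σε2) + C ^ 2 * cE * (2 + C'), by positivity, ?_⟩
  intro N k δ F P Eab Ebb Ec hN hk hkN hP hdiag htr hPn hPF hF hH hG hHC hGC hδ hEab hEbb hEc
  have hN0 : (0 : ℝ) < N := by exact_mod_cast hN
  have hν : (N : ℝ)⁻¹ ≠ 0 := inv_ne_zero hN0.ne'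
  have hk1 : (1 : ℝ) ≤ k := by exact_mod_cast hk
  have hk0 : (0 : ℝ) < k := by linarith
  set W := resid F P with hW
  set L₀ := proj F * (P * F) with hL₀
  set G := (N : ℝ)⁻¹ • (Fᵀ * (P * F)) with hGdef
  have hFF : IsUnit (Fᵀ * F).det := by
    rw [Hmat, det_smul, IsUnit.mul_iff] at hH; exact hH.2
  have hL : P * F = L₀ + W := mul_eq_add_resid
  have hFn : ‖F‖ ^ 2 ≤ N * (q * B ^ 2) := by
    rw [norm_sq_eq_sum]
    calc ∑ i, ∑ j, F i j ^ 2 ≤ ∑ _i : Fin N, ∑ _j : n, B ^ 2 := by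
          refine Finset.sum_le_sum fun i _ => Finset.sum_le_sum fun j _ => ?_
          rw [← sq_abs]
          exact pow_le_pow_left₀ (abs_nonneg _) (hF i j) 2
      _ = _ := by simp [hq]
  have hGn : ‖G‖ ≤ q * B ^ 2 := by
    rw [hGdef, norm_smul, norm_inv, Real.norm_natCast, inv_mul_le_iff₀ hN0]
    refine (norm_mul_le_of_le (frobenius_norm_transpose _).le hPF).trans ?_
    rw [← pow_two]; exact hFn
  have hWn : ‖W‖ ≤ C' * √N := by
    have h1 : ‖W‖ ≤ ‖F‖ := ((isOrthProj_proj F).one_sub.norm_mul_le _).trans hPF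
    refine h1.trans ?_
    rw [hC', ← Real.sqrt_mul (by positivity)]
    exact Real.le_sqrt_of_sq_le (by rw [mul_comm]; exact hFn)
  have hL₀e : L₀ = F * ((Hmat N F)⁻¹ * G) := by
    have e1 : (Hmat N F)⁻¹ = (N : ℝ) • (Fᵀ * F)⁻¹ := by
      have := invertibleOfNonzero hν
      rw [Hmat, inv_smul _ _ hFF, invOf_eq_inv, inv_inv]
    rw [e1, hGdef, Matrix.smul_mul, Matrix.mul_smul (Fᵀ * F)⁻¹, smul_smul, mul_inv_cancel₀ hN0.ne',
      one_smul, hL₀, proj]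
    simp only [Matrix.mul_assoc]
  -- the fitted part of `PF` is bounded entrywise, like `F`
  have hL₀n : ∀ i a, |L₀ i a| ≤ c₀ := by
    intro i a
    rw [hL₀e, mul_apply]
    calc _ ≤ ∑ b, |F i b * ((Hmat N F)⁻¹ * G) b a| := Finset.abs_sum_le_sum_abs _ _
      _ ≤ ∑ _b : n, B * (C * (q * B ^ 2)) := by
          refine Finset.sum_le_sum fun b _ => ?_
          rw [abs_mul]
          refine mul_le_mul (hF i b) ?_ (abs_nonneg _) hB
          exact (abs_entry_le_norm _ b a).trans (norm_mul_le_of_le hHC hGn)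
      _ = _ := by simp [hc₀, hq]; ring
  -- the order of all error terms
  set X : ℝ := k + ‖W‖ * √k + ‖W‖ ^ 3 / √N ^ 2 with hX
  have hsq : √(N : ℝ) ^ 2 = N := Real.sq_sqrt hN0.le
  have hX1 : (k : ℝ) ≤ X := by
    have : 0 ≤ ‖W‖ * √k := by positivity
    have : 0 ≤ ‖W‖ ^ 3 / √N ^ 2 := by positivity
    linarith
  have hX0 : 0 ≤ X := hk0.le.trans hX1
  have hX2 : ‖W‖ * √k ≤ X := by
    have : 0 ≤ ‖W‖ ^ 3 / √N ^ 2 := by positivity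
    linarith
  have hX3 : ‖W‖ ^ 3 / N ≤ X := by
    have : 0 ≤ ‖W‖ * √k := by positivity
    rw [← hsq]
    linarith
  have hkd : (k : ℝ) + d ≤ (1 + d) * k := by
    rw [add_mul, one_mul]
    exact add_le_add le_rfl (le_mul_of_one_le_right (Nat.cast_nonneg d) hk1)
  have hskd : √((k : ℝ) + d) ≤ (1 + d) * √k := by
    have hd1 : (1 : ℝ) ≤ 1 + d := by linarith [(Nat.cast_nonneg d : (0 : ℝ) ≤ d)]
    rw [Real.sqrt_le_left (by positivity), mul_pow, Real.sq_sqrt hk0.le]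
    refine hkd.trans ?_
    gcongr
    exact le_self_pow₀ hd1 two_ne_zero
  have hEabn : ‖Eab‖ ≤ q * q * (c₁ * X) := by
    refine norm_le_of_abs_le _ fun a b => ?_
    have h1 := abs_sum_mul_diag_le (L₀ := L₀) (W := W) hc₀0 hL₀n hdiag htr.le hPn a
    rw [← hL] at h1
    rw [hEab, abs_mul]
    calc _ ≤ (c₀ * (k + d) + ‖W‖ * √((k : ℝ) + d)) * t :=
          mul_le_mul h1 (hτ b) (abs_nonneg _) (by positivity)
      _ ≤ (c₀ * ((1 + d) * X) + (1 + d) * X) * t := by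
          refine mul_le_mul_of_nonneg_right (add_le_add ?_ ?_) ht0
          · refine mul_le_mul_of_nonneg_left (hkd.trans ?_) hc₀0
            gcongr
          · calc ‖W‖ * √((k : ℝ) + d) ≤ ‖W‖ * ((1 + d) * √k) := by gcongr
              _ = (1 + d) * (‖W‖ * √k) := by ring
              _ ≤ _ := by gcongr
      _ = _ := by rw [hc₁]; ring
  have hEbbn : ‖Ebb - ((k : ℝ) ^ 2) • vecMulVec σue σue‖ ≤ q * q * (c₂ * X) := by
    refine norm_le_of_abs_le _ fun a b => ?_
    have h1 : (Ebb - ((k : ℝ) ^ 2) • vecMulVec σue σue) a b =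
        (Ebb a b - σue a * σue b * P.trace ^ 2) + σue a * σue b * (2 * d * k + d ^ 2) := by
      rw [Matrix.sub_apply, Matrix.smul_apply, vecMulVec_apply, htr, smul_eq_mul]; ring
    rw [h1]
    calc _ ≤ κ * ‖P‖ ^ 2 + ς * (2 * d * k + d ^ 2) := by
          refine (abs_add_le _ _).trans (add_le_add (hEbb a b) ?_)
          rw [abs_mul, abs_of_nonneg (by positivity : (0 : ℝ) ≤ 2 * d * k + d ^ 2)]
          exact mul_le_mul_of_nonneg_right (hσσ a b) (by positivity)
      _ ≤ κ * ((1 + d) * X) + ς * ((2 * d + d ^ 2) * X) := by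
          refine add_le_add (mul_le_mul_of_nonneg_left (hPn.trans (hkd.trans ?_)) hκ)
            (mul_le_mul_of_nonneg_left ?_ hς0)
          · gcongr
          · calc (2 * d * k + d ^ 2 : ℝ) ≤ 2 * d * k + d ^ 2 * k := by
                  gcongr; exact le_mul_of_one_le_right (by positivity) hk1
              _ = (2 * d + d ^ 2) * k := by ring
              _ ≤ _ := by gcongr
      _ = _ := by rw [hc₂]; ring
  have hEcn : ‖(N : ℝ)⁻¹ • Ec‖ ≤ q * q * (c₃ * X) := by
    refine norm_le_of_abs_le _ fun a b => ?_
    rw [Matrix.smul_apply, smul_eq_mul, abs_mul, abs_of_pos (inv_pos.2 hN0), hEc,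
      inv_mul_le_iff₀ hN0]
    have h1 : ∀ c d, |G⁻¹ c d * ∑ i, ((P * F) i a * τ c + (P * F) i c * τ a) *
        ((P * F) i d * (P * F) i b)| ≤ C * (8 * t * (c₀ ^ 3 * N + ‖W‖ ^ 3)) := by
      intro c d
      have h2 := abs_sum_cubic_le (L₀ := L₀) (W := W) hc₀0 hL₀n hτ ht0 a b c d
      rw [← hL, Fintype.card_fin] at h2
      rw [abs_mul]
      exact mul_le_mul ((abs_entry_le_norm _ c d).trans hGC) h2 (abs_nonneg _) hC
    calc _ ≤ ∑ c, ∑ d, |G⁻¹ c d * ∑ i, ((P * F) i a * τ c + (P * F) i c * τ a) *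
        ((P * F) i d * (P * F) i b)| := by
          refine (Finset.abs_sum_le_sum_abs _ _).trans (Finset.sum_le_sum fun c _ => ?_)
          exact Finset.abs_sum_le_sum_abs _ _
      _ ≤ ∑ _c : n, ∑ _d : n, C * (8 * t * (c₀ ^ 3 * N + ‖W‖ ^ 3)) :=
          Finset.sum_le_sum fun c _ => Finset.sum_le_sum fun d _ => h1 c d
      _ = q * q * (C * (8 * t * (c₀ ^ 3 * N + ‖W‖ ^ 3))) := by
          simp only [Finset.sum_const, Finset.card_univ, nsmul_eq_mul, hq]; ring
      _ ≤ q * q * (C * (8 * t * (c₀ ^ 3 * (N * X) + N * X))) := by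
          gcongr
          · exact le_mul_of_one_le_right hN0.le (hk1.trans hX1)
          · rwa [div_le_iff₀ hN0, mul_comm] at hX3
      _ = _ := by rw [hc₃]; ring
  -- `M` is the middle factor of `S(k)`, and `E` collects the error terms
  set M := ((k : ℝ) ^ 2 / N) • vecMulVec σue σue + (σε2 / N) • (Wᵀ * W) with hM
  set E := Eab + Eabᵀ + (Ebb - ((k : ℝ) ^ 2) • vecMulVec σue σue) - (N : ℝ)⁻¹ • Ec -
    ((N : ℝ)⁻¹ • Ec)ᵀ with hE
  have hEn : ‖E‖ ≤ cE * X := by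
    calc ‖E‖ ≤ ‖Eab‖ + ‖Eab‖ + ‖Ebb - ((k : ℝ) ^ 2) • vecMulVec σue σue‖ +
          ‖(N : ℝ)⁻¹ • Ec‖ + ‖(N : ℝ)⁻¹ • Ec‖ := by
          refine (norm_sub_le _ _).trans (add_le_add ?_ (frobenius_norm_transpose _).le)
          refine (norm_sub_le _ _).trans (add_le_add ?_ le_rfl)
          refine (norm_add_le _ _).trans (add_le_add ?_ le_rfl)
          exact (norm_add_le _ _).trans (add_le_add le_rfl (frobenius_norm_transpose _).le)
      _ ≤ q * q * (c₁ * X) + q * q * (c₁ * X) + q * q * (c₂ * X) + q * q * (c₃ * X) +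
          q * q * (c₃ * X) := by gcongr
      _ = _ := by rw [hcE]; ring
  have hS : Smat N k σue σε2 F P = (Hmat N F)⁻¹ * M * (Hmat N F)⁻¹ := by
    rw [Smat, hM, hW, transpose_resid_mul_resid hP hFF]
  have hmain : (N : ℝ)⁻¹ • (G⁻¹ *
      (σε2 • ((P * F)ᵀ * (P * F)) + Eab + Eabᵀ + Ebb - (N : ℝ)⁻¹ • Ec - ((N : ℝ)⁻¹ • Ec)ᵀ) *
      G⁻¹) - σε2 • (Hmat N F)⁻¹ - Smat N k σue σε2 F P =
      G⁻¹ * M * G⁻¹ - (Hmat N F)⁻¹ * M * (Hmat N F)⁻¹ + (N : ℝ)⁻¹ • (G⁻¹ * E * G⁻¹) := by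
    have h1 := sandwich_eq (ν := (N : ℝ)⁻¹) hP hν hH hG
    have e1 : σε2 • ((P * F)ᵀ * (P * F)) + Eab + Eabᵀ + Ebb - (N : ℝ)⁻¹ • Ec -
        ((N : ℝ)⁻¹ • Ec)ᵀ = σε2 • ((P * F)ᵀ * (P * F)) + ((k : ℝ) ^ 2) • vecMulVec σue σue + E := by
      rw [hE]; abel
    have e2 : (N : ℝ)⁻¹ • (G⁻¹ * (σε2 • ((P * F)ᵀ * (P * F))) * G⁻¹) =
        σε2 • (Hmat N F)⁻¹ + G⁻¹ * ((σε2 / N) • (Wᵀ * W)) * G⁻¹ := by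
      rw [Matrix.mul_smul, Matrix.smul_mul, smul_comm, h1, smul_add, Matrix.mul_smul,
        Matrix.smul_mul, smul_smul, div_eq_mul_inv]
      rfl
    have e3 : (N : ℝ)⁻¹ • (G⁻¹ * (((k : ℝ) ^ 2) • vecMulVec σue σue) * G⁻¹) =
        G⁻¹ * (((k : ℝ) ^ 2 / N) • vecMulVec σue σue) * G⁻¹ := by
      rw [Matrix.mul_smul, Matrix.smul_mul, smul_smul, Matrix.mul_smul, Matrix.smul_mul,
        div_eq_inv_mul]
    rw [hS, e1, Matrix.mul_add, Matrix.add_mul, Matrix.mul_add, Matrix.add_mul, smul_add, smul_add,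
      e2, e3, hM, Matrix.mul_add G⁻¹, Matrix.add_mul _ _ G⁻¹]
    abel
  rw [hmain]
  have hMn := norm_middle_le (k := (k : ℝ)) (σue := σue) hN0.le hσ W
  refine (norm_sandwich_sub_le hG hH hGC hHC hδ hMn hEn (inv_nonneg.2 hN0.le)).trans ?_
  have hXle : X ≤ (2 + C') * (((k : ℝ) ^ 2 + ‖W‖ ^ 2) / √k) :=
    error_order_le hC'0 hk1 hkN hWn
  have hδ0 : 0 ≤ δ := (norm_nonneg _).trans hδ
  set R := (k : ℝ) ^ 2 + ‖W‖ ^ 2 with hR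
  have hR0 : 0 ≤ R := by positivity
  calc _ ≤ 2 * C ^ 3 * δ * ((ς + σε2) * (R / N)) +
        (N : ℝ)⁻¹ * (C ^ 2 * (cE * ((2 + C') * (R / √k)))) := by gcongr
    _ = (2 * C ^ 3 * (ς + σε2)) * δ * (R / N) + (C ^ 2 * cE * (2 + C')) * (1 / √k) * (R / N) := by
        ring
    _ ≤ (2 * C ^ 3 * (ς + σε2)) * (δ + 1 / √k) * (R / N) +
        (C ^ 2 * cE * (2 + C')) * (δ + 1 / √k) * (R / N) := by
        have : 0 ≤ 1 / √(k : ℝ) := by positivity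
        gcongr <;> linarith
    _ = _ := by ring

end LeadingTermBounds

/-! ### Moments of the leading term -/

section LeadingTermMoments

variable {Ω 𝒵 n : Type*} [m𝒵 : MeasurableSpace 𝒵] {z : ℕ → Ω → 𝒵} {ε : ℕ → Ω → ℝ}
  {u : ℕ → Ω → n → ℝ} {N : ℕ}

lemma MatIsErrPoly.coeff {p q : Type*} {A : (Fin N → 𝒵) → Matrix p q ℝ} (hA : MatMeasurable A) :
    MatIsErrPoly N z ε u 0 (fun ω => A fun i => z i ω) :=
  fun a b => IsErrPoly.coeff (c := fun w => A w a b) (hA a b)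

lemma matIsErrPoly_errCol : MatIsErrPoly N z ε u 1 (errCol N ε) :=
  fun i _ => IsErrPoly.error i

lemma matIsErrPoly_errMat : MatIsErrPoly N z ε u 1 (errMat N u) :=
  fun i a => IsErrPoly.reducedFormError i a

variable [Fintype n] [DecidableEq n]

lemma matIsErrPoly_leadingTerm {F : (Fin N → 𝒵) → Matrix (Fin N) n ℝ}
    {P : (Fin N → 𝒵) → Matrix (Fin N) (Fin N) ℝ} (hF : MatMeasurable F) (hP : MatMeasurable P) :
    MatIsErrPoly N z ε u 4 (fun ω => leadingTerm (F fun i => z i ω) (P fun i => z i ω)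
      (errMat N u ω) (errCol N ε ω)) := by
  have hL := hP.mul hF
  have hGi : MatIsErrPoly N z ε u 0 fun ω => ((N : ℝ)⁻¹ • ((F fun i => z i ω)ᵀ *
      ((P fun i => z i ω) * F fun i => z i ω)))⁻¹ :=
    MatIsErrPoly.coeff ((hF.transpose.mul hL).smul _).inv
  have hLc : MatIsErrPoly N z ε u 0 fun ω => (P fun i => z i ω) * F fun i => z i ω :=
    MatIsErrPoly.coeff hL
  have hα := hLc.transpose.mul (matIsErrPoly_errCol (N := N) (z := z) (ε := ε) (u := u))
  have hU := matIsErrPoly_errMat (N := N) (z := z) (ε := ε) (u := u)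
  have hb := (hU.transpose.mul (MatIsErrPoly.coeff hP)).mul
    (matIsErrPoly_errCol (N := N) (z := z) (ε := ε) (u := u))
  have hv := (hα.mono (by norm_num : 0 + 1 ≤ 2)).add (hb.mono (by norm_num : 1 + 0 + 1 ≤ 2))
  have hvv := hv.mul hv.transpose
  have hB := ((((hLc.transpose.mul hU).add ((hU.transpose.mul hLc).mono (by norm_num))).mul hGi).mul
    (hα.mul hα.transpose)).smul (N : ℝ)⁻¹
  exact ((hGi.mul ((hvv.sub (hB.mono (by norm_num))).sub
    (hB.transpose.mono (by norm_num)))).mul hGi).smul (N : ℝ)⁻¹ |>.mono (by norm_num)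

variable [mΩ : MeasurableSpace Ω] {μ : Measure Ω} [IsProbabilityMeasure μ] {σε2 : ℝ}
  {σue τ : n → ℝ} {C : ℝ} {F : Ω → Matrix (Fin N) n ℝ} {P : Ω → Matrix (Fin N) (Fin N) ℝ}

namespace ErrorModel

/-- The conditional mean of the leading term, in terms of those of `αb'`, `bb'` and
`N B₁ G⁻¹ αα'`. -/
lemma exists_matHasCondExp_leadingTerm (M : ErrorModel μ z ε u σε2 σue τ C)
    (hF : ∀ i a, Measurable[sampleSigma z N] fun ω => F ω i a)
    (hP : ∀ i j, Measurable[sampleSigma z N] fun ω => P ω i j) (hsymm : ∀ ω, (P ω)ᵀ = P ω) :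
    ∃ Eab Ebb Ec : Ω → Matrix n n ℝ,
      MatHasCondExp μ (sampleSigma z N)
        (fun ω => leadingTerm (F ω) (P ω) (errMat N u ω) (errCol N ε ω))
        (fun ω => (N : ℝ)⁻¹ • (((N : ℝ)⁻¹ • ((F ω)ᵀ * (P ω * F ω)))⁻¹ *
          (σε2 • ((P ω * F ω)ᵀ * (P ω * F ω)) + Eab ω + (Eab ω)ᵀ + Ebb ω - (N : ℝ)⁻¹ • Ec ω -
            ((N : ℝ)⁻¹ • Ec ω)ᵀ) * ((N : ℝ)⁻¹ • ((F ω)ᵀ * (P ω * F ω)))⁻¹)) ∧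
      (∀ ω a b, Eab ω a b = (∑ i, (P ω * F ω) i a * P ω i i) * τ b) ∧
      (∀ᵐ ω ∂μ, ∀ a b, |Ebb ω a b - σue a * σue b * (P ω).trace ^ 2| ≤
        2 * (C + |σue a * σue b| + C * |σε2|) * ∑ i, ∑ j, P ω i j ^ 2) ∧
      (∀ ω a b, Ec ω a b = ∑ c, ∑ d, ((N : ℝ)⁻¹ • ((F ω)ᵀ * (P ω * F ω)))⁻¹ c d *
        ∑ i, ((P ω * F ω) i a * τ c + (P ω * F ω) i c * τ a) *
          ((P ω * F ω) i d * (P ω * F ω) i b)) := by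
  have hm := M.sampleSigma_le N
  have hL := @MatMeasurable.mul Ω _ _ _ (sampleSigma z N) _ P F hP hF
  have hG := @MatMeasurable.inv Ω _ (sampleSigma z N) _ _ _
    (@MatMeasurable.smul Ω _ _ (sampleSigma z N) _
      (@MatMeasurable.mul Ω _ _ _ (sampleSigma z N) _ _ _
        (@MatMeasurable.transpose Ω _ _ (sampleSigma z N) _ hF) hL) (N : ℝ)⁻¹)
  choose R hR hRb using M.hasCondExp_quadratic_quadratic hP hsymm
  have haa : MatHasCondExp μ (sampleSigma z N) _ _ := M.hasCondExp_linear_linear hL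
  have hab : MatHasCondExp μ (sampleSigma z N) _
      (fun ω => Matrix.of fun a b => (∑ i, (P ω * F ω) i a * P ω i i) * τ b) :=
    M.hasCondExp_linear_quadratic hL hP
  have hbb : MatHasCondExp μ (sampleSigma z N) _ (fun ω => Matrix.of fun a b => R a b ω) := hR
  have hc : MatHasCondExp μ (sampleSigma z N) _
      (fun ω => Matrix.of fun a b => ∑ c, ∑ d, ((N : ℝ)⁻¹ • ((F ω)ᵀ * (P ω * F ω)))⁻¹ c d *
        ∑ i, ((P ω * F ω) i a * τ c + (P ω * F ω) i c * τ a) *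
          ((P ω * F ω) i d * (P ω * F ω) i b)) := M.hasCondExp_cubic hL hG
  refine ⟨_, fun ω => Matrix.of fun a b => R a b ω, _, ?_, fun _ _ _ => rfl, ?_,
    fun _ _ _ => rfl⟩
  · have h := (((((((haa.add hm hab).add hm hab.transpose).add hm hbb).sub hm
      (hc.smul hm (N : ℝ)⁻¹)).sub hm (hc.smul hm (N : ℝ)⁻¹).transpose).mul_left hm
      hG).mul_right hm hG).smul hm (N : ℝ)⁻¹
    convert! h using 1
    ext1 ω
    simp only [leadingTerm]
    congr 5
    simp only [transpose_add, Matrix.add_mul, Matrix.mul_add, transpose_mul, transpose_transpose,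
      Matrix.mul_assoc]
    abel
  · rw [ae_all_iff]
    intro a
    rw [ae_all_iff]
    exact hRb a

end ErrorModel

end LeadingTermMoments

section Tightness

attribute [local instance] Matrix.frobeniusNormedAddCommGroup Matrix.frobeniusNormedSpace

variable {Ω 𝒵 n : Type*} [mΩ : MeasurableSpace Ω] [m𝒵 : MeasurableSpace 𝒵] [Fintype n]
  {μ : Measure Ω} {z : ℕ → Ω → 𝒵} {ε : ℕ → Ω → ℝ} {u : ℕ → Ω → n → ℝ}
  {σε2 : ℝ} {σue τ : n → ℝ} {C : ℝ} [IsProbabilityMeasure μ]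

lemma norm_mul_transpose_trace {p : Type*} [Fintype p] (A : Matrix p Unit ℝ) :
    ‖A‖ ^ 2 = ∑ a, (A * Aᵀ) a a := by
  rw [norm_sq_eq_sum]
  simp [mul_apply, pow_two]

variable {N : ℕ} {L : Ω → Matrix (Fin N) n ℝ} {P : Ω → Matrix (Fin N) (Fin N) ℝ}

namespace ErrorModel

lemma exists_hasCondExp_norm_linear_sq (M : ErrorModel μ z ε u σε2 σue τ C)
    (hL : ∀ i a, Measurable[sampleSigma z N] fun ω => L ω i a) :
    ∃ R : Ω → ℝ, HasCondExp μ (sampleSigma z N) (fun ω => ‖(L ω)ᵀ * errCol N ε ω‖ ^ 2) R ∧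
      ∀ᵐ ω ∂μ, R ω ≤ |σε2| * ‖L ω‖ ^ 2 := by
  refine ⟨_, by
    simp only [norm_mul_transpose_trace]
    exact HasCondExp.sum (M.sampleSigma_le N) _ fun a _ => M.hasCondExp_linear_linear hL a a, ?_⟩
  refine ae_of_all _ fun ω => ?_
  rw [norm_sq_eq_trace, trace, Finset.mul_sum]
  refine Finset.sum_le_sum fun a _ => ?_
  rw [Matrix.smul_apply, smul_eq_mul, diag_apply]
  refine mul_le_mul_of_nonneg_right (le_abs_self _) ?_
  rw [mul_apply]
  exact Finset.sum_nonneg fun i _ => mul_self_nonneg _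

lemma exists_hasCondExp_norm_quadratic_sq (M : ErrorModel μ z ε u σε2 σue τ C)
    (hP : ∀ i j, Measurable[sampleSigma z N] fun ω => P ω i j) (hsymm : ∀ ω, (P ω)ᵀ = P ω) :
    ∃ R : Ω → ℝ, HasCondExp μ (sampleSigma z N)
        (fun ω => ‖(errMat N u ω)ᵀ * P ω * errCol N ε ω‖ ^ 2) R ∧
      ∀ᵐ ω ∂μ, R ω ≤ ∑ a, (σue a ^ 2 * (P ω).trace ^ 2 +
        2 * (C + σue a ^ 2 + C * |σε2|) * ‖P ω‖ ^ 2) := by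
  choose R hR hRb using M.hasCondExp_quadratic_quadratic hP hsymm
  refine ⟨fun ω => ∑ a, R a a ω, by
    simp only [norm_mul_transpose_trace]
    exact HasCondExp.sum (M.sampleSigma_le N) _ fun a _ => hR a a, ?_⟩
  filter_upwards [ae_all_iff.2 fun a => hRb a a] with ω hω
  refine Finset.sum_le_sum fun a _ => ?_
  have h := (abs_le.1 (hω a)).2
  rw [norm_sq_eq_sum]
  rw [abs_mul_self, ← pow_two] at h
  linarith

lemma exists_hasCondExp_norm_u_linear_sq (M : ErrorModel μ z ε u σε2 σue τ C)
    (hL : ∀ i a, Measurable[sampleSigma z N] fun ω => L ω i a) :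
    ∃ R : Ω → ℝ, HasCondExp μ (sampleSigma z N) (fun ω => ‖(L ω)ᵀ * errMat N u ω‖ ^ 2) R ∧
      ∀ᵐ ω ∂μ, R ω ≤ Fintype.card n * C * ‖L ω‖ ^ 2 := by
  choose R hR hRb using M.hasCondExp_u_linear_sq hL
  refine ⟨fun ω => ∑ a, ∑ b, R a b ω, by
    simp only [norm_sq_eq_sum]
    exact HasCondExp.sum (M.sampleSigma_le N) _ fun a _ =>
      HasCondExp.sum (M.sampleSigma_le N) _ fun b _ => hR a b, ?_⟩
  filter_upwards [ae_all_iff.2 fun a => ae_all_iff.2 fun b => hRb a b] with ω hω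
  calc _ ≤ ∑ a, ∑ _b : n, C * ∑ i, L ω i a ^ 2 :=
        Finset.sum_le_sum fun a _ => Finset.sum_le_sum fun b _ => hω a b
    _ = _ := by
        rw [norm_sq_eq_sum, Finset.sum_comm (s := Finset.univ (α := Fin N))]
        simp only [Finset.sum_const, Finset.card_univ, nsmul_eq_mul, ← Finset.mul_sum]
        ring

lemma exists_hasCondExp_trace_u_quadratic (M : ErrorModel μ z ε u σε2 σue τ C)
    (hP : ∀ i j, Measurable[sampleSigma z N] fun ω => P ω i j)
    (hdiag : ∀ ω i, 0 ≤ P ω i i) :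
    ∃ R : Ω → ℝ, HasCondExp μ (sampleSigma z N)
        (fun ω => ((errMat N u ω)ᵀ * P ω * errMat N u ω).trace) R ∧
      ∀ᵐ ω ∂μ, R ω ≤ Fintype.card n * C * (P ω).trace := by
  choose R hR hRb using M.hasCondExp_u_quadratic hP hdiag
  refine ⟨fun ω => ∑ a, R a ω, by
    simp only [trace, diag_apply]
    exact HasCondExp.sum (M.sampleSigma_le N) _ fun a _ => hR a, ?_⟩
  filter_upwards [ae_all_iff.2 hRb] with ω hω
  calc _ ≤ ∑ _a : n, C * (P ω).trace := Finset.sum_le_sum fun a _ => hω a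
    _ = _ := by simp; ring

end ErrorModel

end Tightness

/-! ### Regular designs and the orders of the error terms -/

section Regular

attribute [local instance] Matrix.frobeniusNormedAddCommGroup Matrix.frobeniusNormedSpace

lemma isLittleOProb_of_tendstoProbOne {Ω n : Type*} [MeasurableSpace Ω] [Fintype n] {μ : Measure Ω}
    {A B : ℕ → Ω → Matrix n n ℝ}
    (h : ∀ δ : ℝ, 0 < δ → TendstoProbOne μ fun N ω => ‖A N ω‖ ≤ δ * ‖B N ω‖) :
    IsLittleOProb μ A fun N ω => frob (B N ω) := by
  intro δ hδ
  simpa only [not_le, frob_eq_norm] using tendstoProbOne_iff.1 (h δ hδ)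

lemma le_sqrt_mul_of_sq_le {x b c : ℝ} (hb : 0 ≤ b) (h : x ^ 2 ≤ c * b ^ 2) : x ≤ √|c| * b := by
  refine (Real.le_sqrt_of_sq_le h).trans ?_
  rw [Real.sqrt_mul' _ (sq_nonneg b), Real.sqrt_sq hb]
  gcongr
  exact le_abs_self c

/-- The assumptions on the reduced form matrices `F N`, the symmetric weighting matrices `P N` and
the subset sizes `k N` under which the leading term dominates: both are functions of
`z_1, …, z_N`, the `P N` behave as averages of projections of rank `k + d`, the reduced form is
bounded, `F'F / N` converges in probability to the nonsingular matrix `H₀`, and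
`F'(1 - P)F / N` tends to zero in probability. -/
structure IsRegularDesign {Ω 𝒵 n : Type*} [MeasurableSpace Ω] [MeasurableSpace 𝒵] [Fintype n]
    [DecidableEq n] (μ : Measure Ω) (z : ℕ → Ω → 𝒵) (F : (N : ℕ) → Ω → Matrix (Fin N) n ℝ)
    (P : (N : ℕ) → Ω → Matrix (Fin N) (Fin N) ℝ) (k : ℕ → ℕ) (d : ℕ) (B : ℝ)
    (H₀ : Matrix n n ℝ) : Prop where
  meas_F : ∀ N i a, Measurable[sampleSigma z N] fun ω => F N ω i a
  meas_P : ∀ N i j, Measurable[sampleSigma z N] fun ω => P N ω i j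
  symm : ∀ N ω, (P N ω)ᵀ = P N ω
  norm_mul_le : ∀ N ω, ‖P N ω * F N ω‖ ≤ ‖F N ω‖
  norm_sq_le : ∀ N ω, ‖P N ω‖ ^ 2 ≤ k N + d
  trace_le : ∀ N ω, (P N ω).trace ≤ k N + d
  diag_nonneg : ∀ N ω i, 0 ≤ P N ω i i
  norm_quadratic_le : ∀ N ω (U : Matrix (Fin N) n ℝ), ‖Uᵀ * P N ω * U‖ ≤ (Uᵀ * P N ω * U).trace
  bound_nonneg : 0 ≤ B
  bound : ∀ N, ∀ᵐ ω ∂μ, ∀ i a, |F N ω i a| ≤ B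
  trace_eq : TendstoProbOne μ fun N ω => (P N ω).trace = k N + d
  approx : ∀ δ : ℝ, 0 < δ → TendstoProbOne μ fun N ω =>
    ‖(N : ℝ)⁻¹ • ((F N ω)ᵀ * (P N ω * F N ω)) - Hmat N (F N ω)‖ ≤ δ
  limit : ∀ δ : ℝ, 0 < δ → TendstoProbOne μ fun N ω => ‖Hmat N (F N ω) - H₀‖ ≤ δ
  limit_isUnit : IsUnit H₀.det
  size : Tendsto k atTop atTop
  rate : Tendsto (fun N => (k N : ℝ) ^ 2 / (N : ℝ)) atTop (𝓝 0)

namespace IsRegularDesign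

variable {Ω 𝒵 n : Type*} [mΩ : MeasurableSpace Ω] [m𝒵 : MeasurableSpace 𝒵] [Fintype n]
  [DecidableEq n] {μ : Measure Ω} {z : ℕ → Ω → 𝒵} {ε : ℕ → Ω → ℝ}
  {u : ℕ → Ω → n → ℝ} {σε2 : ℝ} {σue τ : n → ℝ} {C B : ℝ}
  {F : (N : ℕ) → Ω → Matrix (Fin N) n ℝ} {P : (N : ℕ) → Ω → Matrix (Fin N) (Fin N) ℝ} {k : ℕ → ℕ}
  {d : ℕ} {H₀ : Matrix n n ℝ}

lemma norm_sq_reducedForm_le (D : IsRegularDesign μ z F P k d B H₀) (N : ℕ) :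
    ∀ᵐ ω ∂μ, ‖F N ω‖ ^ 2 ≤ Fintype.card n * B ^ 2 * N := by
  filter_upwards [D.bound N] with ω hω
  rw [norm_sq_eq_sum]
  calc ∑ i, ∑ j, F N ω i j ^ 2 ≤ ∑ _i : Fin N, ∑ _j : n, B ^ 2 := by
        refine Finset.sum_le_sum fun i _ => Finset.sum_le_sum fun j _ => ?_
        rw [← sq_abs]
        exact pow_le_pow_left₀ (abs_nonneg _) (hω i j) 2
    _ = _ := by simp; ring

lemma norm_sq_mul_reducedForm_le (D : IsRegularDesign μ z F P k d B H₀) (N : ℕ) :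
    ∀ᵐ ω ∂μ, ‖P N ω * F N ω‖ ^ 2 ≤ Fintype.card n * B ^ 2 * N := by
  filter_upwards [D.norm_sq_reducedForm_le N] with ω hω
  exact (pow_le_pow_left₀ (norm_nonneg _) (D.norm_mul_le N ω) 2).trans hω

/-- Eventually `1 ≤ k ≤ √N`. -/
lemma eventually_rate (D : IsRegularDesign μ z F P k d B H₀) :
    ∀ᶠ N in atTop, 0 < N ∧ 1 ≤ k N ∧ (k N : ℝ) ≤ √(N : ℝ) := by
  filter_upwards [eventually_gt_atTop 0, D.size.eventually_ge_atTop 1,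
    D.rate.eventually_le_const zero_lt_one] with N h1 h2 h3
  refine ⟨h1, h2, Real.le_sqrt_of_sq_le ?_⟩
  rwa [div_le_one (by exact_mod_cast h1)] at h3

lemma meas_mul (D : IsRegularDesign μ z F P k d B H₀) (N : ℕ) (i : Fin N) (a : n) :
    Measurable[sampleSigma z N] fun ω => (P N ω * F N ω) i a :=
  @MatMeasurable.mul Ω _ _ _ (sampleSigma z N) _ _ _ (D.meas_P N) (D.meas_F N) i a

variable [IsProbabilityMeasure μ]

/-- `f'Pε = O_p(√N)`. -/
lemma exists_norm_linear_le (D : IsRegularDesign μ z F P k d B H₀)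
    (M : ErrorModel μ z ε u σε2 σue τ C) {η : ENNReal} (hη : 0 < η) :
    ∃ c : ℝ, EventuallyProb μ η fun N ω => ‖(P N ω * F N ω)ᵀ * errCol N ε ω‖ ≤ c * √N := by
  obtain ⟨c, hc⟩ := exists_eventuallyProb_le (μ := μ) (m := fun N => sampleSigma z N)
    (fun N => M.sampleSigma_le N) (X := fun N ω => ‖(P N ω * F N ω)ᵀ * errCol N ε ω‖ ^ 2)
    (b := fun N => √N ^ 2) (K := |σε2| * (Fintype.card n * B ^ 2)) (fun _ _ => sq_nonneg _)
    (by
      filter_upwards [eventually_gt_atTop 0] with N hN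
      have : (0 : ℝ) < N := by exact_mod_cast hN
      positivity)
    (Eventually.of_forall fun N => by
      obtain ⟨R, hR, hRb⟩ := M.exists_hasCondExp_norm_linear_sq (D.meas_mul N)
      refine ⟨R, hR, ?_⟩
      filter_upwards [hRb, D.norm_sq_mul_reducedForm_le N] with ω h1 h2
      rw [Real.sq_sqrt (Nat.cast_nonneg N), mul_assoc]
      exact h1.trans (mul_le_mul_of_nonneg_left h2 (abs_nonneg _))) hη
  exact ⟨_, hc.mono (Eventually.of_forall fun N => ae_of_all _ fun ω h =>
    le_sqrt_mul_of_sq_le (Real.sqrt_nonneg _) h)⟩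

/-- `u'Pε = O_p(k)`. -/
lemma exists_norm_quadratic_le (D : IsRegularDesign μ z F P k d B H₀)
    (M : ErrorModel μ z ε u σε2 σue τ C) {η : ENNReal} (hη : 0 < η) :
    ∃ c : ℝ, EventuallyProb μ η fun N ω =>
      ‖(errMat N u ω)ᵀ * P N ω * errCol N ε ω‖ ≤ c * k N := by
  have hC := M.C_nonneg
  obtain ⟨c, hc⟩ := exists_eventuallyProb_le (μ := μ) (m := fun N => sampleSigma z N)
    (fun N => M.sampleSigma_le N)
    (X := fun N ω => ‖(errMat N u ω)ᵀ * P N ω * errCol N ε ω‖ ^ 2)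
    (b := fun N => (k N : ℝ) ^ 2)
    (K := ∑ a, (σue a ^ 2 * (1 + d) ^ 2 + 2 * (C + σue a ^ 2 + C * |σε2|) * (1 + d)))
    (fun _ _ => sq_nonneg _)
    (by
      filter_upwards [D.eventually_rate] with N hN
      have : (0 : ℝ) < k N := by exact_mod_cast hN.2.1
      positivity)
    (by
      filter_upwards [D.eventually_rate] with N hN
      obtain ⟨R, hR, hRb⟩ := M.exists_hasCondExp_norm_quadratic_sq (D.meas_P N) (D.symm N)
      refine ⟨R, hR, ?_⟩
      filter_upwards [hRb] with ω h1
      refine h1.trans ?_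
      rw [Finset.sum_mul]
      refine Finset.sum_le_sum fun a _ => ?_
      have hk1 : (1 : ℝ) ≤ k N := by exact_mod_cast hN.2.1
      have hkd : (k N : ℝ) + d ≤ (1 + d) * k N := by
        rw [add_mul, one_mul]
        exact add_le_add le_rfl (le_mul_of_one_le_right (Nat.cast_nonneg d) hk1)
      have ht : (P N ω).trace ^ 2 ≤ ((1 + d) * k N) ^ 2 :=
        pow_le_pow_left₀ (Finset.sum_nonneg fun i _ => D.diag_nonneg N ω i)
          ((D.trace_le N ω).trans hkd) 2
      have hn : ‖P N ω‖ ^ 2 ≤ (1 + d) * (k N : ℝ) ^ 2 := by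
        refine ((D.norm_sq_le N ω).trans hkd).trans ?_
        gcongr
        exact le_self_pow₀ hk1 two_ne_zero
      calc _ ≤ σue a ^ 2 * ((1 + d) * k N) ^ 2 +
            2 * (C + σue a ^ 2 + C * |σε2|) * ((1 + d) * (k N : ℝ) ^ 2) := by gcongr
        _ = _ := by ring) hη
  exact ⟨_, hc.mono (Eventually.of_forall fun N => ae_of_all _ fun ω h =>
    le_sqrt_mul_of_sq_le (Nat.cast_nonneg _) h)⟩

/-- `(f'Pu + u'Pf) / N = O_p(1 / √N)`. -/
lemma exists_norm_cross_le (D : IsRegularDesign μ z F P k d B H₀)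
    (M : ErrorModel μ z ε u σε2 σue τ C) {η : ENNReal} (hη : 0 < η) :
    ∃ c : ℝ, EventuallyProb μ η fun N ω =>
      ‖(N : ℝ)⁻¹ • ((P N ω * F N ω)ᵀ * errMat N u ω + (errMat N u ω)ᵀ * (P N ω * F N ω))‖ ≤
        c / √N := by
  have hC := M.C_nonneg
  obtain ⟨c, hc⟩ := exists_eventuallyProb_le (μ := μ) (m := fun N => sampleSigma z N)
    (fun N => M.sampleSigma_le N) (X := fun N ω => ‖(P N ω * F N ω)ᵀ * errMat N u ω‖ ^ 2)
    (b := fun N => √N ^ 2) (K := Fintype.card n * C * (Fintype.card n * B ^ 2))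
    (fun _ _ => sq_nonneg _)
    (by
      filter_upwards [eventually_gt_atTop 0] with N hN
      have : (0 : ℝ) < N := by exact_mod_cast hN
      positivity)
    (Eventually.of_forall fun N => by
      obtain ⟨R, hR, hRb⟩ := M.exists_hasCondExp_norm_u_linear_sq (D.meas_mul N)
      refine ⟨R, hR, ?_⟩
      filter_upwards [hRb, D.norm_sq_mul_reducedForm_le N] with ω h1 h2
      rw [Real.sq_sqrt (Nat.cast_nonneg N), mul_assoc _ _ (N : ℝ)]
      exact h1.trans (mul_le_mul_of_nonneg_left h2 (by positivity))) hη
  refine ⟨2 * √|c|, hc.mono ?_⟩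
  filter_upwards [eventually_gt_atTop 0] with N hN
  refine ae_of_all _ fun ω h => ?_
  have hN0 : (0 : ℝ) < N := by exact_mod_cast hN
  have h1 := le_sqrt_mul_of_sq_le (Real.sqrt_nonneg _) h
  have h2 : ‖(errMat N u ω)ᵀ * (P N ω * F N ω)‖ = ‖(P N ω * F N ω)ᵀ * errMat N u ω‖ := by
    rw [← frobenius_norm_transpose, transpose_mul, transpose_transpose]
  rw [norm_smul, norm_inv, Real.norm_natCast]
  calc _ ≤ (N : ℝ)⁻¹ * (√|c| * √N + √|c| * √N) := by
        gcongr
        exact (norm_add_le _ _).trans (add_le_add h1 (h2.trans_le h1))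
    _ = (√N * √N)⁻¹ * (√|c| * √N + √|c| * √N) := by rw [Real.mul_self_sqrt hN0.le]
    _ = _ := by
        have : √(N : ℝ) ≠ 0 := (Real.sqrt_pos.2 hN0).ne'
        field_simp
        ring

/-- `u'Pu / N = O_p(k / N)`. -/
lemma exists_norm_u_quadratic_le (D : IsRegularDesign μ z F P k d B H₀)
    (M : ErrorModel μ z ε u σε2 σue τ C) {η : ENNReal} (hη : 0 < η) :
    ∃ c : ℝ, EventuallyProb μ η fun N ω =>
      ‖(N : ℝ)⁻¹ • ((errMat N u ω)ᵀ * P N ω * errMat N u ω)‖ ≤ c * k N / √N ^ 2 := by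
  have hC := M.C_nonneg
  obtain ⟨c, hc⟩ := exists_eventuallyProb_le (μ := μ) (m := fun N => sampleSigma z N)
    (fun N => M.sampleSigma_le N)
    (X := fun N ω => ((errMat N u ω)ᵀ * P N ω * errMat N u ω).trace)
    (b := fun N => (k N : ℝ)) (K := Fintype.card n * C * (1 + d))
    (fun N ω => (norm_nonneg _).trans (D.norm_quadratic_le N ω _))
    (by
      filter_upwards [D.eventually_rate] with N hN
      exact_mod_cast hN.2.1)
    (by
      filter_upwards [D.eventually_rate] with N hN
      obtain ⟨R, hR, hRb⟩ := M.exists_hasCondExp_trace_u_quadratic (D.meas_P N) (D.diag_nonneg N)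
      refine ⟨R, hR, ?_⟩
      filter_upwards [hRb] with ω h1
      refine h1.trans ?_
      have hk1 : (1 : ℝ) ≤ k N := by exact_mod_cast hN.2.1
      have hkd : (k N : ℝ) + d ≤ (1 + d) * k N := by
        rw [add_mul, one_mul]
        exact add_le_add le_rfl (le_mul_of_one_le_right (Nat.cast_nonneg d) hk1)
      rw [mul_assoc _ (1 + (d : ℝ))]
      exact mul_le_mul_of_nonneg_left ((D.trace_le N ω).trans hkd) (by positivity)) hη
  refine ⟨c, hc.mono ?_⟩
  filter_upwards [eventually_gt_atTop 0] with N hN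
  refine ae_of_all _ fun ω h => ?_
  have hN0 : (0 : ℝ) < N := by exact_mod_cast hN
  rw [norm_smul, norm_inv, Real.norm_natCast, Real.sq_sqrt hN0.le, div_eq_inv_mul]
  gcongr
  exact (D.norm_quadratic_le N ω _).trans h

end IsRegularDesign

end Regular

/-! ### The two remainders -/

section Remainders

attribute [local instance] Matrix.frobeniusNormedAddCommGroup Matrix.frobeniusNormedSpace

namespace IsRegularDesign

variable {Ω 𝒵 n : Type*} [mΩ : MeasurableSpace Ω] [m𝒵 : MeasurableSpace 𝒵] [Fintype n]
  [DecidableEq n] {μ : Measure Ω} {z : ℕ → Ω → 𝒵} {ε : ℕ → Ω → ℝ}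
  {u : ℕ → Ω → n → ℝ} {σε2 : ℝ} {σue τ : n → ℝ} {C B : ℝ}
  {F : (N : ℕ) → Ω → Matrix (Fin N) n ℝ} {P : (N : ℕ) → Ω → Matrix (Fin N) (Fin N) ℝ} {k : ℕ → ℕ}
  {d : ℕ} {H₀ : Matrix n n ℝ}

/-- With probability approaching one, the matrices `H`, `f'Pf / N` and their inverses exist and are
bounded, and the first two differ by at most `δ`. -/
lemma exists_tendstoProbOne_gram (D : IsRegularDesign μ z F P k d B H₀) :
    ∃ C : ℝ, 1 ≤ C ∧ ∀ δ : ℝ, 0 < δ → TendstoProbOne μ fun N ω =>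
      IsUnit (Hmat N (F N ω)).det ∧ ‖Hmat N (F N ω)‖ ≤ C ∧ ‖(Hmat N (F N ω))⁻¹‖ ≤ C ∧
      IsUnit ((N : ℝ)⁻¹ • ((F N ω)ᵀ * (P N ω * F N ω))).det ∧
      ‖((N : ℝ)⁻¹ • ((F N ω)ᵀ * (P N ω * F N ω)))⁻¹‖ ≤ C ∧
      ‖(N : ℝ)⁻¹ • ((F N ω)ᵀ * (P N ω * F N ω)) - Hmat N (F N ω)‖ ≤ δ ∧
      ∀ A, ‖A - (N : ℝ)⁻¹ • ((F N ω)ᵀ * (P N ω * F N ω))‖ ≤ C⁻¹ → IsUnit A.det ∧ ‖A⁻¹‖ ≤ C := by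
  obtain ⟨δ₀, hδ₀, C₀, hC₀⟩ := exists_isUnit_det_and_norm_inv_le D.limit_isUnit
  set C := max 1 (max C₀ (max (‖H₀‖ + δ₀) (3 / δ₀))) with hC
  have hC1 : 1 ≤ C := le_max_left _ _
  have hCC₀ : C₀ ≤ C := (le_max_left _ _).trans (le_max_right _ _)
  have hCH : ‖H₀‖ + δ₀ ≤ C :=
    (le_max_left _ _).trans ((le_max_right _ _).trans (le_max_right _ _))
  have hCδ : 3 / δ₀ ≤ C :=
    (le_max_right _ _).trans ((le_max_right _ _).trans (le_max_right _ _))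
  have hCinv : C⁻¹ ≤ δ₀ / 3 := by
    rw [← inv_div]
    exact inv_anti₀ (by positivity) hCδ
  refine ⟨C, hC1, fun δ hδ => ?_⟩
  have h := (D.limit (δ₀ / 3) (by positivity)).and (D.approx (min δ (δ₀ / 3)) (by positivity))
  refine h.mono (Eventually.of_forall fun N => ae_of_all _ fun ω ⟨h1, h2⟩ => ?_)
  set H := Hmat N (F N ω)
  set G := (N : ℝ)⁻¹ • ((F N ω)ᵀ * (P N ω * F N ω))
  have h3 : ‖G - H₀‖ ≤ δ₀ / 3 + δ₀ / 3 := by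
    have e : G - H₀ = (G - H) + (H - H₀) := by abel
    rw [e]
    exact (norm_add_le _ _).trans (add_le_add (h2.trans (min_le_right _ _)) h1)
  obtain ⟨a1, a2⟩ := hC₀ H (h1.trans (by linarith))
  obtain ⟨b1, b2⟩ := hC₀ G (h3.trans (by linarith))
  refine ⟨a1, ?_, a2.trans hCC₀, b1, b2.trans hCC₀, h2.trans (min_le_left _ _), fun A hA => ?_⟩
  · have e : H = (H - H₀) + H₀ := by abel
    rw [e]
    refine (norm_add_le _ _).trans ?_
    linarith
  · have e : A - H₀ = (A - G) + (G - H₀) := by abel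
    obtain ⟨c1, c2⟩ := hC₀ A (by
      rw [e]
      exact (norm_add_le _ _).trans (by linarith))
    exact ⟨c1, c2.trans hCC₀⟩

variable [IsProbabilityMeasure μ]

/-- The difference between the scaled squared error of the estimator and its leading term is of
smaller order than `S(k)`. The vectors `v N ω` are the errors of the estimator. -/
theorem isLittleOProb_error_sub_leadingTerm (D : IsRegularDesign μ z F P k d B H₀)
    (M : ErrorModel μ z ε u σε2 σue τ C) (hσε2 : 0 ≤ σε2) (hσue : σue ≠ 0) {v : ℕ → Ω → n → ℝ}
    (hv : ∀ N ω, IsUnit ((F N ω + errMat N u ω)ᵀ * P N ω * (F N ω + errMat N u ω)).det →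
      replicateCol Unit (v N ω) =
        ((F N ω + errMat N u ω)ᵀ * P N ω * (F N ω + errMat N u ω))⁻¹ *
          ((F N ω + errMat N u ω)ᵀ * P N ω * errCol N ε ω)) :
    IsLittleOProb μ (fun N ω => (N : ℝ) • vecMulVec (v N ω) (v N ω) -
      leadingTerm (F N ω) (P N ω) (errMat N u ω) (errCol N ε ω))
      (fun N ω => frob (Smat N (k N) σue σε2 (F N ω) (P N ω))) := by
  refine isLittleOProb_of_tendstoProbOne fun δ hδ η hη => ?_
  obtain ⟨C₀, hC₀, hgram⟩ := D.exists_tendstoProbOne_gram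
  have hη' : 0 < η / 2 / 2 / 2 := by
    simpa using ENNReal.half_pos (ENNReal.half_pos (ENNReal.half_pos hη.ne').ne').ne'
  obtain ⟨c₁, h₁⟩ := D.exists_norm_linear_le M hη'
  obtain ⟨c₂, h₂⟩ := D.exists_norm_quadratic_le M hη'
  obtain ⟨c₃, h₃⟩ := D.exists_norm_cross_le M hη'
  obtain ⟨c₄, h₄⟩ := D.exists_norm_u_quadratic_le M hη'
  have h₀ := hgram 1 one_pos (η / 2) (ENNReal.half_pos hη.ne')
  have hev := h₀.and ((h₁.and h₂).and (h₃.and h₄))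
  rw [ENNReal.add_halves, ENNReal.add_halves, ENNReal.add_halves] at hev
  refine hev.mono ?_
  set C₁ := max C₀ (max (max c₁ c₂) (max c₃ c₄)) with hC₁
  have i₀ : C₀ ≤ C₁ := le_max_left _ _
  have i₁ : c₁ ≤ C₁ := (le_max_left _ _).trans ((le_max_left _ _).trans (le_max_right _ _))
  have i₂ : c₂ ≤ C₁ := (le_max_right _ _).trans ((le_max_left _ _).trans (le_max_right _ _))
  have i₃ : c₃ ≤ C₁ := (le_max_left _ _).trans ((le_max_right _ _).trans (le_max_right _ _))
  have i₄ : c₄ ≤ C₁ := (le_max_right _ _).trans ((le_max_right _ _).trans (le_max_right _ _))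
  have hC₁1 : 1 ≤ C₁ := hC₀.trans i₀
  have hC₀0 : 0 < C₀ := by linarith
  have hC₁0 : 0 < C₁ := by linarith
  set ς : ℝ := ∑ a, σue a ^ 2 with hς
  have hς0 : 0 < ς := by
    obtain ⟨a, ha⟩ := Function.ne_iff.1 hσue
    exact Finset.sum_pos' (fun _ _ => sq_nonneg _) ⟨a, Finset.mem_univ a, by
      have : σue a ≠ 0 := ha
      positivity⟩
  have hsqrt : Tendsto (fun N : ℕ => √(N : ℝ)) atTop atTop :=
    Real.tendsto_sqrt_atTop.comp tendsto_natCast_atTop_atTop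
  have hB₁ : Tendsto (fun N : ℕ => C₁ / √(N : ℝ)) atTop (𝓝 0) :=
    tendsto_const_nhds.div_atTop hsqrt
  have hB₂ : Tendsto (fun N : ℕ => C₁ * ((k N : ℝ) ^ 2 / (N : ℝ))) atTop (𝓝 0) := by
    simpa using D.rate.const_mul C₁
  have hkr : Tendsto (fun N => (k N : ℝ)) atTop atTop := tendsto_natCast_atTop_atTop.comp D.size
  filter_upwards [D.eventually_rate, hB₁.eventually_le_const (by positivity : 0 < C₀⁻¹ / 2),
    hB₂.eventually_le_const (by positivity : 0 < C₀⁻¹ / 2),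
    hkr.eventually_ge_atTop (190 * C₁ ^ 12 * (Fintype.card n * C₁ ^ 2) / (δ * ς))]
    with N ⟨hN, hk1, hkN⟩ e₁ e₂ e₃
  refine ae_of_all _ fun ω ⟨⟨g1, g2, g3, g4, g5, g6, g7⟩, ⟨a1, a2⟩, a3, a4⟩ => ?_
  have hN0 : (0 : ℝ) < N := by exact_mod_cast hN
  have hk1' : (1 : ℝ) ≤ k N := by exact_mod_cast hk1
  have hk0 : (0 : ℝ) < k N := by linarith
  have hB1 : ‖(N : ℝ)⁻¹ • ((P N ω * F N ω)ᵀ * errMat N u ω + (errMat N u ω)ᵀ * (P N ω * F N ω))‖ ≤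
      C₁ / √N := a3.trans (by gcongr)
  have hB2 : ‖(N : ℝ)⁻¹ • ((errMat N u ω)ᵀ * P N ω * errMat N u ω)‖ ≤ C₁ * k N / √N ^ 2 :=
    a4.trans (by gcongr)
  have hB2' : ‖(N : ℝ)⁻¹ • ((errMat N u ω)ᵀ * P N ω * errMat N u ω)‖ ≤ C₀⁻¹ / 2 := by
    refine (hB2.trans ?_).trans e₂
    rw [Real.sq_sqrt hN0.le, mul_div_assoc]
    gcongr
    exact le_self_pow₀ hk1' two_ne_zero
  -- `X'PX / N` differs from `G` by the small terms `B₁` and `B₂`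
  obtain ⟨x1, x2⟩ := g7 ((N : ℝ)⁻¹ • ((F N ω + errMat N u ω)ᵀ * P N ω * (F N ω + errMat N u ω))) (by
    rw [← gram_regressor_eq (D.symm N ω), add_assoc, add_sub_cancel_left]
    exact (norm_add_le _ _).trans (by linarith [hB1.trans e₁]))
  have hdet : IsUnit ((F N ω + errMat N u ω)ᵀ * P N ω * (F N ω + errMat N u ω)).det := by
    rw [det_smul, IsUnit.mul_iff] at x1; exact x1.2
  have hr := norm_error_sub_leadingTerm_le hN (D.symm N ω) hC₁1 hk1' hkN (hv N ω hdet) g4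
    (g5.trans i₀) x1 (x2.trans i₀) (a1.trans (by gcongr)) (a2.trans (by gcongr)) hB1 hB2
  have hS := trace_le_card_mul_norm_Smat (k := k N) (σue := σue) (σε2 := σε2) (D.symm N ω) g1
    (g2.trans i₀)
  -- the endogeneity term makes `S(k)` at least of order `k² / N`, whereas `r` is of order `k / N`
  have hS' : (k N : ℝ) ^ 2 / N * ς ≤
      Fintype.card n * C₁ ^ 2 * ‖Smat N (k N) σue σε2 (F N ω) (P N ω)‖ := by
    refine le_trans ?_ hS
    exact le_add_of_nonneg_right (by positivity)
  refine hr.trans ?_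
  rw [div_le_iff₀ (by positivity)] at e₃
  have h5 : 190 * C₁ ^ 12 * ((k N : ℝ) ^ 2 / N * ς) ≤
      δ * ς * k N * ‖Smat N (k N) σue σε2 (F N ω) (P N ω)‖ := by
    calc _ ≤ 190 * C₁ ^ 12 *
          (Fintype.card n * C₁ ^ 2 * ‖Smat N (k N) σue σε2 (F N ω) (P N ω)‖) := by gcongr
      _ = 190 * C₁ ^ 12 * (Fintype.card n * C₁ ^ 2) *
          ‖Smat N (k N) σue σε2 (F N ω) (P N ω)‖ := by ring
      _ ≤ (k N * (δ * ς)) * ‖Smat N (k N) σue σε2 (F N ω) (P N ω)‖ := by gcongr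
      _ = _ := by ring
  refine le_of_mul_le_mul_left ?_ (by positivity : 0 < ς * k N)
  calc _ = 190 * C₁ ^ 12 * ((k N : ℝ) ^ 2 / N * ς) := by field_simp
    _ ≤ _ := h5
    _ = _ := by ring

/-- The conditional mean of the leading term is `σ_ε² H⁻¹ + S(k)`, up to a term of smaller order
than `S(k)`. -/
theorem exists_condExp_leadingTerm (D : IsRegularDesign μ z F P k d B H₀)
    (M : ErrorModel μ z ε u σε2 σue τ C) (hσε2 : 0 < σε2) (hσue : σue ≠ 0) :
    ∃ T : ℕ → Ω → Matrix n n ℝ,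
      (∀ N, MatHasCondExp μ (sampleSigma z N)
        (fun ω => leadingTerm (F N ω) (P N ω) (errMat N u ω) (errCol N ε ω))
        (fun ω => σε2 • (Hmat N (F N ω))⁻¹ + Smat N (k N) σue σε2 (F N ω) (P N ω) + T N ω)) ∧
      IsLittleOProb μ T (fun N ω => frob (Smat N (k N) σue σε2 (F N ω) (P N ω))) := by
  choose Eab Ebb Ec hcond hab hbb hc using fun N =>
    M.exists_matHasCondExp_leadingTerm (D.meas_F N) (D.meas_P N) (D.symm N)
  refine ⟨fun N ω => (N : ℝ)⁻¹ • (((N : ℝ)⁻¹ • ((F N ω)ᵀ * (P N ω * F N ω)))⁻¹ *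
      (σε2 • ((P N ω * F N ω)ᵀ * (P N ω * F N ω)) + Eab N ω + (Eab N ω)ᵀ + Ebb N ω -
        (N : ℝ)⁻¹ • Ec N ω - ((N : ℝ)⁻¹ • Ec N ω)ᵀ) *
      ((N : ℝ)⁻¹ • ((F N ω)ᵀ * (P N ω * F N ω)))⁻¹) - σε2 • (Hmat N (F N ω))⁻¹ -
      Smat N (k N) σue σε2 (F N ω) (P N ω), fun N => ?_, ?_⟩
  · convert! hcond N using 1
    ext1 ω
    beta_reduce
    rw [← sub_add_eq_sub_sub, add_sub_cancel]
  have hC := M.C_nonneg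
  obtain ⟨C₀, hC₀, hgram⟩ := D.exists_tendstoProbOne_gram
  have hC₀0 : 0 < C₀ := by linarith
  set ς : ℝ := ∑ a, σue a ^ 2 with hς
  have hς0 : 0 < ς := by
    obtain ⟨a, ha⟩ := Function.ne_iff.1 hσue
    exact Finset.sum_pos' (fun _ _ => sq_nonneg _) ⟨a, Finset.mem_univ a, by
      have : σue a ≠ 0 := ha
      positivity⟩
  have hσσ : ∀ a b, |σue a * σue b| ≤ ς := fun a b => by
    have h := abs_entry_le_norm (vecMulVec σue σue) a b
    rwa [norm_vecMulVec_self, vecMulVec_apply] at h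
  set κ : ℝ := 2 * (C + ς + C * |σε2|) with hκ
  obtain ⟨c, hc0, hT⟩ := exists_norm_mean_sub_le σue τ d hσε2.le D.bound_nonneg hC₀0.le
    (by positivity : 0 ≤ κ)
  refine isLittleOProb_of_tendstoProbOne fun δ hδ => ?_
  -- the trace of the middle factor of `S(k)` is at least `m (k² + ‖W‖²) / N`
  set m : ℝ := min ς σε2 with hm
  have hm0 : 0 < m := lt_min hς0 hσε2
  set c' : ℝ := c * (Fintype.card n * C₀ ^ 2 / m) with hc'
  have hc'0 : 0 ≤ c' := by positivity
  set δ₁ : ℝ := δ / (2 * (c' + 1)) with hδ₁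
  have hδ₁0 : 0 < δ₁ := by positivity
  have hkr : Tendsto (fun N => 1 / √(k N : ℝ)) atTop (𝓝 0) :=
    tendsto_const_nhds.div_atTop (Real.tendsto_sqrt_atTop.comp
      (tendsto_natCast_atTop_atTop.comp D.size))
  refine ((hgram δ₁ hδ₁0).and D.trace_eq).mono ?_
  filter_upwards [D.eventually_rate, hkr.eventually_le_const hδ₁0] with N ⟨hN, hk1, hkN⟩ e₁
  filter_upwards [D.bound N, hbb N] with ω hF hEbb ⟨⟨g1, g2, g3, g4, g5, g6, g7⟩, htr⟩
  have hN0 : (0 : ℝ) < N := by exact_mod_cast hN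
  refine (hT N (k N) δ₁ (F N ω) (P N ω) (Eab N ω) (Ebb N ω) (Ec N ω) hN hk1 hkN (D.symm N ω)
    (D.diag_nonneg N ω) htr (D.norm_sq_le N ω) (D.norm_mul_le N ω) hF g1 g4 g3 g5 g6 (hab N ω)
    (fun a b => (hEbb a b).trans ?_) (hc N ω)).trans ?_
  · rw [norm_sq_eq_sum, hκ]
    gcongr
    exact hσσ a b
  have hS := trace_le_card_mul_norm_Smat (k := k N) (σue := σue) (σε2 := σε2) (D.symm N ω) g1 g2
  have hR : ((k N : ℝ) ^ 2 + ‖resid (F N ω) (P N ω)‖ ^ 2) / N ≤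
      Fintype.card n * C₀ ^ 2 / m * ‖Smat N (k N) σue σε2 (F N ω) (P N ω)‖ := by
    rw [div_mul_eq_mul_div, le_div_iff₀ hm0]
    refine le_trans ?_ hS
    calc _ = (k N : ℝ) ^ 2 / N * m + m / N * ‖resid (F N ω) (P N ω)‖ ^ 2 := by ring
      _ ≤ _ := by
          gcongr
          · exact min_le_left _ _
          · exact min_le_right _ _
  calc _ ≤ c * (δ₁ + δ₁) * (Fintype.card n * C₀ ^ 2 / m *
        ‖Smat N (k N) σue σε2 (F N ω) (P N ω)‖) := by gcongr
    _ = 2 * c' * δ₁ * ‖Smat N (k N) σue σε2 (F N ω) (P N ω)‖ := by rw [hc']; ring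
    _ ≤ (2 * (c' + 1) * δ₁) * ‖Smat N (k N) σue σε2 (F N ω) (P N ω)‖ := by gcongr; linarith
    _ = _ := by
        rw [hδ₁, mul_div_cancel₀]
        positivity

end IsRegularDesign

end Remainders

/-! ### The errors of the linear model -/

section ModelErrors

lemma abs_condExp_mul_le {Ω : Type*} {m mΩ : MeasurableSpace Ω} {μ : Measure Ω} {X Y : Ω → ℝ}
    (hXY : Integrable (fun ω => X ω * Y ω) μ) (hX : Integrable (fun ω => X ω ^ 2) μ)
    (hY : Integrable (fun ω => Y ω ^ 2) μ) :
    ∀ᵐ ω ∂μ, |(μ[fun ω => X ω * Y ω | m]) ω| ≤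
      (μ[fun ω => X ω ^ 2 | m]) ω + (μ[fun ω => Y ω ^ 2 | m]) ω := by
  have h1 : μ[fun ω => X ω * Y ω | m] ≤ᵐ[μ]
      μ[(fun ω => X ω ^ 2) + fun ω => Y ω ^ 2 | m] :=
    condExp_mono hXY (hX.add hY) (ae_of_all _ fun ω => by
      simp only [Pi.add_apply]
      nlinarith [sq_nonneg (X ω - Y ω), sq_nonneg (X ω), sq_nonneg (Y ω)])
  have h2 : μ[-((fun ω => X ω ^ 2) + fun ω => Y ω ^ 2) | m] ≤ᵐ[μ] μ[fun ω => X ω * Y ω | m] :=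
    condExp_mono (hX.add hY).neg hXY (ae_of_all _ fun ω => by
      simp only [Pi.add_apply, Pi.neg_apply]
      nlinarith [sq_nonneg (X ω + Y ω), sq_nonneg (X ω), sq_nonneg (Y ω)])
  filter_upwards [h1, h2, condExp_add hX hY m,
    condExp_neg ((fun ω => X ω ^ 2) + fun ω => Y ω ^ 2) (μ := μ) m] with ω e1 e2 e3 e4
  rw [e3, Pi.add_apply] at e1
  rw [e4, Pi.neg_apply, e3, Pi.add_apply] at e2
  exact abs_le.2 ⟨e2, e1⟩

variable {Ω 𝒵 : Type*} [MeasurableSpace Ω] [MeasurableSpace 𝒵] {μ : Measure Ω}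
  [IsProbabilityMeasure μ] {d₁ d₂ : ℕ} {y : ℕ → Ω → ℝ} {Y : ℕ → Ω → Fin d₁ → ℝ}
  {z : ℕ → Ω → 𝒵} {x₁ : 𝒵 → Fin d₂ → ℝ} {g : 𝒵 → Fin d₁ → ℝ} {β : Fin d₁ ⊕ Fin d₂ → ℝ}
  {ε : ℕ → Ω → ℝ} {u : ℕ → Ω → Fin d₁ ⊕ Fin d₂ → ℝ}

lemma measurable_reducedForm (hx₁ : Measurable x₁) (hg : Measurable g) :
    Measurable (reducedForm g x₁) := by
  refine measurable_pi_iff.2 fun a => ?_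
  rcases a with a | a
  · exact (measurable_pi_apply a).comp hg
  · exact (measurable_pi_apply a).comp hx₁

lemma measurable_structuralError (hx₁ : Measurable x₁) :
    Measurable fun w : ℝ × (Fin d₁ → ℝ) × 𝒵 => structuralError x₁ β w.1 w.2.1 w.2.2 := by
  simp only [structuralError, regressor, dotProduct]
  refine measurable_fst.sub (Finset.measurable_fun_sum _ fun a _ => Measurable.mul_const ?_ _)
  rcases a with a | a
  · exact (measurable_pi_apply a).comp (measurable_fst.comp measurable_snd)
  · exact (measurable_pi_apply a).comp (hx₁.comp (measurable_snd.comp measurable_snd))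

lemma measurable_reducedFormError (hx₁ : Measurable x₁) (hg : Measurable g) :
    Measurable fun w : ℝ × (Fin d₁ → ℝ) × 𝒵 => reducedFormError g x₁ w.2.1 w.2.2 := by
  refine measurable_pi_iff.2 fun a => ?_
  simp only [reducedFormError, Pi.sub_apply, regressor]
  refine Measurable.sub ?_ ((measurable_pi_apply a).comp ((measurable_reducedForm hx₁ hg).comp
    (measurable_snd.comp measurable_snd)))
  rcases a with a | a
  · exact (measurable_pi_apply a).comp (measurable_fst.comp measurable_snd)
  · exact (measurable_pi_apply a).comp (hx₁.comp (measurable_snd.comp measurable_snd))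

/-- The assumptions of the linear model on the errors, in the form used by the moment bounds. -/
theorem exists_errorModel {σε2 : ℝ} {σue : Fin d₁ ⊕ Fin d₂ → ℝ}
    (hy : ∀ i, Measurable (y i)) (hY : ∀ i, Measurable (Y i)) (hz : ∀ i, Measurable (z i))
    (hx₁ : Measurable x₁) (hg : Measurable g)
    (hε : ∀ i ω, ε i ω = structuralError x₁ β (y i ω) (Y i ω) (z i ω))
    (hu : ∀ i ω, u i ω = reducedFormError g x₁ (Y i ω) (z i ω))
    (hindep : iIndepFun (fun i ω => (y i ω, Y i ω, z i ω)) μ)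
    (hy4 : ∀ i, MemLp (y i) 4 μ) (hY4 : ∀ i a, MemLp (fun ω => Y i ω a) 4 μ)
    (hσε : ∀ i, ∫ ω, ε i ω ^ 2 ∂μ = σε2)
    (hε0 : ∀ i, μ[ε i | MeasurableSpace.comap (z i) inferInstance] =ᵐ[μ] 0)
    (hgY : ∀ i a, μ[fun ω => Y i ω a | MeasurableSpace.comap (z i) inferInstance]
      =ᵐ[μ] fun ω => g (z i ω) a)
    (hmom : ∃ c : Fin d₁ ⊕ Fin d₂ → ℕ → ℕ → ℝ, ∀ i a r s, r + s ≤ 4 →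
      μ[fun ω => ε i ω ^ r * u i ω a ^ s | MeasurableSpace.comap (z i) inferInstance]
        =ᵐ[μ] fun _ => c a r s)
    (hfb : ∃ B : ℝ, ∀ i, ∀ᵐ ω ∂μ, ∀ a, |reducedForm g x₁ (z i ω) a| ≤ B)
    (hσue : ∀ i a, μ[fun ω => u i ω a * ε i ω | MeasurableSpace.comap (z i) inferInstance]
      =ᵐ[μ] fun _ => σue a)
    (hσue_ne : σue ≠ 0) :
    ∃ (τ : Fin d₁ ⊕ Fin d₂ → ℝ) (C : ℝ), ErrorModel μ z ε u σε2 σue τ C := by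
  obtain ⟨c, hc⟩ := hmom
  obtain ⟨B, hB⟩ := hfb
  obtain ⟨a₀, -⟩ := Function.ne_iff.1 hσue_ne
  have hw : ∀ i, Measurable fun ω => (y i ω, Y i ω, z i ω) := fun i =>
    (hy i).prodMk ((hY i).prodMk (hz i))
  have hεm : ∀ i, Measurable (ε i) := fun i => by
    rw [funext (hε i)]
    exact (measurable_structuralError hx₁).comp (hw i)
  have hum : ∀ i, Measurable (u i) := fun i => by
    rw [funext (hu i)]
    exact (measurable_reducedFormError hx₁ hg).comp (hw i)
  have hf4 : ∀ i a, MemLp (fun ω => reducedForm g x₁ (z i ω) a) 4 μ := fun i a =>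
    MemLp.of_bound (((measurable_pi_apply a).comp
      ((measurable_reducedForm hx₁ hg).comp (hz i))).aestronglyMeasurable) B
      ((hB i).mono fun ω h => h a)
  have hX4 : ∀ i a, MemLp (fun ω => regressor x₁ (Y i ω) (z i ω) a) 4 μ := by
    intro i a
    rcases a with a | a
    · exact hY4 i a
    · exact hf4 i (Sum.inr a)
  have hε4 : ∀ i, MemLp (ε i) 4 μ := fun i => by
    rw [funext (hε i)]
    simp only [structuralError, dotProduct]
    exact (hy4 i).sub (memLp_finsetSum _ fun a _ => (hX4 i a).mul_const (β a))
  have hu4 : ∀ i a, MemLp (fun ω => u i ω a) 4 μ := fun i a => by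
    simp only [hu, reducedFormError, Pi.sub_apply]
    exact (hX4 i a).sub (hf4 i a)
  have hone : MemLp (fun _ : Ω => (1 : ℝ)) 4 μ := memLp_const 1
  have h4 : ∀ {X₁ X₂ X₃ X₄ : Ω → ℝ}, MemLp X₁ 4 μ → MemLp X₂ 4 μ → MemLp X₃ 4 μ → MemLp X₄ 4 μ →
      Integrable (fun ω => X₁ ω * X₂ ω * X₃ ω * X₄ ω) μ := by
    intro X₁ X₂ X₃ X₄ h1 h2 h3 h4
    have h := integrable_prod_four (μ := μ) (X := ![X₁, X₂, X₃, X₄]) (by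
      intro t
      fin_cases t
      exacts [h1, h2, h3, h4])
    simp only [Fin.prod_univ_four] at h
    exact h
  refine ⟨fun a => c a 2 1, ∑ a, 2 * (|c a 0 2| + |c a 2 2|), ?_⟩
  have hCa : ∀ a, 2 * (|c a 0 2| + |c a 2 2|) ≤ ∑ a, 2 * (|c a 0 2| + |c a 2 2|) := fun a =>
    Finset.single_le_sum (f := fun a => 2 * (|c a 0 2| + |c a 2 2|)) (fun _ _ => by positivity)
      (Finset.mem_univ a)
  have hεε : ∀ i, μ[fun ω => ε i ω * ε i ω | MeasurableSpace.comap (z i) inferInstance]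
      =ᵐ[μ] fun _ => c a₀ 2 0 := fun i => by
    simpa [pow_two] using hc i a₀ 2 0 (by norm_num)
  -- the constant conditional variance is the unconditional one
  have hc20 : c a₀ 2 0 = σε2 := by
    have h1 := integral_condExp (μ := μ) (hz 0).comap_le (f := fun ω => ε 0 ω * ε 0 ω)
    rw [integral_congr_ae (hεε 0)] at h1
    rw [← hσε 0]
    simpa [pow_two] using h1
  exact {
    C_nonneg := Finset.sum_nonneg fun _ _ => by positivity
    meas_z := hz
    meas_ε := hεm
    meas_u := hum
    indep := by
      have h := hindep.comp (fun _ w => (structuralError x₁ β w.1 w.2.1 w.2.2,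
        reducedFormError g x₁ w.2.1 w.2.2, w.2.2)) fun _ =>
          (measurable_structuralError hx₁).prodMk ((measurable_reducedFormError hx₁ hg).prodMk
            (measurable_snd.comp measurable_snd))
      convert! h using 3 with i
      simp [hε, hu]
    ε_four := hε4
    u_four := hu4
    ε_mean := hε0
    u_mean := fun i a => by
      rcases a with a | a
      · have e : (fun ω => u i ω (Sum.inl a)) = (fun ω => Y i ω a) - fun ω => g (z i ω) a := by
          ext ω
          simp [hu, reducedFormError, regressor, reducedForm]
        have hgm : Measurable[MeasurableSpace.comap (z i) inferInstance] fun ω => g (z i ω) a :=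
          ((measurable_pi_apply a).comp hg).comp (comap_measurable (z i))
        have hgi : Integrable (fun ω => g (z i ω) a) μ :=
          (hf4 i (Sum.inl a)).integrable (by norm_num)
        rw [e]
        filter_upwards [condExp_sub ((hY4 i a).integrable (by norm_num)) hgi
          (MeasurableSpace.comap (z i) inferInstance), hgY i a] with ω h1 h2
        rw [h1, Pi.sub_apply, h2, condExp_of_stronglyMeasurable (hz i).comap_le
          hgm.stronglyMeasurable hgi]
        simp
      · have e : (fun ω => u i ω (Sum.inr a)) = 0 := by
          ext ω
          simp [hu, reducedFormError, regressor, reducedForm]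
        rw [e, condExp_zero]
    ε_ε := fun i => hc20 ▸ hεε i
    u_ε := hσue
    u_ε_ε := fun i a => by
      have h := hc i a 2 1 (by norm_num)
      have e : (fun ω => ε i ω ^ 2 * u i ω a ^ 1) = fun ω => u i ω a * (ε i ω * ε i ω) := by
        ext ω; ring
      rwa [e] at h
    u_u := fun i a b => by
      have hsq : ∀ a, Integrable (fun ω => u i ω a ^ 2) μ := fun a => by
        convert! h4 (hu4 i a) (hu4 i a) hone hone using 2 with ω
        ring
      have hab : Integrable (fun ω => u i ω a * u i ω b) μ := by
        convert! h4 (hu4 i a) (hu4 i b) hone hone using 2 with ω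
        ring
      have e : ∀ a, (fun ω => ε i ω ^ 0 * u i ω a ^ 2) = fun ω => u i ω a ^ 2 := fun a => by
        ext ω; ring
      have ha := hc i a 0 2 (by norm_num)
      have hb := hc i b 0 2 (by norm_num)
      rw [e] at ha hb
      filter_upwards [abs_condExp_mul_le hab (hsq a) (hsq b), ha, hb] with ω h1 h2 h3
      rw [h2, h3] at h1
      have i1 := hCa a
      have i2 := hCa b
      linarith [le_abs_self (c a 0 2), le_abs_self (c b 0 2), abs_nonneg (c a 2 2),
        abs_nonneg (c b 2 2)]
    u_ε_u_ε := fun i a b => by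
      have hsq : ∀ a, Integrable (fun ω => (u i ω a * ε i ω) ^ 2) μ := fun a => by
        convert! h4 (hu4 i a) (hu4 i a) (hε4 i) (hε4 i) using 2 with ω
        ring
      have hab : Integrable (fun ω => u i ω a * ε i ω * (u i ω b * ε i ω)) μ := by
        convert! h4 (hu4 i a) (hu4 i b) (hε4 i) (hε4 i) using 2 with ω
        ring
      have e : ∀ a, (fun ω => ε i ω ^ 2 * u i ω a ^ 2) = fun ω => (u i ω a * ε i ω) ^ 2 :=
        fun a => by ext ω; ring
      have ha := hc i a 2 2 (by norm_num)
      have hb := hc i b 2 2 (by norm_num)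
      rw [e] at ha hb
      filter_upwards [abs_condExp_mul_le hab (hsq a) (hsq b), ha, hb] with ω h1 h2 h3
      rw [h2, h3] at h1
      have i1 := hCa a
      have i2 := hCa b
      linarith [le_abs_self (c a 2 2), le_abs_self (c b 2 2), abs_nonneg (c a 0 2),
        abs_nonneg (c b 0 2)] }

end ModelErrors

/-! ### Convergence of the sample matrices -/

section Design

attribute [local instance] Matrix.frobeniusNormedAddCommGroup Matrix.frobeniusNormedSpace

variable {Ω 𝒵 : Type*} {d₂ : ℕ} {n : Type*} [Fintype n] {z : ℕ → Ω → 𝒵} {x₁ : 𝒵 → Fin d₂ → ℝ}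
  {ψ : ℕ → 𝒵 → ℝ} {φ : 𝒵 → n → ℝ}

/-- The average projection matrix, as a function of the first `N` values of `z`. -/
noncomputable def sampleProj (N : ℕ) (ψ : ℕ → 𝒵 → ℝ) (x₁ : 𝒵 → Fin d₂ → ℝ) (K k : ℕ)
    (w : Fin N → 𝒵) : Matrix (Fin N) (Fin N) ℝ :=
  ((K.choose k : ℕ) : ℝ)⁻¹ • ∑ s ∈ Finset.powersetCard k (Finset.univ : Finset (Fin K)),
    proj (Matrix.of fun i => instr ψ x₁ s (w i))

/-- The mean over the subsets of the average squared approximation error of the instruments. -/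
noncomputable def approxError (N : ℕ) (ψ : ℕ → 𝒵 → ℝ) (x₁ : 𝒵 → Fin d₂ → ℝ) (φ : 𝒵 → n → ℝ)
    (K k : ℕ) (Γ : (s : Finset (Fin K)) → Matrix ({j // j ∈ s} ⊕ Fin d₂) n ℝ) (w : ℕ → 𝒵) : ℝ :=
  (N : ℝ)⁻¹ * (((K.choose k : ℕ) : ℝ)⁻¹ *
    ∑ s ∈ Finset.powersetCard k (Finset.univ : Finset (Fin K)),
      ‖(rows N fun i => φ (w i)) - instrMatrix N ψ x₁ s w * Γ s‖ ^ 2)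

lemma norm_sq_approx_eq {N K : ℕ} {s : Finset (Fin K)} (Γ : Matrix ({j // j ∈ s} ⊕ Fin d₂) n ℝ)
    (w : ℕ → 𝒵) : ‖(rows N fun i => φ (w i)) - instrMatrix N ψ x₁ s w * Γ‖ ^ 2 =
      ∑ i : Fin N, ∑ a, (φ (w i) a - Γᵀ.mulVec (instr ψ x₁ s (w i)) a) ^ 2 := by
  rw [norm_sq_eq_sum]
  refine Finset.sum_congr rfl fun i _ => Finset.sum_congr rfl fun a _ => ?_
  rw [mulVec_transpose]
  rfl

variable [MeasurableSpace 𝒵]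

lemma measurable_sample_coeff {N : ℕ} {p q : Type*} {A : (Fin N → 𝒵) → Matrix p q ℝ}
    (hA : MatMeasurable A) (i : p) (j : q) :
    Measurable[sampleSigma z N] fun ω => A (fun i => z i ω) i j :=
  (hA i j).comp (comap_measurable _)

lemma matMeasurable_rows {n : Type*} {φ : 𝒵 → n → ℝ} (hφ : Measurable φ) (N : ℕ) :
    MatMeasurable fun w : Fin N → 𝒵 => Matrix.of fun i => φ (w i) :=
  fun i a => (measurable_pi_apply a).comp (hφ.comp (measurable_pi_apply i))

variable [mΩ : MeasurableSpace Ω] {μ : Measure Ω}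

lemma matMeasurable_instrMatrix {N K : ℕ} (hx₁ : Measurable x₁) (hψ : ∀ j, Measurable (ψ j))
    (s : Finset (Fin K)) :
    MatMeasurable fun w : Fin N → 𝒵 => Matrix.of fun i => instr ψ x₁ s (w i) := by
  intro i j
  rcases j with j | j
  · exact (hψ _).comp (measurable_pi_apply i)
  · exact (measurable_pi_apply j).comp (hx₁.comp (measurable_pi_apply i))

lemma matMeasurable_sampleProj {N K k : ℕ} (hx₁ : Measurable x₁) (hψ : ∀ j, Measurable (ψ j)) :
    MatMeasurable (sampleProj N ψ x₁ K k) := by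
  refine MatMeasurable.smul (fun i j => ?_) _
  simp only [Matrix.sum_apply]
  exact Finset.measurable_fun_sum _ fun s _ => (matMeasurable_instrMatrix hx₁ hψ s).proj i j

lemma measurableSet_fullRank (hx₁ : Measurable x₁) (hψ : ∀ j, Measurable (ψ j))
    (hz : ∀ i, Measurable (z i)) (N K k : ℕ) :
    MeasurableSet {ω | FullRank N ψ x₁ K k fun i => z i ω} := by
  simp only [FullRank, isUnit_iff_ne_zero, Set.ofPred_forall]
  refine Finset.measurableSet_biInter _ fun s _ => ?_
  have h := ((matMeasurable_instrMatrix (N := N) hx₁ hψ s).transpose.mul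
    (matMeasurable_instrMatrix hx₁ hψ s)).det
  exact ((h.comp (measurable_pi_lambda (fun ω (i : Fin N) => z i ω) fun i => hz i))
    (measurableSet_singleton 0)).compl

/-- Because the observations are identically distributed, the mean of the sample approximation error
is the population approximation error. -/
lemma lintegral_approxError (hφ : Measurable φ) (hx₁ : Measurable x₁) (hψ : ∀ j, Measurable (ψ j))
    (hz : ∀ i, Measurable (z i)) (hident : ∀ i, IdentDistrib (z i) (z 0) μ μ) {N : ℕ} (hN : 0 < N)
    {K k : ℕ} (hk : k ≤ K) (Γ : (s : Finset (Fin K)) → Matrix ({j // j ∈ s} ⊕ Fin d₂) n ℝ) :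
    ∫⁻ ω, ENNReal.ofReal (approxError N ψ x₁ φ K k Γ fun i => z i ω) ∂μ =
      ((K.choose k : ℕ) : ENNReal)⁻¹ *
        ∑ s ∈ Finset.powersetCard k (Finset.univ : Finset (Fin K)),
          ∫⁻ ω, ENNReal.ofReal (∑ a, (φ (z 0 ω) a -
            (Γ s)ᵀ.mulVec (instr ψ x₁ s (z 0 ω)) a) ^ 2) ∂μ := by
  have hN0 : (0 : ℝ) < N := by exact_mod_cast hN
  have hc0 : (0 : ℝ) < (K.choose k : ℕ) := by exact_mod_cast Nat.choose_pos hk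
  have hsm : ∀ s : Finset (Fin K), Measurable fun w : 𝒵 => ENNReal.ofReal (∑ a, (φ w a -
      (Γ s)ᵀ.mulVec (instr ψ x₁ s w) a) ^ 2) := fun s => by
    refine ENNReal.measurable_ofReal.comp (Finset.measurable_fun_sum _ fun a _ =>
      (((measurable_pi_apply a).comp hφ).sub ?_).pow_const 2)
    simp only [mulVec, dotProduct]
    refine Finset.measurable_fun_sum _ fun j _ => Measurable.const_mul ?_ _
    rcases j with j | j
    · exact hψ _
    · exact (measurable_pi_apply j).comp hx₁
  have e : ∀ ω, ENNReal.ofReal (approxError N ψ x₁ φ K k Γ fun i => z i ω) =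
      (N : ENNReal)⁻¹ * (((K.choose k : ℕ) : ENNReal)⁻¹ *
        ∑ s ∈ Finset.powersetCard k (Finset.univ : Finset (Fin K)), ∑ i : Fin N,
          ENNReal.ofReal (∑ a, (φ (z i ω) a - (Γ s)ᵀ.mulVec (instr ψ x₁ s (z i ω)) a) ^ 2)) := by
    intro ω
    rw [approxError, ENNReal.ofReal_mul (by positivity), ENNReal.ofReal_mul (by positivity),
      ENNReal.ofReal_inv_of_pos hN0, ENNReal.ofReal_inv_of_pos hc0, ENNReal.ofReal_natCast,
      ENNReal.ofReal_natCast, ENNReal.ofReal_sum_of_nonneg fun s _ => sq_nonneg _]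
    congr 2
    refine Finset.sum_congr rfl fun s _ => ?_
    rw [norm_sq_approx_eq, ENNReal.ofReal_sum_of_nonneg fun i _ =>
      Finset.sum_nonneg fun a _ => sq_nonneg _]
  have hmi : ∀ (s : Finset (Fin K)) (i : ℕ), Measurable fun ω => ENNReal.ofReal
      (∑ a, (φ (z i ω) a - (Γ s)ᵀ.mulVec (instr ψ x₁ s (z i ω)) a) ^ 2) := fun s i =>
    (hsm s).comp (hz i)
  simp_rw [e]
  rw [lintegral_const_mul _ ((Finset.measurable_fun_sum _ fun s _ =>
      Finset.measurable_fun_sum _ fun i _ => hmi s _).const_mul _),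
    lintegral_const_mul _ (Finset.measurable_fun_sum _ fun s _ =>
      Finset.measurable_fun_sum _ fun i _ => hmi s _),
    lintegral_finsetSum _ fun s _ => Finset.measurable_fun_sum _ fun i _ => hmi s _,
    mul_left_comm, Finset.mul_sum]
  congr 1
  refine Finset.sum_congr rfl fun s _ => ?_
  rw [lintegral_finsetSum _ fun i _ => hmi s _]
  have hi : ∀ i : Fin N, ∫⁻ ω, ENNReal.ofReal
      (∑ a, (φ (z i ω) a - (Γ s)ᵀ.mulVec (instr ψ x₁ s (z i ω)) a) ^ 2) ∂μ =
      ∫⁻ ω, ENNReal.ofReal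
      (∑ a, (φ (z 0 ω) a - (Γ s)ᵀ.mulVec (instr ψ x₁ s (z 0 ω)) a) ^ 2) ∂μ :=
    fun i => ((hident i).comp (hsm s)).lintegral_eq
  simp_rw [hi]
  rw [Finset.sum_const, Finset.card_univ, Fintype.card_fin, nsmul_eq_mul, ← mul_assoc,
    ENNReal.inv_mul_cancel (by exact_mod_cast hN.ne') (ENNReal.natCast_ne_top N), one_mul]

/-- `f'(I - P)f / N` tends to zero in probability: on the event that all instrument matrices have
full rank it is bounded by the approximation error of the instruments, whose mean tends to zero. -/
lemma tendstoProbOne_gram_sub_Hmat (hφ : Measurable φ) (hx₁ : Measurable x₁)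
    (hψ : ∀ j, Measurable (ψ j)) (hz : ∀ i, Measurable (z i))
    (hident : ∀ i, IdentDistrib (z i) (z 0) μ μ) {K k : ℕ → ℕ} (hkK : ∀ N, k N ≤ K N)
    (hrank : TendstoProbOne μ fun N ω => FullRank N ψ x₁ (K N) (k N) fun i => z i ω)
    (Γ : (N : ℕ) → (s : Finset (Fin (K N))) → Matrix ({j // j ∈ s} ⊕ Fin d₂) n ℝ)
    (hΓ : Tendsto (fun N => (((K N).choose (k N) : ℕ) : ENNReal)⁻¹ *
      ∑ s ∈ Finset.powersetCard (k N) (Finset.univ : Finset (Fin (K N))),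
        ∫⁻ ω, ENNReal.ofReal (∑ a, (φ (z 0 ω) a -
          (Γ N s)ᵀ.mulVec (instr ψ x₁ s (z 0 ω)) a) ^ 2) ∂μ) atTop (𝓝 0)) {δ : ℝ} (hδ : 0 < δ) :
    TendstoProbOne μ fun N ω => ‖(N : ℝ)⁻¹ • ((rows N fun i => φ (z i ω))ᵀ *
      ((csaP N ψ x₁ (K N) (k N) fun i => z i ω) * rows N fun i => φ (z i ω))) -
        Hmat N (rows N fun i => φ (z i ω))‖ ≤ δ := by
  have hsmall : TendstoProbOne μ fun N ω =>
      approxError N ψ x₁ φ (K N) (k N) (Γ N) (fun i => z i ω) < δ := by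
    rw [tendstoProbOne_iff]
    have h1 : Tendsto (fun N => ((((K N).choose (k N) : ℕ) : ENNReal)⁻¹ *
      ∑ s ∈ Finset.powersetCard (k N) (Finset.univ : Finset (Fin (K N))),
        ∫⁻ ω, ENNReal.ofReal (∑ a, (φ (z 0 ω) a -
          (Γ N s)ᵀ.mulVec (instr ψ x₁ s (z 0 ω)) a) ^ 2) ∂μ) / ENNReal.ofReal δ) atTop
        (𝓝 (0 / ENNReal.ofReal δ)) :=
      ENNReal.Tendsto.div_const hΓ (Or.inr (by simpa using hδ))
    rw [ENNReal.zero_div] at h1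
    refine tendsto_of_tendsto_of_tendsto_of_le_of_le' tendsto_const_nhds h1
      (Eventually.of_forall fun _ => zero_le) ?_
    filter_upwards [eventually_gt_atTop 0] with N hN
    have hm : Measurable fun ω => approxError N ψ x₁ φ (K N) (k N) (Γ N) fun i => z i ω := by
      simp only [approxError, norm_sq_eq_sum]
      refine ((Finset.measurable_fun_sum _ fun s _ => Finset.measurable_fun_sum _ fun i _ =>
        Finset.measurable_fun_sum _ fun a _ => Measurable.pow_const ?_ 2).const_mul _).const_mul _
      have h2 := (matMeasurable_instrMatrix (N := N) hx₁ hψ s).mul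
        (B := fun _ => Γ N s) fun _ _ => measurable_const
      exact (((measurable_pi_apply a).comp hφ).comp (hz i)).sub
        ((h2 i a).comp (measurable_pi_lambda (fun ω (i : Fin N) => z i ω) fun i => hz i))
    rw [← lintegral_approxError hφ hx₁ hψ hz hident hN (hkK N)]
    refine le_trans (measure_mono fun ω hω => ?_) (meas_ge_le_lintegral_div
      (ENNReal.measurable_ofReal.comp hm).aemeasurable (by simpa using hδ) ENNReal.ofReal_ne_top)
    simp only [Set.mem_ofPred_eq, not_lt] at hω ⊢
    exact ENNReal.ofReal_le_ofReal hω
  refine (hrank.and hsmall).mono (Eventually.of_forall fun N => ae_of_all _ fun ω ⟨h1, h2⟩ => ?_)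
  refine le_trans ?_ h2.le
  set F := rows N fun i => φ (z i ω)
  have e : (N : ℝ)⁻¹ • (Fᵀ * ((csaP N ψ x₁ (K N) (k N) fun i => z i ω) * F)) - Hmat N F =
      -((N : ℝ)⁻¹ • (Fᵀ * (1 - csaP N ψ x₁ (K N) (k N) fun i => z i ω) * F)) := by
    rw [Hmat, ← smul_sub, ← smul_neg]
    congr 1
    simp only [Matrix.mul_sub, Matrix.sub_mul, Matrix.mul_one, Matrix.mul_assoc, neg_sub]
  rw [e, norm_neg, norm_smul, norm_inv, Real.norm_natCast, approxError]
  gcongr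
  exact norm_transpose_mul_one_sub_csaP_mul_le N ψ x₁ _ (hkK N) h1 F (Γ N)

variable [IsProbabilityMeasure μ]

lemma tendstoProbOne_of_tendsto_ae {X : ℕ → Ω → ℝ} {c : ℝ}
    (hX : ∀ N, AEStronglyMeasurable (X N) μ)
    (h : ∀ᵐ ω ∂μ, Tendsto (fun N => X N ω) atTop (𝓝 c)) {δ : ℝ} (hδ : 0 < δ) :
    TendstoProbOne μ fun N ω => |X N ω - c| ≤ δ := by
  rw [tendstoProbOne_iff]
  have h1 := tendstoInMeasure_iff_norm.1
    (tendstoInMeasure_of_tendsto_ae (g := fun _ => c) hX h) δ hδ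
  refine tendsto_of_tendsto_of_tendsto_of_le_of_le tendsto_const_nhds h1 (fun _ => zero_le)
    fun N => measure_mono fun ω hω => ?_
  simp only [Set.mem_ofPred_eq, not_le] at hω ⊢
  exact hω.le

/-- The law of large numbers for `f'f / N`. -/
lemma tendstoProbOne_Hmat (hφ : Measurable φ) (hz : ∀ i, Measurable (z i)) (hindep : iIndepFun z μ)
    (hident : ∀ i, IdentDistrib (z i) (z 0) μ μ) {B : ℝ}
    (hB : ∀ᵐ ω ∂μ, ∀ a, |φ (z 0 ω) a| ≤ B) {δ : ℝ} (hδ : 0 < δ) :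
    TendstoProbOne μ fun N ω => ‖Hmat N (rows N fun i => φ (z i ω)) -
      Matrix.of fun a b => ∫ ω, φ (z 0 ω) a * φ (z 0 ω) b ∂μ‖ ≤ δ := by
  set q : ℝ := (Fintype.card n : ℝ) with hq
  have hq0 : 0 ≤ q := by positivity
  have hφa : ∀ a, Measurable fun w => φ w a := fun a => (measurable_pi_apply a).comp hφ
  have hent : ∀ p : n × n, TendstoProbOne μ fun N ω =>
      |(∑ i ∈ Finset.range N, φ (z i ω) p.1 * φ (z i ω) p.2) / N -
        ∫ ω, φ (z 0 ω) p.1 * φ (z 0 ω) p.2 ∂μ| ≤ δ / (q * q + 1) := by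
    intro p
    have hp : Measurable fun w => φ w p.1 * φ w p.2 := (hφa p.1).mul (hφa p.2)
    refine tendstoProbOne_of_tendsto_ae (fun N => ?_) ?_ (by positivity)
    · exact ((Finset.measurable_fun_sum _ fun i _ =>
        hp.comp (hz i)).div_const _).aestronglyMeasurable
    · refine strong_law_ae_real (fun i ω => φ (z i ω) p.1 * φ (z i ω) p.2) ?_ ?_ ?_
      · refine Integrable.of_bound (hp.comp (hz 0)).aestronglyMeasurable (B * B) ?_
        filter_upwards [hB] with ω h
        rw [Real.norm_eq_abs, abs_mul]
        exact mul_le_mul (h _) (h _) (abs_nonneg _) ((abs_nonneg _).trans (h p.1))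
      · intro i j hij
        exact (hindep.indepFun hij).comp hp hp
      · exact fun i => (hident i).comp hp
  refine (TendstoProbOne.forall_fintype hent).mono
    (Eventually.of_forall fun N => ae_of_all _ fun ω h => ?_)
  refine (norm_le_of_abs_le (c := δ / (q * q + 1)) _ fun a b => ?_).trans ?_
  · convert! h (a, b) using 2
    rw [Matrix.sub_apply, Hmat, Matrix.smul_apply, mul_apply, smul_eq_mul, div_eq_inv_mul,
      ← Fin.sum_univ_eq_sum_range fun i => φ (z i ω) a * φ (z i ω) b]
    rfl
  · rw [mul_div_assoc', div_le_iff₀ (by positivity)]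
    nlinarith [mul_nonneg hq0 hq0]

lemma tendstoProbOne_fullRank (hx₁ : Measurable x₁) (hψ : ∀ j, Measurable (ψ j))
    (hz : ∀ i, Measurable (z i)) {K k : ℕ → ℕ}
    (h : Tendsto (fun N => μ {ω | FullRank N ψ x₁ (K N) (k N) fun i => z i ω}) atTop (𝓝 1)) :
    TendstoProbOne μ fun N ω => FullRank N ψ x₁ (K N) (k N) fun i => z i ω := by
  rw [tendstoProbOne_iff]
  have h1 : Tendsto (fun N => 1 - μ {ω | FullRank N ψ x₁ (K N) (k N) fun i => z i ω}) atTop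
      (𝓝 (1 - 1)) := ENNReal.Tendsto.sub tendsto_const_nhds h (Or.inl ENNReal.one_ne_top)
  rw [tsub_self] at h1
  refine h1.congr fun N => ?_
  rw [← prob_compl_eq_one_sub (measurableSet_fullRank hx₁ hψ hz N (K N) (k N))]
  rfl

end Design

/-! ### The estimation error -/

/-- The estimation error `β̂ - β = (X'PX)⁻¹ X'Pε`, when `X'PX` is nonsingular. -/
lemma replicateCol_ivEstimator_sub {m n : Type*} [Fintype m] [Fintype n] [DecidableEq n]
    {P : Matrix m m ℝ} {X : Matrix m n ℝ} (h : IsUnit (Xᵀ * P * X).det) {y : m → ℝ}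
    {β : n → ℝ} {e : Matrix m Unit ℝ} (hy : replicateCol Unit y = X * replicateCol Unit β + e) :
    replicateCol Unit (ivEstimator P X y - β) = (Xᵀ * P * X)⁻¹ * (Xᵀ * P * e) := by
  have h1 : replicateCol Unit (ivEstimator P X y) =
      (Xᵀ * P * X)⁻¹ * (Xᵀ * P * replicateCol Unit y) := by
    rw [ivEstimator, replicateCol_mulVec, replicateCol_mulVec]
  have h2 : replicateCol Unit (ivEstimator P X y - β) =
      replicateCol Unit (ivEstimator P X y) - replicateCol Unit β := rfl
  rw [h2, h1, hy, Matrix.mul_add, Matrix.mul_add, ← Matrix.mul_assoc (Xᵀ * P) X,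
    ← Matrix.mul_assoc _ (Xᵀ * P * X), nonsing_inv_mul _ h, Matrix.one_mul, add_sub_cancel_left]

section Design

attribute [local instance] Matrix.frobeniusNormedAddCommGroup Matrix.frobeniusNormedSpace

variable {Ω 𝒵 n : Type*} [mΩ : MeasurableSpace Ω] [MeasurableSpace 𝒵] {μ : Measure Ω}
  [IsProbabilityMeasure μ] {d₂ : ℕ} [Fintype n] [DecidableEq n]
  {z : ℕ → Ω → 𝒵} {x₁ : 𝒵 → Fin d₂ → ℝ} {ψ : ℕ → 𝒵 → ℝ} {φ : 𝒵 → n → ℝ}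

/-- Complete subset averaging satisfies the conditions under which the leading term dominates. -/
theorem exists_isRegularDesign (hφ : Measurable φ) (hx₁ : Measurable x₁)
    (hψ : ∀ j, Measurable (ψ j)) (hz : ∀ i, Measurable (z i)) (hindep : iIndepFun z μ)
    (hident : ∀ i, IdentDistrib (z i) (z 0) μ μ)
    (hB : ∃ B : ℝ, ∀ i, ∀ᵐ ω ∂μ, ∀ a, |φ (z i ω) a| ≤ B)
    (hH : IsUnit (Matrix.of fun a b => ∫ ω, φ (z 0 ω) a * φ (z 0 ω) b ∂μ).det) {K k : ℕ → ℕ}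
    (hrank : Tendsto (fun N => μ {ω | FullRank N ψ x₁ (K N) (k N) fun i => z i ω}) atTop (𝓝 1))
    (Γ : (N : ℕ) → (s : Finset (Fin (K N))) → Matrix ({j // j ∈ s} ⊕ Fin d₂) n ℝ)
    (hΓ : Tendsto (fun N => (((K N).choose (k N) : ℕ) : ENNReal)⁻¹ *
      ∑ s ∈ Finset.powersetCard (k N) (Finset.univ : Finset (Fin (K N))),
        ∫⁻ ω, ENNReal.ofReal (∑ a, (φ (z 0 ω) a -
          (Γ N s)ᵀ.mulVec (instr ψ x₁ s (z 0 ω)) a) ^ 2) ∂μ) atTop (𝓝 0))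
    (hkK : ∀ N, k N ≤ K N) (hk : Tendsto k atTop atTop)
    (hkN : Tendsto (fun N => (k N : ℝ) ^ 2 / (N : ℝ)) atTop (𝓝 0)) :
    ∃ B : ℝ, IsRegularDesign μ z (fun N ω => rows N fun i => φ (z i ω))
      (fun N ω => csaP N ψ x₁ (K N) (k N) fun i => z i ω) k d₂ B
      (Matrix.of fun a b => ∫ ω, φ (z 0 ω) a * φ (z 0 ω) b ∂μ) := by
  obtain ⟨B, hB⟩ := hB
  have hfull := tendstoProbOne_fullRank hx₁ hψ hz hrank
  exact ⟨|B|, {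
    meas_F := fun N i a => measurable_sample_coeff (matMeasurable_rows hφ N) i a
    meas_P := fun N i j => measurable_sample_coeff (matMeasurable_sampleProj hx₁ hψ) i j
    symm := fun N ω => transpose_csaP N ψ x₁ _ _ _
    norm_mul_le := fun N ω => norm_csaP_mul_le N ψ x₁ _ (hkK N) _
    norm_sq_le := fun N ω => norm_csaP_sq_le N ψ x₁ _ (hkK N)
    trace_le := fun N ω => trace_csaP_le N ψ x₁ _ (hkK N)
    diag_nonneg := fun N ω i => csaP_diag_nonneg N ψ x₁ _ i
    norm_quadratic_le := fun N ω U => norm_quadratic_csaP_le N ψ x₁ _ U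
    bound_nonneg := abs_nonneg B
    bound := fun N => by
      filter_upwards [ae_all_iff.2 hB] with ω h i a
      exact (h i a).trans (le_abs_self B)
    trace_eq := hfull.mono (Eventually.of_forall fun N => ae_of_all _ fun ω h =>
      trace_csaP N ψ x₁ _ (hkK N) h)
    approx := fun δ hδ => tendstoProbOne_gram_sub_Hmat hφ hx₁ hψ hz hident hkK hfull Γ hΓ hδ
    limit := fun δ hδ => tendstoProbOne_Hmat hφ hz hindep hident (hB 0) hδ
    limit_isUnit := hH
    size := hk
    rate := hkN }⟩

end Design

end CSA

theorem theorem1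
    {Ω 𝒵 : Type*} [MeasurableSpace Ω] [MeasurableSpace 𝒵]
    (μ : Measure Ω) [IsProbabilityMeasure μ] {d₁ d₂ : ℕ}
    -- the observations, the included exogenous variables, the instruments and `g(z) = E[Y | z]`
    (y : ℕ → Ω → ℝ) (Y : ℕ → Ω → Fin d₁ → ℝ) (z : ℕ → Ω → 𝒵)
    (x₁ : 𝒵 → Fin d₂ → ℝ) (ψ : ℕ → 𝒵 → ℝ) (g : 𝒵 → Fin d₁ → ℝ)
    (β : Fin d₁ ⊕ Fin d₂ → ℝ) (σε2 : ℝ) (σue : Fin d₁ ⊕ Fin d₂ → ℝ)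
    -- the number of instruments and the subset size as functions of the sample size
    (K k : ℕ → ℕ)
    (hy : ∀ i, Measurable (y i)) (hY : ∀ i, Measurable (Y i)) (hz : ∀ i, Measurable (z i))
    (hx₁ : Measurable x₁) (hψ : ∀ j, Measurable (ψ j)) (hg : Measurable g)
    -- the errors
    (ε : ℕ → Ω → ℝ) (u : ℕ → Ω → Fin d₁ ⊕ Fin d₂ → ℝ)
    (hε : ∀ i ω, ε i ω = CSA.structuralError x₁ β (y i ω) (Y i ω) (z i ω))
    (hu : ∀ i ω, u i ω = CSA.reducedFormError g x₁ (Y i ω) (z i ω))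
    -- i.i.d. observations with finite fourth moments, and the error variance
    (hindep : iIndepFun (fun i ω => (y i ω, Y i ω, z i ω)) μ)
    (hident : ∀ i, IdentDistrib (fun ω => (y i ω, Y i ω, z i ω))
      (fun ω => (y 0 ω, Y 0 ω, z 0 ω)) μ μ)
    (hy4 : ∀ i, MemLp (y i) 4 μ) (hY4 : ∀ i a, MemLp (fun ω => Y i ω a) 4 μ)
    (hσε : ∀ i, ∫ ω, ε i ω ^ 2 ∂μ = σε2) (hσε_pos : 0 < σε2)
    -- conditional means
    (hε0 : ∀ i, μ[ε i | MeasurableSpace.comap (z i) inferInstance] =ᵐ[μ] 0)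
    (hgY : ∀ i a, μ[fun ω => Y i ω a | MeasurableSpace.comap (z i) inferInstance]
      =ᵐ[μ] fun ω => g (z i ω) a)
    -- conditional moments up to order four are constant
    (hmom : ∃ c : Fin d₁ ⊕ Fin d₂ → ℕ → ℕ → ℝ, ∀ i a r s, r + s ≤ 4 →
      μ[fun ω => ε i ω ^ r * u i ω a ^ s | MeasurableSpace.comap (z i) inferInstance]
        =ᵐ[μ] fun _ => c a r s)
    -- `f` is bounded and `E[f f']` is nonsingular
    (hfb : ∃ B : ℝ, ∀ i, ∀ᵐ ω ∂μ, ∀ a, |CSA.reducedForm g x₁ (z i ω) a| ≤ B)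
    (hH : IsUnit (Matrix.of fun a b =>
      ∫ ω, CSA.reducedForm g x₁ (z 0 ω) a * CSA.reducedForm g x₁ (z 0 ω) b ∂μ).det)
    -- with probability approaching one, all the subset instrument matrices have full rank
    (hrank : Tendsto (fun N => μ {ω | ∀ s ∈ Finset.powersetCard (k N)
        (Finset.univ : Finset (Fin (K N))),
        IsUnit ((CSA.instrMatrix N ψ x₁ s fun i => z i ω).transpose *
          CSA.instrMatrix N ψ x₁ s fun i => z i ω).det}) atTop (𝓝 1))
    -- the largest diagonal element of `P^k` tends to zero in probability
    (hdiag : ∀ δ : ℝ, 0 < δ → Tendsto (fun N => μ {ω | ∃ i : Fin N,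
        δ < CSA.csaP N ψ x₁ (K N) (k N) (fun j => z j ω) i i}) atTop (𝓝 0))
    -- on average over the subsets, the instruments approximate `f` in mean square
    (happrox : ∃ Γ : (N : ℕ) → (s : Finset (Fin (K N))) →
        Matrix ({j // j ∈ s} ⊕ Fin d₂) (Fin d₁ ⊕ Fin d₂) ℝ,
      Tendsto (fun N => (((K N).choose (k N) : ℕ) : ENNReal)⁻¹ *
        ∑ s ∈ Finset.powersetCard (k N) (Finset.univ : Finset (Fin (K N))),
          ∫⁻ ω, ENNReal.ofReal (∑ a, (CSA.reducedForm g x₁ (z 0 ω) a -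
            (Γ N s).transpose.mulVec (CSA.instr ψ x₁ s (z 0 ω)) a) ^ 2) ∂μ)
        atTop (𝓝 0))
    -- the rates
    (hkK : ∀ N, k N ≤ K N) (hk : Tendsto k atTop atTop)
    (hkN : Tendsto (fun N => (k N : ℝ) ^ 2 / (N : ℝ)) atTop (𝓝 0))
    -- endogeneity
    (hσue : ∀ i a, μ[fun ω => u i ω a * ε i ω | MeasurableSpace.comap (z i) inferInstance]
      =ᵐ[μ] fun _ => σue a)
    (hσue_ne : σue ≠ 0)
    -- the sample matrices, the estimator, and the leading terms
    (f : (N : ℕ) → Ω → Matrix (Fin N) (Fin d₁ ⊕ Fin d₂) ℝ)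
    (hf : ∀ N ω, f N ω = CSA.rows N fun i => CSA.reducedForm g x₁ (z i ω))
    (P : (N : ℕ) → Ω → Matrix (Fin N) (Fin N) ℝ)
    (hP : ∀ N ω, P N ω = CSA.csaP N ψ x₁ (K N) (k N) fun i => z i ω)
    (βhat : ℕ → Ω → Fin d₁ ⊕ Fin d₂ → ℝ)
    (hβhat : ∀ N ω, βhat N ω = CSA.ivEstimator (P N ω)
      (CSA.rows N fun i => CSA.regressor x₁ (Y i ω) (z i ω)) (fun i : Fin N => y i ω))
    (S : ℕ → Ω → Matrix (Fin d₁ ⊕ Fin d₂) (Fin d₁ ⊕ Fin d₂) ℝ)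
    (hS : ∀ N ω, S N ω = CSA.Smat N (k N) σue σε2 (f N ω) (P N ω)) :
    ∃ Q r T : ℕ → Ω → Matrix (Fin d₁ ⊕ Fin d₂) (Fin d₁ ⊕ Fin d₂) ℝ,
      -- the decomposition of the scaled squared error
      (∀ (N : ℕ) ω, (N : ℝ) • Matrix.vecMulVec (βhat N ω - β) (βhat N ω - β) = Q N ω + r N ω) ∧
      -- the entries of `Q` are polynomials of degree at most four in the errors
      (∀ N a b, ∃ p : CSA.ErrPoly 𝒵 (Fin d₁ ⊕ Fin d₂) N, p.totalDegree ≤ 4 ∧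
        (∀ e, Measurable (p.coeff e)) ∧
        ∀ ω, Q N ω a b = p.value (fun i => z i ω) (fun i => ε i ω) (fun i => u i ω)) ∧
      -- the conditional expectation of `Q` given `z_1, …, z_N`
      (∀ N a b, CSA.HasCondExp μ
        (MeasurableSpace.comap (fun ω (i : Fin N) => z i ω) inferInstance)
        (fun ω => Q N ω a b)
        (fun ω => (σε2 • (CSA.Hmat N (f N ω))⁻¹ + S N ω + T N ω) a b)) ∧
      -- the remainders are of smaller order in probability than `S`
      CSA.IsLittleOProb μ r (fun N ω => CSA.frob (S N ω)) ∧
      CSA.IsLittleOProb μ T (fun N ω => CSA.frob (S N ω)) := by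
  have hφ := CSA.measurable_reducedForm hx₁ hg
  obtain ⟨Γ, hΓ⟩ := happrox
  obtain ⟨τ, C, M⟩ := CSA.exists_errorModel hy hY hz hx₁ hg hε hu hindep hy4 hY4 hσε hε0 hgY hmom
    hfb hσue hσue_ne
  have hsnd : Measurable fun w : ℝ × (Fin d₁ → ℝ) × 𝒵 => w.2.2 := measurable_snd.comp measurable_snd
  obtain ⟨B, D⟩ := CSA.exists_isRegularDesign hφ hx₁ hψ hz
    (hindep.comp (fun _ w => w.2.2) fun _ => hsnd) (fun i => (hident i).comp hsnd) hfb hH hrank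
    Γ hΓ hkK hk hkN
  obtain rfl : f = fun N ω => CSA.rows N fun i => CSA.reducedForm g x₁ (z i ω) :=
    funext fun N => funext (hf N)
  obtain rfl : P = fun N ω => CSA.csaP N ψ x₁ (K N) (k N) fun i => z i ω :=
    funext fun N => funext (hP N)
  obtain rfl : S = fun N ω => CSA.Smat N (k N) σue σε2 _ _ := funext fun N => funext (hS N)
  have hX : ∀ N ω, (CSA.rows N fun i => CSA.regressor x₁ (Y i ω) (z i ω)) =
      (CSA.rows N fun i => CSA.reducedForm g x₁ (z i ω)) + CSA.errMat N u ω := by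
    intro N ω
    ext i a
    simp [CSA.rows, CSA.errMat, hu, CSA.reducedFormError]
  have hv : ∀ N ω, Matrix.replicateCol Unit (fun i : Fin N => y i ω) =
      (CSA.rows N fun i => CSA.regressor x₁ (Y i ω) (z i ω)) * Matrix.replicateCol Unit β +
        CSA.errCol N ε ω := by
    intro N ω
    ext i a
    simp [CSA.rows, CSA.errCol, hε, CSA.structuralError, Matrix.mul_apply, dotProduct]
  obtain ⟨T, hT, hTo⟩ := D.exists_condExp_leadingTerm M hσε_pos hσue_ne
  refine ⟨fun N ω => CSA.leadingTerm (CSA.rows N fun i => CSA.reducedForm g x₁ (z i ω))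
      (CSA.csaP N ψ x₁ (K N) (k N) fun i => z i ω) (CSA.errMat N u ω) (CSA.errCol N ε ω), _, T,
    fun N ω => (add_sub_cancel _ _).symm, fun N a b => ?_, fun N a b => hT N a b, ?_, hTo⟩
  · exact CSA.matIsErrPoly_leadingTerm (CSA.matMeasurable_rows hφ N)
      (CSA.matMeasurable_sampleProj (N := N) (K := K N) (k := k N) hx₁ hψ) a b
  · refine D.isLittleOProb_error_sub_leadingTerm M hσε_pos.le hσue_ne fun N ω hdet => ?_
    rw [← hX] at hdet ⊢
    rw [hβhat]
    exact CSA.replicateCol_ivEstimator_sub hdet (hv N ω)
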